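/- **Setting.** Let $U_I=S^2\setminus\{(0,0,\pm1)\}$ with spherical coordinates $(\theta,\phi)$, and let $\rho_I(p)$ be the unit tangent vector at $p\in U_I$ in the direction of increasing $\phi$. For $R\in SO(3)$ put $U_R=RU_I$ and $\rho_R(Rp)=R_*\rho_I(p)$. Orient $S^2$ so that $(\partial_x,\partial_y)$ is an oriented basis at the south pole. Fix $s\in\mathbb Z$. A *random spin $s$ field* $G$ on a probability space $(\Omega,P)$ is a family of functions $G_R:U_R\times\Omega\to\mathbb C$ ($R\in SO(3)$), each jointly measurable, such that for all $R_1,R_2$ and $p\in U_{R_1}\cap U_{R_2}$ almost surely $G_{R_2}(p)=e^{is\psi}G_{R_1}(p)$, where $\psi$ is the angle from $\rho_{R_1}(p)$ to $\rho_{R_2}(p)$, and such that $E\int_{S^2}|G|^2\,dS<\infty$, where $|G|=|G_R|$. It is - *isotropic* if for all $x_1,\dots,x_N\in U_I$ the joint law of $G_R(Rx_1),\dots,G_R(Rx_N)$ does not depend on $R\in SO(3)$; - *Gaussian* if $\{\Re G_I(x):x\in U_I\}\cup\{\Im G_I(x):x\in U_I\}$ is a Gaussian family; - *involutive* if almost surely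 $\overline{A_{lm}}=A_{l,-m}$ for all $l\ge|s|$, $|m|\le l$, where $A_{lm}=\langle G,{}_sY_{lm}\rangle=\int_{S^2}G_I\,\overline{{}_sY_{lm}}\,dS$. Here $Y_{lm}$ are the orthonormal spherical harmonics $$Y_{lm}(\theta,\phi)=e^{im\phi}(-1)^{\max(-m,0)}\frac{1}{l!}\Big[\frac{(l+m)!(l-m)!(2l+1)}{4\pi}\Big]^{1/2}\sin^{2l}(\theta/2)\sum_r\binom lr\binom l{r-m}(-1)^{l-r}\cot^{2r-m}(\theta/2),$$ so that $\overline{Y_{lm}}=Y_{l,-m}$, and, for $l\ge|s|$, $|m|\le l$, the spin $s$ spherical harmonics are ${}_sY_{lm}=\big[\tfrac{(l-s)!}{(l+s)!}\big]^{1/2}\partial^sY_{lm}$ if $s\ge0$ and ${}_sY_{lm}=\big[\tfrac{(l+s)!}{(l-s)!}\big]^{1/2}(-\overline\partial)^{-s}Y_{lm}$ if $s<0$, where on functions of spin $\sigma$ over $U_I$ $$\partial=-(\sin\theta)^{\sigma}\Big(\tfrac{\partial}{\partial\theta}+\tfrac{i}{\sin\theta}\tfrac{\partial}{\partial\phi}\Big)(\sin\theta)^{-\sigma},\qquad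 \overline\partial=-(\sin\theta)^{-\sigma}\Big(\tfrac{\partial}{\partial\theta}-\tfrac{i}{\sin\theta}\tfrac{\partial}{\partial\phi}\Big)(\sin\theta)^{\sigma},$$ $\partial$ raising and $\overline\partial$ lowering the spin by one. Let $\lambda_{ls}=(l-s)(l+s+1)$ if $s\ge0$ and $\lambda_{ls}=(l+s)(l-s+1)$ if $s<0$. Let $a>1$, and let $f:\mathbb R\to\mathbb R$ be smooth, supported in $[1/a^2,a^2]$, with $\sum_{j\in\mathbb Z}f^2(a^{2j}u)=1$ for all $u>0$. For $j\in\mathbb Z$ put $$\widehat\Gamma_j=\sum_{l\ge|s|}\ \sum_{m=-l}^{l}f^2(a^{2j}\lambda_{ls})\,|A_{lm}|^2 .$$ **Proposition.** Let $G$ be a Gaussian, involutive, isotropic random spin $s$ field. Then for every $l\ge|s|$ the number $C_l:=E|A_{lm}|^2$ is the same for all $|m|\le l$, and for every $j\in\mathbb Z$ the random variable $\widehat\Gamma_j$ is square integrable with $$\operatorname{Var}(\widehat\Gamma_j)=\sum_{l\ge|s|}2f^4(a^{2j}\lambda_{ls})\,C_l^2\,(2l+1).$$ If moreover for some $c,C>0$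 and some $\alpha>2$ one has $c\,l^{-\alpha}\le C_l\le C\,l^{-\alpha}$ for all $l\ge|s|$ with $l>0$, then $$\frac{\widehat\Gamma_j-E\widehat\Gamma_j}{\sqrt{\operatorname{Var}(\widehat\Gamma_j)}}\longrightarrow N(0,1)\quad\text{in law as } j\to-\infty .$$ -/

import Mathlib

open MeasureTheory ProbabilityTheory Filter Topology
open scoped Matrix ENNReal

namespace SpinField

noncomputable section

/-! ### The sphere, rotations, charts and reference directions -/

/-- The unit sphere of `ℝ³`. -/
abbrev Sphere2 : Type := Metric.sphere (0 : EuclideanSpace ℝ (Fin 3)) 1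

/-- The rotation group `SO(3)`. -/
abbrev SO3 : Type := Matrix.specialOrthogonalGroup (Fin 3) ℝ

/-- The Cartesian coordinates of a point of the sphere. -/
def vec (p : Sphere2) : Fin 3 → ℝ := WithLp.ofLp p.1

theorem norm_toLp_mulVec (R : SO3) (p : Sphere2) :
    ‖WithLp.toLp 2 (R.1 *ᵥ vec p)‖ = 1 := by
  have hR : R.1ᵀ * R.1 = 1 := by
    have h := (Matrix.mem_specialOrthogonalGroup_iff.1 R.2).1
    exact (Matrix.mem_orthogonalGroup_iff' (Fin 3) ℝ).1 h
  have hp : ‖(p : EuclideanSpace ℝ (Fin 3))‖ = 1 := by simp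
  have key : ∀ v : Fin 3 → ℝ, ‖WithLp.toLp 2 v‖ ^ 2 = v ⬝ᵥ v := by
    intro v
    rw [EuclideanSpace.norm_sq_eq]
    simp [dotProduct, pow_two]
  have h2 : ‖WithLp.toLp 2 (R.1 *ᵥ vec p)‖ ^ 2 = 1 := by
    rw [key, Matrix.dotProduct_mulVec, Matrix.vecMul_mulVec, hR, Matrix.vecMul_one, ← key]
    have : WithLp.toLp 2 (vec p) = (p : EuclideanSpace ℝ (Fin 3)) := rfl
    rw [this, hp, one_pow]
  nlinarith [norm_nonneg (WithLp.toLp 2 (R.1 *ᵥ vec p))]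

/-- The action of `SO(3)` on the sphere. -/
def rotate (R : SO3) (p : Sphere2) : Sphere2 :=
  ⟨WithLp.toLp 2 (R.1 *ᵥ vec p), by
    rw [mem_sphere_zero_iff_norm]; exact norm_toLp_mulVec R p⟩

/-- `U_I`: the sphere without the two poles `(0, 0, ±1)`. -/
def chartI : Set Sphere2 := {p | ¬ (vec p = ![0, 0, 1] ∨ vec p = ![0, 0, -1])}

/-- `U_R = R U_I`. -/
def chart (R : SO3) : Set Sphere2 := rotate R '' chartI

/-- The reference direction `ρ_I(p)`: the unit tangent vector at `p ∈ U_I` to the circle of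
latitude through `p`, pointing in the direction of increasing longitude. -/
def rhoI (p : Sphere2) : Fin 3 → ℝ :=
  (Real.sqrt (vec p 0 ^ 2 + vec p 1 ^ 2))⁻¹ • ![-vec p 1, vec p 0, 0]

/-- The reference direction `ρ_R(p) = R_* ρ_I(R⁻¹ p)` at `p ∈ U_R`. -/
def rho (R : SO3) (p : Sphere2) : Fin 3 → ℝ := R.1 *ᵥ rhoI (rotate R⁻¹ p)

/-- Rotation by a right angle in the tangent plane at `p`, for the orientation of the sphere in
which `(∂/∂x, ∂/∂y)` is an oriented basis at the south pole and `(∂/∂y, ∂/∂x)` at the north pole. -/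
def rot90 (p : Sphere2) (v : Fin 3 → ℝ) : Fin 3 → ℝ := crossProduct v (vec p)

/-- The angle in `(-π, π]` from the tangent vector `v` to the tangent vector `w` at `p`. -/
def angle (p : Sphere2) (v w : Fin 3 → ℝ) : ℝ :=
  Complex.arg ⟨v ⬝ᵥ w, rot90 p v ⬝ᵥ w⟩

/-- The transition function `exp (i s ψ)` of the spin `s` line bundle from the chart `U_{R₁}` to
the chart `U_{R₂}` at `p`, where `ψ` is the angle from `ρ_{R₁}(p)` to `ρ_{R₂}(p)`. -/
def transition (s : ℤ) (R₁ R₂ : SO3) (p : Sphere2) : ℂ :=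
  Complex.exp (Complex.I * (s : ℂ) * (angle p (rho R₁ p) (rho R₂ p) : ℂ))

/-- The usual surface measure on the sphere (of total mass `4π`). -/
def surface : Measure Sphere2 := (volume : Measure (EuclideanSpace ℝ (Fin 3))).toSphere

/-- The colatitude `θ ∈ (0, π)` of a point of `U_I`. -/
def colat (p : Sphere2) : ℝ := Real.arccos (vec p 2)

/-- The longitude `φ` of a point of `U_I`. -/
def longit (p : Sphere2) : ℝ := Complex.arg ⟨vec p 0, vec p 1⟩

/-! ### Spin spherical harmonics -/

/-- The binomial coefficient `n` over `k`, which is zero for `k < 0`. -/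
def binom (n : ℕ) (k : ℤ) : ℝ := if k < 0 then 0 else (n.choose k.toNat : ℝ)

/-- The orthonormal spherical harmonics `Y_{lm}` (`|m| ≤ l`) in the coordinates `(θ, φ)`, with the
normalization of signs for which the complex conjugate of `Y_{lm}` is `Y_{l,-m}`. -/
def sphY (l : ℕ) (m : ℤ) (θ φ : ℝ) : ℂ :=
  Complex.exp (Complex.I * (m : ℂ) * (φ : ℂ)) *
    (((-1 : ℝ) ^ (-m).toNat *
      (Real.sqrt ((((l : ℤ) + m).toNat.factorial : ℝ) * (((l : ℤ) - m).toNat.factorial : ℝ) *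
        (2 * l + 1) / (4 * Real.pi)) / (l.factorial : ℝ)) *
      Real.sin (θ / 2) ^ (2 * l) *
      ∑ r ∈ Finset.range (l + 1), (l.choose r : ℝ) * binom l ((r : ℤ) - m) * (-1) ^ (l - r) *
        Real.cot (θ / 2) ^ (2 * (r : ℤ) - m) : ℝ) : ℂ)

/-- The spin-raising operator `∂`, from spin `s` to spin `s + 1`, in the coordinates `(θ, φ)`:
`-(sin θ)^s (∂/∂θ + (i / sin θ) ∂/∂φ) (sin θ)^(-s)`. -/
def edth (s : ℤ) (h : ℝ → ℝ → ℂ) (θ φ : ℝ) : ℂ :=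
  -((Real.sin θ : ℂ) ^ s) *
    (deriv (fun t : ℝ => (Real.sin t : ℂ) ^ (-s) * h t φ) θ +
      Complex.I / (Real.sin θ : ℂ) * deriv (fun u : ℝ => (Real.sin θ : ℂ) ^ (-s) * h θ u) φ)

/-- The spin-lowering operator `∂̄`, from spin `s` to spin `s - 1`, in the coordinates `(θ, φ)`:
`-(sin θ)^(-s) (∂/∂θ - (i / sin θ) ∂/∂φ) (sin θ)^s`. -/
def edthBar (s : ℤ) (h : ℝ → ℝ → ℂ) (θ φ : ℝ) : ℂ :=
  -((Real.sin θ : ℂ) ^ (-s)) *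
    (deriv (fun t : ℝ => (Real.sin t : ℂ) ^ s * h t φ) θ -
      Complex.I / (Real.sin θ : ℂ) * deriv (fun u : ℝ => (Real.sin θ : ℂ) ^ s * h θ u) φ)

/-- `∂ⁿ`, applied to a function of spin `0`. -/
def edthPow : ℕ → (ℝ → ℝ → ℂ) → ℝ → ℝ → ℂ
  | 0, h => h
  | n + 1, h => edth (n : ℤ) (edthPow n h)

/-- `(-∂̄)ⁿ`, applied to a function of spin `0`. -/
def negEdthBarPow : ℕ → (ℝ → ℝ → ℂ) → ℝ → ℝ → ℂ
  | 0, h => h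
  | n + 1, h => fun θ φ => -edthBar (-(n : ℤ)) (negEdthBarPow n h) θ φ

/-- The spin `s` spherical harmonic `ₛY_{lm}` (`l ≥ |s|`, `|m| ≤ l`), trivialized over `U_I` and
expressed in the coordinates `(θ, φ)`. -/
def spinYCoord (s : ℤ) (l : ℕ) (m : ℤ) (θ φ : ℝ) : ℂ :=
  (Real.sqrt (((l - s.natAbs).factorial : ℝ) / ((l + s.natAbs).factorial : ℝ)) : ℂ) *
    (if 0 ≤ s then edthPow s.natAbs (sphY l m) θ φ else negEdthBarPow s.natAbs (sphY l m) θ φ)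

/-- `ₛY_{lm,I}` as a function on `U_I`. -/
def spinY (s : ℤ) (l : ℕ) (m : ℤ) (p : Sphere2) : ℂ := spinYCoord s l m (colat p) (longit p)

/-- The eigenvalue `λ_{ls}` of the spin `s` Laplacian. -/
def eigen (s : ℤ) (l : ℕ) : ℝ :=
  if 0 ≤ s then ((l : ℝ) - s) * ((l : ℝ) + s + 1) else ((l : ℝ) + s) * ((l : ℝ) - s + 1)

/-! ### Random spin fields -/

variable {Ω : Type*} [MeasurableSpace Ω]

/-- A random spin `s` field on the probability space `(Ω, P)`. The value at `p` is given by its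
trivializations `G_R(p)`, for all `R` with `p ∈ U_R`; the values of `toFun R p` for `p ∉ U_R` carry
no meaning and are never used. At each point the trivializations are almost surely those of an
element of the fibre of the spin `s` line bundle, all trivializations are jointly measurable, and
the field has finite mean square norm. -/
structure RandomSpinField (s : ℤ) (P : Measure Ω) where
  /-- The trivializations `(R, p, ω) ↦ G_R(p)(ω)`. -/
  toFun : SO3 → Sphere2 → Ω → ℂ
  ae_transition : ∀ (R₁ R₂ : SO3) (p : Sphere2), p ∈ chart R₁ → p ∈ chart R₂ →
    ∀ᵐ ω ∂P, toFun R₂ p ω = transition s R₁ R₂ p * toFun R₁ p ω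
  measurable_toFun : ∀ R : SO3, Measurable (fun q : chart R × Ω => toFun R q.1 q.2)
  lintegral_sq_lt_top :
    ∫⁻ ω, ∫⁻ p in chartI, ‖toFun 1 p ω‖ₑ ^ 2 ∂surface ∂P < ⊤

namespace RandomSpinField

variable {s : ℤ} {P : Measure Ω} (G : RandomSpinField s P)

/-- The rotated field `G^R`, trivialized over `U_I`: `(G^R)_I(x) = G_R(R x)`. -/
def rotI (R : SO3) (x : Sphere2) (ω : Ω) : ℂ := G.toFun R (rotate R x) ω

/-- Isotropy in law: the joint law of `(G^R)_I(x_1), …, (G^R)_I(x_N)` does not depend on `R`. -/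
def Isotropic : Prop :=
  ∀ (N : ℕ) (x : Fin N → Sphere2), (∀ i, x i ∈ chartI) → ∀ R R' : SO3,
    P.map (fun ω i => G.rotI R (x i) ω) = P.map (fun ω i => G.rotI R' (x i) ω)

/-- The field is Gaussian: the real and imaginary parts of `G_I(x)`, `x ∈ U_I`, together form a
Gaussian family. -/
def Gaussian : Prop :=
  IsGaussianProcess
    (Sum.elim (fun (x : chartI) (ω : Ω) => (G.toFun 1 x ω).re)
      (fun (x : chartI) (ω : Ω) => (G.toFun 1 x ω).im)) P

/-- The spin `s` spherical harmonic coefficient `A_{lm} = ⟨G, ₛY_{lm}⟩`. -/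
def coeff (l : ℕ) (m : ℤ) (ω : Ω) : ℂ :=
  ∫ p in chartI, G.toFun 1 p ω * (starRingEnd ℂ) (spinY s l m p) ∂surface

/-- The field is involutive: almost surely, the complex conjugate of `A_{lm}` is `A_{l,-m}`. -/
def Involutive : Prop :=
  ∀ l : ℕ, s.natAbs ≤ l → ∀ m : ℤ, |m| ≤ l →
    ∀ᵐ ω ∂P, (starRingEnd ℂ) (G.coeff l m ω) = G.coeff l (-m) ω

/-- The angular power spectrum `C_l = E|A_{lm}|²` (`l ≥ |s|`). For an isotropic field the right-hand
side is the same for all `|m| ≤ l`; it is read off here at `m = 0`. -/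
def spectrum (l : ℕ) : ℝ := ∫ ω, ‖G.coeff l 0 ω‖ ^ 2 ∂P

/-- The statistic `Γ̂_j`, the sum of `f²(a^{2j} λ_{ls}) |A_{lm}|²` over `l ≥ |s|` and `|m| ≤ l`. -/
def gammaHat (f : ℝ → ℝ) (a : ℝ) (j : ℤ) (ω : Ω) : ℝ :=
  ∑' l : {l : ℕ // s.natAbs ≤ l}, ∑ m ∈ Finset.Icc (-(l.1 : ℤ)) (l.1 : ℤ),
    f (a ^ (2 * j) * eigen s l.1) ^ 2 * ‖G.coeff l.1 m ω‖ ^ 2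

end RandomSpinField

/-- The conditions on the real filter function `f` and the scale `a`: `f` is smooth, supported in
`[1/a², a²]`, and its Daubechies sum is `1` for every `u > 0`. -/
structure IsNeedletFilter (f : ℝ → ℝ) (a : ℝ) : Prop where
  one_lt : 1 < a
  smooth : ContDiff ℝ ((⊤ : ℕ∞) : WithTop ℕ∞) f
  support_subset : Function.support f ⊆ Set.Icc (1 / a ^ 2) (a ^ 2)
  daubechies : ∀ u : ℝ, 0 < u → HasSum (fun j : ℤ => f (a ^ (2 * j) * u) ^ 2) 1

end

end SpinField

open SpinField

/-! Isotropy forces the coefficients to satisfy the conclusion of Schur's lemma: `E[A_{lm} conj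
A_{l'm'}]` vanishes unless `(l, m) = (l', m')`, and is then independent of `m`. This is obtained
from explicit polynomials rather than from representation theory. By the ladder relations
(`spinYCoord_eq`), the spin harmonics of degree `l` are, up to constants, the coefficients in `(u,
v)` of `spinGen`, a product of powers of two linear forms built from the spinor coordinates of the
point. A rotation acts on `spinGen` by a linear substitution in `(u, v)`, and the phase ambiguity of
the spinor is exactly absorbed by the transition function of the bundle. Rotations about the
vertical axis make the second moments diagonal in `m`. A single quarter turn about a horizontal axis
then gives `moment_identity`, an identity of polynomials whose coefficients decide everything else
(`moment_eq_zero_of_lt`, `moment_self`).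

The coefficients are integrals of a Gaussian field, so they lie in its closed linear span in `L²`
and are jointly Gaussian (`isGaussianProcess_of_orthogonal`). Involutivity also determines `E[A_{lm}
A_{l'm'}]`, and hence all covariances of the real and imaginary parts. The real forms `realCoeff`
turn out to be uncorrelated and centred for `l > 0`, hence independent with law `N(0, C_l)`. Degree
`0` may have a nonzero mean, but its weight is `f² (0) = 0`. Almost surely `Γ̂_j` is thus a finite
sum of terms `f² X²` with `2l + 1` independent Gaussians `X` in degree `l`, and `Var (X²) = 2 C_l²`
gives the variance formula.

For the limit, the normalized statistic is a weighted sum of independent copies of one standardized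
chi-square variable, the squares of the weights summing to `1`. Put `L = a^(-j)`. The filter only
sees degrees at least of order `L`, so each unnormalized weight is `O(L^(-α))`. One well chosen
degree of order `L` already contributes about `L` equal terms, so the variance is at least a
constant times `L^(1 - 2α)`. The largest weight is therefore `O(L^(-1/2))`, and comparing
characteristic functions factor by factor concludes (`tendsto_charFun_weighted_sum`). -/

namespace SpinField

/-! ### Half-angle polynomials, ladder relations and the explicit form of the spin harmonics. -/

open Polynomial in
/-- The polynomial `(cos (θ/2) X + sin (θ/2))^p (-sin (θ/2) X + cos (θ/2))^q`. Its coefficients are,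
up to normalization, the spin spherical harmonics as functions of the colatitude. -/
noncomputable def wignerPoly (p q : ℕ) (θ : ℝ) : ℝ[X] :=
  (C (Real.cos (θ / 2)) * X + C (Real.sin (θ / 2))) ^ p *
    (-(C (Real.sin (θ / 2)) * X) + C (Real.cos (θ / 2))) ^ q

open Polynomial in
/-- `Q'` is the coefficientwise derivative at `θ` of the polynomial-valued function `Q`. -/
def HasCoeffDerivAt (Q : ℝ → ℝ[X]) (Q' : ℝ[X]) (θ : ℝ) : Prop :=
  ∀ k, HasDerivAt (fun t => (Q t).coeff k) (Q'.coeff k) θ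

open Polynomial in
theorem HasCoeffDerivAt.mul {Q₁ Q₂ : ℝ → ℝ[X]} {Q₁' Q₂' : ℝ[X]} {θ : ℝ}
    (h₁ : HasCoeffDerivAt Q₁ Q₁' θ) (h₂ : HasCoeffDerivAt Q₂ Q₂' θ) :
    HasCoeffDerivAt (fun t => Q₁ t * Q₂ t) (Q₁' * Q₂ θ + Q₁ θ * Q₂') θ := by
  intro k
  simp only [coeff_add, coeff_mul, ← Finset.sum_add_distrib]
  exact HasDerivAt.fun_sum fun i _ => (h₁ i.1).mul (h₂ i.2)

open Polynomial in
theorem HasCoeffDerivAt.pow {Q : ℝ → ℝ[X]} {Q' : ℝ[X]} {θ : ℝ}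
    (h : HasCoeffDerivAt Q Q' θ) (n : ℕ) :
    HasCoeffDerivAt (fun t => Q t ^ n) ((n : ℝ[X]) * Q θ ^ (n - 1) * Q') θ := by
  induction n with
  | zero =>
    intro k
    simpa using hasDerivAt_const θ ((1 : ℝ[X]).coeff k)
  | succ n ih =>
    have := ih.mul h
    simp only [← pow_succ] at this
    convert this using 1
    rcases n with _ | n
    · simp
    · simp only [Nat.add_sub_cancel]
      push_cast
      ring

open Polynomial in
theorem hasCoeffDerivAt_linear {a b : ℝ → ℝ} {a' b' θ : ℝ} (ha : HasDerivAt a a' θ)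
    (hb : HasDerivAt b b' θ) :
    HasCoeffDerivAt (fun t => C (a t) * X + C (b t)) (C a' * X + C b') θ := by
  intro k
  rcases k with _ | _ | k
  · simpa using hb
  · simpa [coeff_C] using ha
  · simpa [coeff_C, coeff_X] using hasDerivAt_const θ (0 : ℝ)

open Polynomial in
-- Differentiation in `θ` exchanges the two linear factors, up to the factor `1/2` and a sign. The
-- truncated exponents `p - 1` and `q - 1` are harmless, since at zero the coefficient `p` or `q` in
-- front vanishes.
theorem hasCoeffDerivAt_wignerPoly (p q : ℕ) (θ : ℝ) :
    HasCoeffDerivAt (wignerPoly p q)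
      (C (1 / 2) * ((p : ℝ[X]) * wignerPoly (p - 1) (q + 1) θ - (q : ℝ[X]) * wignerPoly (p + 1) (q - 1) θ)) θ := by
  have h2 : HasDerivAt (fun t : ℝ => t / 2) (1 / 2) θ := (hasDerivAt_id θ).div_const 2
  have hc : HasDerivAt (fun t : ℝ => Real.cos (t / 2)) (-Real.sin (θ / 2) * (1 / 2)) θ := h2.cos
  have hs : HasDerivAt (fun t : ℝ => Real.sin (t / 2)) (Real.cos (θ / 2) * (1 / 2)) θ := h2.sin
  have hA := hasCoeffDerivAt_linear hc hs
  have hB := hasCoeffDerivAt_linear hs.neg hc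
  have := (hA.pow p).mul (hB.pow q)
  unfold wignerPoly
  simp only [Pi.neg_apply, C_neg, neg_mul, C_mul] at this ⊢
  convert this using 1
  ring

open Polynomial in
theorem X_mul_derivative_wignerPoly (p q : ℕ) (θ : ℝ) :
    X * derivative (wignerPoly p q θ) =
      (p : ℝ[X]) * C (Real.cos (θ / 2)) * X * wignerPoly (p - 1) q θ -
        (q : ℝ[X]) * C (Real.sin (θ / 2)) * X * wignerPoly p (q - 1) θ := by
  unfold wignerPoly
  simp only [derivative_mul, derivative_pow, derivative_add, derivative_neg, derivative_C,
    derivative_X, C_eq_natCast]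
  ring

theorem coeff_X_mul_derivative (Q : Polynomial ℝ) (k : ℕ) :
    (Polynomial.X * Polynomial.derivative Q).coeff k = k * Q.coeff k := by
  rcases k with _ | k
  · simp
  · rw [Polynomial.coeff_X_mul, Polynomial.coeff_derivative]; push_cast; ring

open Polynomial in
/-- The raising and lowering relations in polynomial form. -/
theorem wignerPoly_raise (p q : ℕ) (θ : ℝ) :
    C (Real.sin θ) *
        (C (1 / 2) * ((p : ℝ[X]) * wignerPoly (p - 1) (q + 1) θ - (q : ℝ[X]) * wignerPoly (p + 1) (q - 1) θ)) -
      (X * derivative (wignerPoly p q θ) - C (((p : ℝ) + q) / 2) * wignerPoly p q θ) =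
    C (Real.sin θ * p) * wignerPoly (p - 1) (q + 1) θ -
      C (((p : ℝ) - q) / 2 * Real.cos θ) * wignerPoly p q θ ∧
    C (Real.sin θ) *
        (C (1 / 2) * ((p : ℝ[X]) * wignerPoly (p - 1) (q + 1) θ - (q : ℝ[X]) * wignerPoly (p + 1) (q - 1) θ)) +
      (X * derivative (wignerPoly p q θ) - C (((p : ℝ) + q) / 2) * wignerPoly p q θ) =
    -(C (Real.sin θ * q) * wignerPoly (p + 1) (q - 1) θ) +
      C (((p : ℝ) - q) / 2 * Real.cos θ) * wignerPoly p q θ := by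
  set c := Real.cos (θ / 2) with hc
  set s := Real.sin (θ / 2) with hs
  have e1 : Real.sin θ = 2 * s * c := by
    rw [hs, hc, ← Real.sin_two_mul]; congr 1; ring
  have e2 : Real.cos θ = c ^ 2 - s ^ 2 := by
    rw [hs, hc, ← Real.cos_two_mul']; congr 1; ring
  have e3 : (C c : ℝ[X]) ^ 2 + C s ^ 2 = 1 := by
    rw [← C_pow, ← C_pow, ← C_add, hs, hc, add_comm, Real.sin_sq_add_cos_sq, C_1]
  have h2 : (C (1 / 2) : ℝ[X]) * 2 = 1 := by
    rw [show (2 : ℝ[X]) = C 2 from rfl, ← C_mul]; norm_num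
  rw [X_mul_derivative_wignerPoly]
  have ep : ((p : ℝ) + q) / 2 = (1 / 2) * (p + q) := by ring
  have em : ((p : ℝ) - q) / 2 = (1 / 2) * (p - q) := by ring
  rw [ep, em, e1, e2]
  unfold wignerPoly
  rw [← hc, ← hs]
  simp only [C_mul, C_add, C_sub, C_pow, C_eq_natCast, show (C 2 : ℝ[X]) = 2 from rfl]
  generalize (C (1 / 2) : ℝ[X]) = h at *
  generalize (C c : ℝ[X]) = c at *
  generalize (C s : ℝ[X]) = s at *
  generalize (X : ℝ[X]) = x at *
  -- The two factors arise from `(x, 1)` by a rotation, so `x` is a combination of them. With this,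
  -- both identities become polynomial in the factors and in `c`, `s`.
  have hx : x = c * (c * x + s) - s * (-(s * x) + c) := by linear_combination -x * e3
  generalize c * x + s = A at *
  generalize -(s * x) + c = B at *
  -- The only facts needed about truncated exponents; afterwards all powers can be treated as free
  -- variables.
  have hA : (p : ℝ[X]) * A ^ (p - 1) * A = p * A ^ p := by
    rcases p with _ | p
    · simp
    · simp [pow_succ, mul_assoc]
  have hB : (q : ℝ[X]) * B ^ (q - 1) * B = q * B ^ q := by
    rcases q with _ | q
    · simp
    · simp [pow_succ, mul_assoc]
  simp only [pow_succ]
  generalize A ^ (p - 1) = Ap at *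
  generalize B ^ (q - 1) = Bq at *
  generalize A ^ p = AP at *
  generalize B ^ q = BQ at *
  generalize (p : ℝ[X]) = P at *
  generalize (q : ℝ[X]) = Q at *
  constructor
  · linear_combination -(c * P * Ap * BQ - s * Q * Bq * AP) * hx +
      (s * c * P * Ap * BQ * B - s * c * Q * Bq * AP * A + (P * c ^ 2 + Q * s ^ 2) * AP * BQ) * h2 -
      h * (P + Q) * AP * BQ * e3 - c ^ 2 * BQ * hA - s ^ 2 * AP * hB
  · linear_combination (c * P * Ap * BQ - s * Q * Bq * AP) * hx +
      (s * c * P * Ap * BQ * B - s * c * Q * Bq * AP * A - (P * c ^ 2 + Q * s ^ 2) * AP * BQ) * h2 +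
      h * (P + Q) * AP * BQ * e3 + c ^ 2 * BQ * hA + s ^ 2 * AP * hB

/-- The derivative in `θ` of a coefficient of `wignerPoly`, combined with the two first-order
ladder operators. -/
theorem exists_hasDerivAt_coeff_wignerPoly (p q k : ℕ) (θ : ℝ) :
    ∃ v' : ℝ, HasDerivAt (fun t => (wignerPoly p q t).coeff k) v' θ ∧
      Real.sin θ * v' - (k - ((p : ℝ) + q) / 2) * (wignerPoly p q θ).coeff k =
        Real.sin θ * p * (wignerPoly (p - 1) (q + 1) θ).coeff k -
          ((p : ℝ) - q) / 2 * Real.cos θ * (wignerPoly p q θ).coeff k ∧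
      Real.sin θ * v' + (k - ((p : ℝ) + q) / 2) * (wignerPoly p q θ).coeff k =
        -(Real.sin θ * q * (wignerPoly (p + 1) (q - 1) θ).coeff k) +
          ((p : ℝ) - q) / 2 * Real.cos θ * (wignerPoly p q θ).coeff k := by
  refine ⟨_, hasCoeffDerivAt_wignerPoly p q θ k, ?_, ?_⟩
  · have := congrArg (fun Q : Polynomial ℝ => Q.coeff k) (wignerPoly_raise p q θ).1
    simp only [Polynomial.coeff_sub, Polynomial.coeff_C_mul, coeff_X_mul_derivative] at this ⊢
    linear_combination this
  · have := congrArg (fun Q : Polynomial ℝ => Q.coeff k) (wignerPoly_raise p q θ).2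
    simp only [Polynomial.coeff_sub, Polynomial.coeff_add, Polynomial.coeff_neg,
      Polynomial.coeff_C_mul, coeff_X_mul_derivative] at this ⊢
    linear_combination this

theorem hasDerivAt_sin_zpow (n : ℤ) {θ : ℝ} (h : Real.sin θ ≠ 0) :
    HasDerivAt (fun t : ℝ => (Real.sin t : ℂ) ^ n)
      (n * (Real.sin θ : ℂ) ^ n * (Real.cos θ / Real.sin θ : ℝ)) θ := by
  have h' : (Real.sin θ : ℂ) ≠ 0 := by exact_mod_cast h
  have h1 : HasDerivAt (fun t : ℝ => (Real.sin t : ℂ)) (Real.cos θ : ℂ) θ :=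
    (Real.hasDerivAt_sin θ).ofReal_comp
  have := (hasDerivAt_zpow n (Real.sin θ : ℂ) (Or.inl h')).comp θ h1
  refine this.congr_deriv ?_
  rw [zpow_sub_one₀ h']
  push_cast
  field_simp

/-- Both spin operators reduce to first-order operators in `θ` on functions with separated
variables. The separated form is only required near `θ`, because the formulas iterated later hold on
`(0, π)` alone. -/
theorem edth_aux {h : ℝ → ℝ → ℂ} {v : ℝ → ℝ} {v' θ : ℝ} {c : ℂ} {m : ℤ} (hθ : Real.sin θ ≠ 0)
    (hh : ∀ᶠ t in 𝓝 θ, ∀ φ, h t φ = c * Complex.exp (Complex.I * m * φ) * (v t : ℂ))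
    (hv : HasDerivAt v v' θ) (σ : ℤ) (φ : ℝ) :
    deriv (fun t : ℝ => (Real.sin t : ℂ) ^ σ * h t φ) θ =
      (Real.sin θ : ℂ) ^ σ * (c * Complex.exp (Complex.I * m * φ)) *
        ((σ : ℝ) * (Real.cos θ / Real.sin θ) * v θ + v' : ℝ) ∧
    deriv (fun u : ℝ => (Real.sin θ : ℂ) ^ σ * h θ u) φ =
      (Real.sin θ : ℂ) ^ σ * (c * Complex.exp (Complex.I * m * φ)) * (Complex.I * m * (v θ : ℝ)) := by
  constructor
  · have e : (fun t : ℝ => (Real.sin t : ℂ) ^ σ * h t φ) =ᶠ[𝓝 θ]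
        fun t => (Real.sin t : ℂ) ^ σ * (c * Complex.exp (Complex.I * m * φ) * (v t : ℂ)) := by
      filter_upwards [hh] with t ht
      rw [ht]
    rw [e.deriv_eq, ((hasDerivAt_sin_zpow σ hθ).fun_mul (hv.ofReal_comp.const_mul _)).deriv]
    push_cast
    ring
  · have e : (fun u : ℝ => (Real.sin θ : ℂ) ^ σ * h θ u) =
        fun u : ℝ => ((Real.sin θ : ℂ) ^ σ * c * (v θ : ℂ)) * Complex.exp (Complex.I * m * u) := by
      funext u
      rw [hh.self_of_nhds u]
      ring
    have h1 : HasDerivAt (fun u : ℝ => Complex.exp (Complex.I * m * u))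
        (Complex.exp (Complex.I * m * φ) * (Complex.I * m * 1)) φ :=
      ((HasDerivAt.ofReal_comp (hasDerivAt_id φ)).const_mul (Complex.I * m)).cexp
    rw [e, (h1.const_mul _).deriv]
    ring

theorem edth_eq {h : ℝ → ℝ → ℂ} {v : ℝ → ℝ} {v' θ : ℝ} {c : ℂ} {m : ℤ} (hθ : Real.sin θ ≠ 0)
    (hh : ∀ᶠ t in 𝓝 θ, ∀ φ, h t φ = c * Complex.exp (Complex.I * m * φ) * (v t : ℂ))
    (hv : HasDerivAt v v' θ) (σ : ℤ) (φ : ℝ) :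
    edth σ h θ φ = -(c * Complex.exp (Complex.I * m * φ)) *
      (((Real.sin θ * v' - m * v θ) - σ * Real.cos θ * v θ) / Real.sin θ : ℝ) := by
  have h' : (Real.sin θ : ℂ) ≠ 0 := by exact_mod_cast hθ
  rw [edth, (edth_aux hθ hh hv (-σ) φ).1, (edth_aux hθ hh hv (-σ) φ).2, zpow_neg]
  have h'' : (Real.sin θ : ℂ) ^ σ ≠ 0 := zpow_ne_zero _ h'
  push_cast at h' h'' ⊢
  field_simp
  linear_combination (-c * (v θ : ℂ) * m) * Complex.I_sq

theorem edthBar_eq {h : ℝ → ℝ → ℂ} {v : ℝ → ℝ} {v' θ : ℝ} {c : ℂ} {m : ℤ} (hθ : Real.sin θ ≠ 0)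
    (hh : ∀ᶠ t in 𝓝 θ, ∀ φ, h t φ = c * Complex.exp (Complex.I * m * φ) * (v t : ℂ))
    (hv : HasDerivAt v v' θ) (σ : ℤ) (φ : ℝ) :
    edthBar σ h θ φ = -(c * Complex.exp (Complex.I * m * φ)) *
      (((Real.sin θ * v' + m * v θ) + σ * Real.cos θ * v θ) / Real.sin θ : ℝ) := by
  have h' : (Real.sin θ : ℂ) ≠ 0 := by exact_mod_cast hθ
  rw [edthBar, (edth_aux hθ hh hv σ φ).1, (edth_aux hθ hh hv σ φ).2, zpow_neg]
  have h'' : (Real.sin θ : ℂ) ^ σ ≠ 0 := zpow_ne_zero _ h'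
  push_cast at h' h'' ⊢
  field_simp
  linear_combination (c * (v θ : ℂ) * m) * Complex.I_sq

/-- Repeated raising of the spin. -/
theorem edthPow_eq {l k : ℕ} {m : ℤ} (hk : (k : ℤ) = l + m) {c : ℂ} {h : ℝ → ℝ → ℂ}
    (hh : ∀ θ ∈ Set.Ioo 0 Real.pi, ∀ φ,
      h θ φ = c * Complex.exp (Complex.I * m * φ) * ((wignerPoly l l θ).coeff k : ℂ))
    (n : ℕ) (hn : n ≤ l) : ∀ θ ∈ Set.Ioo 0 Real.pi, ∀ φ, edthPow n h θ φ =
      ((-1) ^ n * (l.descFactorial n : ℂ) * c) * Complex.exp (Complex.I * m * φ) *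
        ((wignerPoly (l - n) (l + n) θ).coeff k : ℂ) := by
  have hk' : (k : ℝ) = l + m := by exact_mod_cast hk
  induction n with
  | zero => simpa [edthPow] using hh
  | succ n ih =>
    intro θ hθ φ
    have ih' := ih (by omega)
    have hs : Real.sin θ ≠ 0 := (Real.sin_pos_of_mem_Ioo hθ).ne'
    obtain ⟨v', hv, e, -⟩ := exists_hasDerivAt_coeff_wignerPoly (l - n) (l + n) k θ
    rw [edthPow, edth_eq hs (Filter.eventually_of_mem (isOpen_Ioo.mem_nhds hθ) ih') hv]
    -- For exponents `p = l - n`, `q = l + n` one has `(p - q) / 2 = -n`, which cancels the spin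
    -- term, and `k - (p + q) / 2 = m`. Only the neighbouring polynomial survives.
    have e2 : ((Real.sin θ * v' - m * (wignerPoly (l - n) (l + n) θ).coeff k) -
        ((n : ℤ) : ℝ) * Real.cos θ * (wignerPoly (l - n) (l + n) θ).coeff k) / Real.sin θ =
        (l - n : ℕ) * (wignerPoly (l - (n + 1)) (l + (n + 1)) θ).coeff k := by
      rw [div_eq_iff hs]
      rw [Nat.sub_sub, Nat.cast_sub (by omega : n ≤ l)] at e
      rw [Nat.cast_sub (by omega : n ≤ l)]
      push_cast at e ⊢
      rw [hk'] at e
      rw [← add_assoc]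
      linear_combination e
    rw [e2, Nat.descFactorial_succ]
    push_cast
    ring

/-- Repeated lowering of the spin. -/
theorem negEdthBarPow_eq {l k : ℕ} {m : ℤ} (hk : (k : ℤ) = l + m) {c : ℂ} {h : ℝ → ℝ → ℂ}
    (hh : ∀ θ ∈ Set.Ioo 0 Real.pi, ∀ φ,
      h θ φ = c * Complex.exp (Complex.I * m * φ) * ((wignerPoly l l θ).coeff k : ℂ))
    (n : ℕ) (hn : n ≤ l) : ∀ θ ∈ Set.Ioo 0 Real.pi, ∀ φ, negEdthBarPow n h θ φ =
      ((-1) ^ n * (l.descFactorial n : ℂ) * c) * Complex.exp (Complex.I * m * φ) *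
        ((wignerPoly (l + n) (l - n) θ).coeff k : ℂ) := by
  have hk' : (k : ℝ) = l + m := by exact_mod_cast hk
  induction n with
  | zero => simpa [negEdthBarPow] using hh
  | succ n ih =>
    intro θ hθ φ
    have ih' := ih (by omega)
    have hs : Real.sin θ ≠ 0 := (Real.sin_pos_of_mem_Ioo hθ).ne'
    obtain ⟨v', hv, -, e⟩ := exists_hasDerivAt_coeff_wignerPoly (l + n) (l - n) k θ
    simp only [negEdthBarPow]
    rw [edthBar_eq hs (Filter.eventually_of_mem (isOpen_Ioo.mem_nhds hθ) ih') hv]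
    have e2 : ((Real.sin θ * v' + m * (wignerPoly (l + n) (l - n) θ).coeff k) +
        ((-(n : ℤ) : ℤ) : ℝ) * Real.cos θ * (wignerPoly (l + n) (l - n) θ).coeff k) / Real.sin θ =
        -((l - n : ℕ) * (wignerPoly (l + (n + 1)) (l - (n + 1)) θ).coeff k) := by
      rw [div_eq_iff hs]
      rw [Nat.sub_sub, Nat.cast_sub (by omega : n ≤ l)] at e
      rw [Nat.cast_sub (by omega : n ≤ l)]
      push_cast at e ⊢
      rw [hk'] at e
      rw [← add_assoc]
      linear_combination e
    rw [e2, Nat.descFactorial_succ]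
    push_cast
    ring

theorem coeff_wignerPoly_self (l k : ℕ) (θ : ℝ) :
    (wignerPoly l l θ).coeff k = ∑ r ∈ Finset.range (l + 1),
      if r ≤ k then (l.choose r : ℝ) * l.choose (k - r) * (-1) ^ (k - r) *
        (Real.cos (θ / 2) ^ r * Real.sin (θ / 2) ^ (l - r) *
          (Real.sin (θ / 2) ^ (k - r) * Real.cos (θ / 2) ^ (l - (k - r)))) else 0 := by
  have lin : ∀ (a b : ℝ) (n : ℕ), (Polynomial.C a * Polynomial.X + Polynomial.C b) ^ n =
      ∑ r ∈ Finset.range (n + 1), Polynomial.C (a ^ r * b ^ (n - r) * n.choose r) *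
        Polynomial.X ^ r := by
    intro a b n
    rw [add_pow]
    refine Finset.sum_congr rfl fun r _ => ?_
    simp only [Polynomial.C_mul, Polynomial.C_pow, Polynomial.C_eq_natCast, mul_pow]
    ring
  have lin2 : ∀ (a b : ℝ) (n j : ℕ), ((Polynomial.C a * Polynomial.X + Polynomial.C b) ^ n).coeff j
      = a ^ j * b ^ (n - j) * n.choose j := by
    intro a b n j
    rw [lin, Polynomial.finsetSum_coeff]
    simp only [Polynomial.coeff_C_mul_X_pow]
    rw [Finset.sum_ite_eq]
    split_ifs with h
    · rfl
    · rw [Nat.choose_eq_zero_of_lt (by simpa using h)]; simp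
  rw [wignerPoly, lin, ← neg_mul, ← Polynomial.C_neg, Finset.sum_mul, Polynomial.finsetSum_coeff]
  refine Finset.sum_congr rfl fun r _ => ?_
  rw [mul_assoc, Polynomial.coeff_C_mul, Polynomial.coeff_X_pow_mul', lin2]
  split_ifs
  · rw [neg_pow]; ring
  · simp

/-- The spherical harmonics in terms of `wignerPoly`. -/
theorem sphY_eq (l : ℕ) (m : ℤ) (hm : |m| ≤ l) {θ : ℝ} (hθ : θ ∈ Set.Ioo 0 Real.pi) (φ : ℝ) :
    sphY l m θ φ = (((-1) ^ m.toNat * (Real.sqrt ((((l : ℤ) + m).toNat.factorial : ℝ) *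
        (((l : ℤ) - m).toNat.factorial : ℝ) * (2 * l + 1) / (4 * Real.pi)) / (l.factorial : ℝ)) : ℝ)
        : ℂ) * Complex.exp (Complex.I * m * φ) *
      ((wignerPoly l l θ).coeff ((l : ℤ) + m).toNat : ℂ) := by
  obtain ⟨hm1, hm2⟩ := abs_le.1 hm
  have hs : Real.sin (θ / 2) ≠ 0 :=
    (Real.sin_pos_of_pos_of_lt_pi (by linarith [hθ.1]) (by linarith [hθ.2, hθ.1])).ne'
  have hc : Real.cos (θ / 2) ≠ 0 :=
    (Real.cos_pos_of_mem_Ioo ⟨by linarith [hθ.1, Real.pi_pos], by linarith [hθ.2]⟩).ne'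
  have key : Real.sin (θ / 2) ^ (2 * l) *
      ∑ r ∈ Finset.range (l + 1), (l.choose r : ℝ) * binom l ((r : ℤ) - m) * (-1) ^ (l - r) *
        Real.cot (θ / 2) ^ (2 * (r : ℤ) - m) =
      (-1) ^ (-m).toNat * (-1) ^ m.toNat * (wignerPoly l l θ).coeff ((l : ℤ) + m).toNat := by
    obtain ⟨k, hk⟩ : ∃ k : ℕ, (k : ℤ) = l + m := ⟨((l : ℤ) + m).toNat, by omega⟩
    rw [← hk, Int.toNat_natCast, coeff_wignerPoly_self, Finset.mul_sum, Finset.mul_sum]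
    refine Finset.sum_congr rfl fun r hr => ?_
    have hr' : r ≤ l := by simpa [Nat.lt_succ_iff] using hr
    by_cases hrm : (r : ℤ) < m
    · rw [binom, if_pos (by omega)]
      split_ifs with h
      · rw [Nat.choose_eq_zero_of_lt (by omega : l < k - r)]; simp
      · simp
    · obtain ⟨j, hj⟩ : ∃ j : ℕ, (j : ℤ) = r - m := ⟨((r : ℤ) - m).toNat, by omega⟩
      rw [binom, if_neg (by omega), ← hj, Int.toNat_natCast]
      split_ifs with h
      · have hjl : j + (k - r) = l := by omega
        -- The definition of `sphY` uses the index `r - m`, the polynomial the index `l + m - r`;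
        -- these are complementary in `l`. The sign exponents differ by `m` modulo `2`, which
        -- produces the factor `(-1) ^ m`.
        have e1 : l.choose j = l.choose (k - r) := by
          rw [← hjl, Nat.choose_symm_add]
        have e2 : l - (k - r) = j := by omega
        have e3 : (-1 : ℝ) ^ (l - r) = (-1) ^ (-m).toNat * (-1) ^ m.toNat * (-1) ^ (k - r) := by
          rw [← pow_add, ← pow_add]
          rcases le_total 0 m with h0 | h0
          · rw [show (-m).toNat + m.toNat + (k - r) = (l - r) + 2 * m.toNat by omega, pow_add,
              pow_mul]
            simp
          · rw [show l - r = (-m).toNat + m.toNat + (k - r) by omega]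
        have e4 : Real.sin (θ / 2) ^ (2 * l) * Real.cot (θ / 2) ^ (2 * (r : ℤ) - m) =
            Real.cos (θ / 2) ^ r * Real.sin (θ / 2) ^ (l - r) *
              (Real.sin (θ / 2) ^ (k - r) * Real.cos (θ / 2) ^ j) := by
          rw [show 2 * (r : ℤ) - m = ((r + j : ℕ) : ℤ) by push_cast; omega, zpow_natCast,
            Real.cot_eq_cos_div_sin, div_pow, show 2 * l = (r + j) + ((l - r) + (k - r)) by omega,
            pow_add]
          field_simp
          ring
        rw [e1, e2, e3]
        linear_combination (((-1 : ℝ) ^ (-m).toNat * (-1) ^ m.toNat * (-1) ^ (k - r)) *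
          l.choose r * l.choose (k - r)) * e4
      · rw [Nat.choose_eq_zero_of_lt (by omega : l < j)]; simp
  have hsq : ((-1 : ℝ) ^ (-m).toNat) ^ 2 = 1 := by
    rw [← pow_mul, mul_comm, pow_mul]; simp
  have final : ∀ N : ℝ, ((-1 : ℝ) ^ (-m).toNat * N * Real.sin (θ / 2) ^ (2 * l) *
      ∑ r ∈ Finset.range (l + 1), (l.choose r : ℝ) * binom l ((r : ℤ) - m) * (-1) ^ (l - r) *
        Real.cot (θ / 2) ^ (2 * (r : ℤ) - m)) =
      (-1) ^ m.toNat * N * (wignerPoly l l θ).coeff ((l : ℤ) + m).toNat := by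
    intro N
    rw [mul_assoc, key]
    linear_combination ((-1) ^ m.toNat * N * (wignerPoly l l θ).coeff ((l : ℤ) + m).toNat) * hsq
  rw [sphY, final]
  push_cast
  ring

/-- The normalizing constant of the spin spherical harmonics relative to `wignerPoly`. -/
noncomputable def harmConst (s : ℤ) (l : ℕ) (m : ℤ) : ℝ :=
  Real.sqrt (((l - s.natAbs).factorial : ℝ) / ((l + s.natAbs).factorial : ℝ)) *
    ((-1) ^ s.natAbs * (l.descFactorial s.natAbs : ℝ) *
      ((-1) ^ m.toNat * (Real.sqrt ((((l : ℤ) + m).toNat.factorial : ℝ) *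
        (((l : ℤ) - m).toNat.factorial : ℝ) * (2 * l + 1) / (4 * Real.pi)) / (l.factorial : ℝ))))

theorem spinYCoord_eq {s : ℤ} {l : ℕ} (hl : s.natAbs ≤ l) (m : ℤ) (hm : |m| ≤ l) {θ : ℝ}
    (hθ : θ ∈ Set.Ioo 0 Real.pi) (φ : ℝ) :
    spinYCoord s l m θ φ = (harmConst s l m : ℂ) * Complex.exp (Complex.I * m * φ) *
      ((wignerPoly ((l : ℤ) - s).toNat ((l : ℤ) + s).toNat θ).coeff ((l : ℤ) + m).toNat : ℂ) := by
  have hk : ((((l : ℤ) + m).toNat : ℕ) : ℤ) = l + m := by have := abs_le.1 hm; omega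
  have hh := fun θ (hθ : θ ∈ Set.Ioo 0 Real.pi) φ => sphY_eq l m hm hθ φ
  rw [spinYCoord, harmConst]
  split_ifs with hs
  · rw [edthPow_eq hk hh _ hl θ hθ, show l - s.natAbs = ((l : ℤ) - s).toNat by omega,
      show l + s.natAbs = ((l : ℤ) + s).toNat by omega]
    push_cast
    ring
  · rw [negEdthBarPow_eq hk hh _ hl θ hθ, show l - s.natAbs = ((l : ℤ) + s).toNat by omega,
      show l + s.natAbs = ((l : ℤ) - s).toNat by omega]
    push_cast
    ring

/-- The squared constant depends on `m` only through `(l + m)! (l - m)!`, which the binomial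
coefficient cancels. The same binomial coefficient appears in `moment_self`, which is why the power
spectrum does not depend on `m`. -/
theorem harmConst_sq {s : ℤ} {l : ℕ} (hl : s.natAbs ≤ l) : ∃ K : ℝ, K ≠ 0 ∧
    ∀ m : ℤ, |m| ≤ l → harmConst s l m ^ 2 * (2 * l).choose ((l : ℤ) + m).toNat = K := by
  refine ⟨((l - s.natAbs).factorial : ℝ) / ((l + s.natAbs).factorial : ℝ) *
    ((l.descFactorial s.natAbs : ℝ) ^ 2 * (((2 * l).factorial : ℝ) * (2 * l + 1) / (4 * Real.pi) /
      (l.factorial : ℝ) ^ 2)), ?_, ?_⟩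
  · have : (l.descFactorial s.natAbs : ℝ) ≠ 0 := by
      rw [Nat.cast_ne_zero]
      exact (Nat.pos_of_ne_zero (by rw [Ne, Nat.descFactorial_eq_zero_iff_lt]; omega)).ne'
    have := Real.pi_pos
    have h1 : (2 * (l : ℝ) + 1) ≠ 0 := by positivity
    simp [Nat.factorial_ne_zero, *, Real.pi_ne_zero]
  · intro m hm
    have hm' := abs_le.1 hm
    have hch : ((2 * l).choose ((l : ℤ) + m).toNat : ℝ) * (((l : ℤ) + m).toNat.factorial : ℝ) *
        (((l : ℤ) - m).toNat.factorial : ℝ) = (2 * l).factorial := by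
      have := Nat.choose_mul_factorial_mul_factorial (n := 2 * l) (k := ((l : ℤ) + m).toNat)
        (by omega)
      rw [show 2 * l - ((l : ℤ) + m).toNat = ((l : ℤ) - m).toNat by omega] at this
      exact_mod_cast this
    rw [harmConst]
    simp only [mul_pow, div_pow]
    rw [Real.sq_sqrt (by positivity), Real.sq_sqrt (by positivity), ← pow_mul, ← pow_mul,
      mul_comm s.natAbs, mul_comm m.toNat, pow_mul, pow_mul, ← hch]
    simp only [even_two, Even.neg_pow, one_pow]
    ring

end SpinField

namespace SpinField

/-! ### Spinor coordinates -/

/-- The distance of a point of the sphere to the vertical axis. -/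
noncomputable def axisDist (p : Sphere2) : ℝ := Real.sqrt (vec p 0 ^ 2 + vec p 1 ^ 2)

/-- The first spinor coordinate `cos (θ/2) exp (iφ/2)`. -/
noncomputable def spinA (p : Sphere2) : ℂ :=
  Real.cos (colat p / 2) * Complex.exp (Complex.I * (longit p / 2 : ℝ))

/-- The second spinor coordinate `sin (θ/2) exp (-iφ/2)`. -/
noncomputable def spinB (p : Sphere2) : ℂ :=
  Real.sin (colat p / 2) * Complex.exp (-(Complex.I * (longit p / 2 : ℝ)))

theorem vec_sq_sum (p : Sphere2) : vec p 0 ^ 2 + vec p 1 ^ 2 + vec p 2 ^ 2 = 1 := by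
  have hp : ‖(p : EuclideanSpace ℝ (Fin 3))‖ = 1 := by simp
  have := EuclideanSpace.norm_sq_eq (p : EuclideanSpace ℝ (Fin 3))
  rw [hp] at this
  simp only [Real.norm_eq_abs, sq_abs, Fin.sum_univ_three] at this
  simpa [vec] using this.symm

theorem axisDist_sq (p : Sphere2) : axisDist p ^ 2 = vec p 0 ^ 2 + vec p 1 ^ 2 :=
  Real.sq_sqrt (by positivity)

theorem axisDist_pos {p : Sphere2} (hp : p ∈ chartI) : 0 < axisDist p := by
  rw [axisDist, Real.sqrt_pos]
  by_contra h
  have h0 : vec p 0 = 0 := by nlinarith [sq_nonneg (vec p 0), sq_nonneg (vec p 1)]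
  have h1 : vec p 1 = 0 := by nlinarith [sq_nonneg (vec p 0), sq_nonneg (vec p 1)]
  have h2 : vec p 2 ^ 2 = 1 := by have := vec_sq_sum p; rw [h0, h1] at this; linarith
  apply hp
  rcases sq_eq_sq_iff_eq_or_eq_neg.1 (h2.trans (one_pow 2).symm) with h | h
  · left; ext i; fin_cases i <;> simp [h0, h1, h]
  · right; ext i; fin_cases i <;> simp [h0, h1, h]

theorem axisDist_eq_sin (p : Sphere2) : axisDist p = Real.sin (colat p) := by
  rw [axisDist, colat, Real.sin_arccos]
  congr 1
  linarith [vec_sq_sum p]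

theorem cos_colat (p : Sphere2) : Real.cos (colat p) = vec p 2 := by
  have := vec_sq_sum p
  apply Real.cos_arccos <;> nlinarith [sq_nonneg (vec p 0), sq_nonneg (vec p 1)]

theorem colat_mem {p : Sphere2} (hp : p ∈ chartI) : colat p ∈ Set.Ioo 0 Real.pi := by
  have h := axisDist_pos hp
  rw [axisDist_eq_sin] at h
  have h1 : 0 ≤ colat p := Real.arccos_nonneg _
  have h2 : colat p ≤ Real.pi := Real.arccos_le_pi _
  constructor
  · rcases h1.lt_or_eq with h' | h'
    · exact h'
    · rw [← h'] at h; simp at h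
  · rcases h2.lt_or_eq with h' | h'
    · exact h'
    · rw [h'] at h; simp at h

theorem axisDist_mul_exp_longit (p : Sphere2) :
    (axisDist p : ℂ) * Complex.exp (Complex.I * longit p) = vec p 0 + Complex.I * vec p 1 := by
  have h := Complex.norm_mul_exp_arg_mul_I (⟨vec p 0, vec p 1⟩ : ℂ)
  have h2 : ‖(⟨vec p 0, vec p 1⟩ : ℂ)‖ = axisDist p := by
    rw [Complex.norm_def, Complex.normSq_mk, axisDist]; congr 1; ring
  rw [h2, mul_comm _ Complex.I] at h
  rw [longit, h]
  apply Complex.ext <;> simp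

theorem conj_spinA (p : Sphere2) : (starRingEnd ℂ) (spinA p) =
    Real.cos (colat p / 2) * Complex.exp (-(Complex.I * (longit p / 2 : ℝ))) := by
  rw [spinA, map_mul, ← Complex.exp_conj, map_mul, Complex.conj_ofReal, Complex.conj_ofReal,
    Complex.conj_I, neg_mul]

theorem conj_spinB (p : Sphere2) : (starRingEnd ℂ) (spinB p) =
    Real.sin (colat p / 2) * Complex.exp (Complex.I * (longit p / 2 : ℝ)) := by
  rw [spinB, map_mul, ← Complex.exp_conj, map_neg, map_mul, Complex.conj_ofReal,
    Complex.conj_ofReal, Complex.conj_I, neg_mul, neg_neg]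

theorem exp_mul_exp_neg_half (p : Sphere2) : Complex.exp (Complex.I * (longit p / 2 : ℝ)) *
    Complex.exp (-(Complex.I * (longit p / 2 : ℝ))) = 1 := by
  rw [← Complex.exp_add]; simp

theorem sin_eq_half (p : Sphere2) :
    axisDist p = 2 * Real.sin (colat p / 2) * Real.cos (colat p / 2) := by
  rw [axisDist_eq_sin, ← Real.sin_two_mul]; congr 1; ring

theorem vec_two_eq_half (p : Sphere2) :
    vec p 2 = Real.cos (colat p / 2) ^ 2 - Real.sin (colat p / 2) ^ 2 := by
  rw [← cos_colat, ← Real.cos_two_mul']; congr 1; ring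

theorem spinor_norm (p : Sphere2) :
    spinA p * (starRingEnd ℂ) (spinA p) + spinB p * (starRingEnd ℂ) (spinB p) = 1 := by
  rw [conj_spinA, conj_spinB, spinA, spinB]
  have h : (Real.cos (colat p / 2) : ℂ) ^ 2 + (Real.sin (colat p / 2) : ℂ) ^ 2 = 1 := by
    exact_mod_cast Real.cos_sq_add_sin_sq _
  linear_combination ((Real.cos (colat p / 2) : ℂ) ^ 2 + (Real.sin (colat p / 2) : ℂ) ^ 2) *
    exp_mul_exp_neg_half p + h

theorem spinor_diff (p : Sphere2) :
    spinA p * (starRingEnd ℂ) (spinA p) - spinB p * (starRingEnd ℂ) (spinB p) = vec p 2 := by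
  rw [conj_spinA, conj_spinB, spinA, spinB]
  have h : (Real.cos (colat p / 2) : ℂ) ^ 2 - (Real.sin (colat p / 2) : ℂ) ^ 2 = vec p 2 := by
    exact_mod_cast (vec_two_eq_half p).symm
  linear_combination ((Real.cos (colat p / 2) : ℂ) ^ 2 - (Real.sin (colat p / 2) : ℂ) ^ 2) *
    exp_mul_exp_neg_half p + h

theorem spinor_mul (p : Sphere2) : 2 * (spinA p * spinB p) = axisDist p := by
  rw [spinA, spinB, sin_eq_half, Complex.ofReal_mul, Complex.ofReal_mul, Complex.ofReal_ofNat]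
  linear_combination 2 * (Real.cos (colat p / 2) : ℂ) * (Real.sin (colat p / 2) : ℂ) *
    exp_mul_exp_neg_half p

theorem spinor_hopf (p : Sphere2) :
    2 * (spinA p * (starRingEnd ℂ) (spinB p)) = vec p 0 + Complex.I * vec p 1 := by
  rw [← axisDist_mul_exp_longit, conj_spinB, spinA, sin_eq_half]
  have h : Complex.exp (Complex.I * longit p) = Complex.exp (Complex.I * (longit p / 2 : ℝ)) *
    Complex.exp (Complex.I * (longit p / 2 : ℝ)) := by
    rw [← Complex.exp_add]; congr 1; push_cast; ring
  rw [h]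
  push_cast
  ring

/-! ### Generating function of the spin harmonics -/

/-- The generating function of the spin `s` harmonics of degree `l`. -/
noncomputable def spinGen (s : ℤ) (l : ℕ) (u v : ℂ) (p : Sphere2) : ℂ :=
  (spinA p * u + spinB p * v) ^ ((l : ℤ) - s).toNat *
    (-(starRingEnd ℂ) (spinB p) * u + (starRingEnd ℂ) (spinA p) * v) ^ ((l : ℤ) + s).toNat

/-- The unnormalized spin `s` harmonics of degree `l` and order `k - l`. -/
noncomputable def harm (s : ℤ) (l k : ℕ) (p : Sphere2) : ℂ :=
  Complex.exp (Complex.I * ((k : ℤ) - l : ℤ) * longit p) *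
    ((wignerPoly ((l : ℤ) - s).toNat ((l : ℤ) + s).toNat (colat p)).coeff k : ℂ)

theorem spinY_eq {s : ℤ} {l : ℕ} (hl : s.natAbs ≤ l) {m : ℤ} (hm : |m| ≤ l) {p : Sphere2}
    (hp : p ∈ chartI) :
    spinY s l m p = (harmConst s l m : ℂ) * harm s l ((l : ℤ) + m).toNat p := by
  have : ((((l : ℤ) + m).toNat : ℕ) : ℤ) = l + m := by have := abs_le.1 hm; omega
  rw [spinY, spinYCoord_eq hl m hm (colat_mem hp), harm, this, add_sub_cancel_left, mul_assoc]

theorem homogenize_wignerPoly (p q : ℕ) (θ : ℝ) (u v : ℂ) :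
    ((Real.cos (θ / 2) : ℂ) * u + (Real.sin (θ / 2) : ℂ) * v) ^ p *
      (-(Real.sin (θ / 2) : ℂ) * u + (Real.cos (θ / 2) : ℂ) * v) ^ q =
    ∑ k ∈ Finset.range (p + q + 1),
      ((wignerPoly p q θ).coeff k : ℂ) * u ^ k * v ^ (p + q - k) := by
  -- For `v ≠ 0` this is evaluation at `u / v` followed by multiplication by `v ^ (p + q)`;
  -- continuity covers `v = 0`.
  refine congrFun (Continuous.ext_on (dense_compl_singleton (0 : ℂ))
    (f := fun v : ℂ => ((Real.cos (θ / 2) : ℂ) * u + (Real.sin (θ / 2) : ℂ) * v) ^ p *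
      (-(Real.sin (θ / 2) : ℂ) * u + (Real.cos (θ / 2) : ℂ) * v) ^ q)
    (g := fun v : ℂ => ∑ k ∈ Finset.range (p + q + 1),
      ((wignerPoly p q θ).coeff k : ℂ) * u ^ k * v ^ (p + q - k))
    (by fun_prop) (by fun_prop) ?_) v
  intro v hv
  have hv : v ≠ 0 := hv
  have hdeg : (wignerPoly p q θ).natDegree < p + q + 1 := by
    have h1 : ∀ a b : ℝ, (Polynomial.C a * Polynomial.X + Polynomial.C b).natDegree ≤ 1 :=
      fun a b => Polynomial.natDegree_linear_le
    rw [wignerPoly, ← neg_mul, ← Polynomial.C_neg]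
    refine Nat.lt_succ_of_le (Polynomial.natDegree_mul_le.trans (add_le_add ?_ ?_))
    · exact (Polynomial.natDegree_pow_le_of_le p (h1 _ _)).trans (by simp)
    · exact (Polynomial.natDegree_pow_le_of_le q (h1 _ _)).trans (by simp)
  have e := Polynomial.eval₂_eq_sum_range' Complex.ofRealHom hdeg (u / v)
  have e2 : Polynomial.eval₂ Complex.ofRealHom (u / v) (wignerPoly p q θ) =
      ((Real.cos (θ / 2) : ℂ) * (u / v) + (Real.sin (θ / 2) : ℂ)) ^ p *
      (-((Real.sin (θ / 2) : ℂ) * (u / v)) + (Real.cos (θ / 2) : ℂ)) ^ q := by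
    simp only [wignerPoly, Polynomial.eval₂_mul, Polynomial.eval₂_pow, Polynomial.eval₂_add,
      Polynomial.eval₂_neg, Polynomial.eval₂_C, Polynomial.eval₂_X, Complex.ofRealHom_eq_coe]
  rw [e2] at e
  have e3 : ((Real.cos (θ / 2) : ℂ) * u + (Real.sin (θ / 2) : ℂ) * v) ^ p *
      (-(Real.sin (θ / 2) : ℂ) * u + (Real.cos (θ / 2) : ℂ) * v) ^ q = v ^ (p + q) *
      (((Real.cos (θ / 2) : ℂ) * (u / v) + (Real.sin (θ / 2) : ℂ)) ^ p *
      (-((Real.sin (θ / 2) : ℂ) * (u / v)) + (Real.cos (θ / 2) : ℂ)) ^ q) := by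
    rw [pow_add, mul_mul_mul_comm, ← mul_pow, ← mul_pow]
    congr 2 <;> field_simp
  simp only
  rw [e3, e, Finset.mul_sum]
  refine Finset.sum_congr rfl fun k hk => ?_
  have hk : k ≤ p + q := by simpa [Nat.lt_succ_iff] using hk
  rw [show v ^ (p + q) = v ^ (p + q - k) * v ^ k by rw [← pow_add]; congr 1; omega]
  simp only [Complex.ofRealHom_eq_coe, div_pow]
  field_simp

theorem spinGen_eq_sum {s : ℤ} {l : ℕ} (hl : s.natAbs ≤ l) (u v : ℂ) (p : Sphere2) :
    spinGen s l u v p = ∑ k ∈ Finset.range (2 * l + 1), harm s l k p * u ^ k * v ^ (2 * l - k) := by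
  set e := Complex.exp (Complex.I * (longit p / 2 : ℝ)) with he
  have hne : e ≠ 0 := Complex.exp_ne_zero _
  have he' : Complex.exp (-(Complex.I * (longit p / 2 : ℝ))) = e⁻¹ := Complex.exp_neg _
  have hpq : ((l : ℤ) - s).toNat + ((l : ℤ) + s).toNat = 2 * l := by omega
  have h := homogenize_wignerPoly ((l : ℤ) - s).toNat ((l : ℤ) + s).toNat (colat p) (e * u)
    (e⁻¹ * v)
  rw [hpq] at h
  rw [spinGen, conj_spinA, conj_spinB, spinA, spinB, ← he, he']
  refine Eq.trans ?_ (h.trans ?_)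
  · congr 2 <;> ring
  · refine Finset.sum_congr rfl fun k hk => ?_
    have hk : k ≤ 2 * l := by simpa [Nat.lt_succ_iff] using hk
    have h2 : Complex.exp (Complex.I * ((k : ℤ) - l : ℤ) * longit p) = e ^ k * e⁻¹ ^ (2 * l - k) := by
      rw [inv_pow, ← zpow_natCast, ← zpow_natCast, ← zpow_neg, ← zpow_add₀ hne, he,
        ← Complex.exp_int_mul]
      congr 1
      push_cast [hk]
      ring
    rw [harm, h2]
    simp only [mul_pow]
    ring

/-! ### Two families of rotations -/

/-- The rotation by a right angle about the second axis. -/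
def rotY : SO3 := ⟨!![0, 0, 1; 0, 1, 0; -1, 0, 0], by
  rw [Matrix.mem_specialOrthogonalGroup_iff]
  constructor
  · rw [Matrix.mem_orthogonalGroup_iff]
    ext i j
    fin_cases i <;> fin_cases j <;> simp [Matrix.mul_apply, Fin.sum_univ_three]
  · simp [Matrix.det_fin_three]⟩

/-- The rotation by the angle `α` about the third axis. -/
noncomputable def rotZ (α : ℝ) : SO3 :=
  ⟨!![Real.cos α, -Real.sin α, 0; Real.sin α, Real.cos α, 0; 0, 0, 1], by
  rw [Matrix.mem_specialOrthogonalGroup_iff]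
  have h := Real.sin_sq_add_cos_sq α
  constructor
  · rw [Matrix.mem_orthogonalGroup_iff]
    ext i j
    fin_cases i <;> fin_cases j <;> simp [Matrix.mul_apply, Fin.sum_univ_three] <;>
      nlinarith
  · simp [Matrix.det_fin_three]; nlinarith⟩

theorem vec_rotate (R : SO3) (p : Sphere2) : vec (rotate R p) = R.1 *ᵥ vec p := rfl

theorem vec_injective : Function.Injective vec := fun p q h => by
  apply Subtype.ext
  ext i
  exact congrFun h i

theorem rotate_one (p : Sphere2) : rotate 1 p = p := by
  apply vec_injective; rw [vec_rotate]; simp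

theorem rotate_mul (R S : SO3) (p : Sphere2) : rotate (R * S) p = rotate R (rotate S p) := by
  apply vec_injective; simp only [vec_rotate]; simp [Matrix.mulVec_mulVec]

theorem rotate_inv_rotate (R : SO3) (p : Sphere2) : rotate R⁻¹ (rotate R p) = p := by
  rw [← rotate_mul, inv_mul_cancel, rotate_one]

theorem rotate_rotate_inv (R : SO3) (p : Sphere2) : rotate R (rotate R⁻¹ p) = p := by
  rw [← rotate_mul, mul_inv_cancel, rotate_one]

theorem chart_one : chart 1 = chartI := by
  rw [chart, show rotate 1 = id from funext rotate_one, Set.image_id]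

theorem rho_one (p : Sphere2) : rho 1 p = rhoI p := by
  rw [rho, inv_one, rotate_one]; simp

theorem vec_rotY_inv (p : Sphere2) : vec (rotate rotY⁻¹ p) 0 = -vec p 2 ∧
    vec (rotate rotY⁻¹ p) 1 = vec p 1 ∧ vec (rotate rotY⁻¹ p) 2 = vec p 0 := by
  obtain ⟨x, rfl⟩ : ∃ x, p = rotate rotY x := ⟨_, (rotate_rotate_inv rotY p).symm⟩
  rw [rotate_inv_rotate, vec_rotate]
  simp [rotY, Matrix.mulVec, dotProduct, Fin.sum_univ_three]

/-- The value of the transition function in terms of a complex number of modulus one. -/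
theorem transition_eq_zpow (s : ℤ) (R₁ R₂ : SO3) (p : Sphere2) {z : ℂ} (hz : ‖z‖ = 1)
    (h : (⟨rho R₁ p ⬝ᵥ rho R₂ p, rot90 p (rho R₁ p) ⬝ᵥ rho R₂ p⟩ : ℂ) = z) :
    transition s R₁ R₂ p = z ^ s := by
  rw [transition, angle, h]
  have := Complex.norm_mul_exp_arg_mul_I z
  rw [hz, Complex.ofReal_one, one_mul] at this
  conv_rhs => rw [← this]
  rw [← Complex.exp_int_mul]
  congr 1
  ring

/-- A spinor is determined by its point up to a phase, and the normalization `2ab = sin θ > 0` ties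
that phase to the reference direction. The quarter turn lifts to a unitary matrix; its result and
the normalized spinor of the rotated point differ by a phase `z`, whose conjugate square is the
rotation between the two reference directions. -/
theorem exists_spinor_rotY {p : Sphere2} (hp : p ∈ chartI) (hx : rotate rotY⁻¹ p ∈ chartI) :
    ∃ z : ℂ, z * (starRingEnd ℂ) z = 1 ∧
      spinA (rotate rotY⁻¹ p) = z * ((spinA p + spinB p) / (Real.sqrt 2 : ℂ)) ∧
      spinB (rotate rotY⁻¹ p) = z * ((spinB p - spinA p) / (Real.sqrt 2 : ℂ)) ∧
      ∀ s : ℤ, transition s 1 rotY p = ((starRingEnd ℂ) z ^ 2) ^ s := by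
  obtain ⟨x0, x1, x2⟩ := vec_rotY_inv p
  set x := rotate rotY⁻¹ p with hxdef
  have hr : (axisDist p : ℂ) ≠ 0 := by exact_mod_cast (axisDist_pos hp).ne'
  have hrx : (axisDist x : ℂ) ≠ 0 := by exact_mod_cast (axisDist_pos hx).ne'
  have n1 := spinor_norm p
  have d1 := spinor_diff p
  have m1 := spinor_mul p
  have f1 := spinor_hopf p
  have f1' := congrArg (starRingEnd ℂ) f1
  have m1' := congrArg (starRingEnd ℂ) m1
  have n2 := spinor_norm x
  have d2 := spinor_diff x
  have m2 := spinor_mul x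
  have f2 := spinor_hopf x
  have f2' := congrArg (starRingEnd ℂ) f2
  have m2' := congrArg (starRingEnd ℂ) m2
  rw [x2] at d2
  rw [x0, x1] at f2 f2'
  simp only [map_add, map_mul, Complex.conj_ofReal, Complex.conj_I, Complex.conj_conj,
    map_ofNat, map_neg, Complex.ofReal_neg] at f1' f2' m1' m2' f2
  have h2 : (Real.sqrt 2 : ℂ) * (Real.sqrt 2 : ℂ) = 2 := by
    rw [← Complex.ofReal_mul, Real.mul_self_sqrt (by norm_num)]; norm_num
  have h2' : (Real.sqrt 2 : ℂ) ≠ 0 := by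
    intro h; rw [h] at h2; norm_num at h2
  obtain ⟨k, hk, hkc⟩ : ∃ k : ℂ, k * k * 2 = 1 ∧ (starRingEnd ℂ) k = k ∧ (Real.sqrt 2 : ℂ)⁻¹ = k := by
    refine ⟨_, ?_, ?_, rfl⟩
    · field_simp; rw [← h2]; ring
    · rw [map_inv₀, Complex.conj_ofReal]
  obtain ⟨hkc, hkk⟩ := hkc
  simp only [div_eq_mul_inv, hkk]
  set a := spinA p
  set b := spinB p
  set A := spinA x
  set B := spinB x
  generalize ha' : (starRingEnd ℂ) a = a' at *
  generalize hb' : (starRingEnd ℂ) b = b' at *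
  generalize hA' : (starRingEnd ℂ) A = A' at *
  generalize hB' : (starRingEnd ℂ) B = B' at *
  -- `H`, `H'`, `HA`, `HB` say that the two unit spinors have the same rank one projector. They are
  -- then proportional, and the factor `z` is their Hermitian inner product.
  have H : (a + b) * k * ((b' - a') * k) = A * B' := by
    linear_combination (1 / 2 : ℂ) * ((a + b) * (b' - a')) * hk + (1 / 4 : ℂ) * f1 -
      (1 / 4 : ℂ) * f1' - (1 / 2 : ℂ) * d1 - (1 / 2 : ℂ) * f2
  have H' : (a' + b') * k * ((b - a) * k) = A' * B := by
    linear_combination (1 / 2 : ℂ) * ((a' + b') * (b - a)) * hk - (1 / 4 : ℂ) * f1 +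
      (1 / 4 : ℂ) * f1' - (1 / 2 : ℂ) * d1 - (1 / 2 : ℂ) * f2'
  have HA : (a + b) * k * ((a' + b') * k) = A * A' := by
    linear_combination (1 / 2 : ℂ) * ((a + b) * (a' + b')) * hk + (1 / 4 : ℂ) * f1 +
      (1 / 4 : ℂ) * f1' + (1 / 2 : ℂ) * n1 - (1 / 2 : ℂ) * d2 - (1 / 2 : ℂ) * n2
  have HB : (b - a) * k * ((b' - a') * k) = B * B' := by
    linear_combination (1 / 2 : ℂ) * ((b - a) * (b' - a')) * hk - (1 / 4 : ℂ) * f1 -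
      (1 / 4 : ℂ) * f1' + (1 / 2 : ℂ) * n1 + (1 / 2 : ℂ) * d2 - (1 / 2 : ℂ) * n2
  have hz' : (starRingEnd ℂ) (A * ((a' + b') * k) + B * ((b' - a') * k)) =
      A' * ((a + b) * k) + B' * ((b - a) * k) := by
    simp only [map_add, map_mul, map_sub, hA', hB', hkc, ← ha', ← hb', Complex.conj_conj]
  have eA : A = (A * ((a' + b') * k) + B * ((b' - a') * k)) * ((a + b) * k) := by
    linear_combination -A * HA - B * H - A * n2
  have eB : B = (A * ((a' + b') * k) + B * ((b' - a') * k)) * ((b - a) * k) := by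
    linear_combination -A * H' - B * HB - B * n2
  have hzz : (A * ((a' + b') * k) + B * ((b' - a') * k)) *
      (A' * ((a + b) * k) + B' * ((b - a) * k)) = 1 := by
    linear_combination A * A' * HA + B * A' * H + A * B' * H' + B * B' * HB +
      (A * A' + B * B' + 1) * n2
  refine ⟨A * ((a' + b') * k) + B * ((b' - a') * k), ?_, eA, eB, fun s => ?_⟩
  · rw [hz', hzz]
  rw [hz']
  have hnorm : ‖A' * ((a + b) * k) + B' * ((b - a) * k)‖ = 1 := by
    have h3 : (starRingEnd ℂ) (A * ((a' + b') * k) + B * ((b' - a') * k)) *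
        (A * ((a' + b') * k) + B * ((b' - a') * k)) = 1 := by rw [hz', mul_comm, hzz]
    rw [mul_comm, Complex.mul_conj'] at h3
    rw [← hz', RCLike.norm_conj]
    have h4 : ‖A * ((a' + b') * k) + B * ((b' - a') * k)‖ ^ 2 = 1 := by exact_mod_cast h3
    nlinarith [norm_nonneg (A * ((a' + b') * k) + B * ((b' - a') * k))]
  generalize A * ((a' + b') * k) + B * ((b' - a') * k) = z at *
  generalize A' * ((a + b) * k) + B' * ((b - a) * k) = z' at *
  have hval : z' ^ 2 * axisDist x * axisDist p = -vec p 0 * vec p 2 - Complex.I * vec p 1 := by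
    -- The normalization `2AB = axisDist x` turns `z' ^ 2` into an expression in `a` and `b`;
    -- multiplying by `axisDist p = 2 a' b'` makes it a function of the Cartesian coordinates.
    have e1 : z' ^ 2 * axisDist x = b ^ 2 - a ^ 2 := by
      rw [← m2]
      have : A * B = z ^ 2 * ((a + b) * k * ((b - a) * k)) := by
        calc A * B = (z * ((a + b) * k)) * (z * ((b - a) * k)) := by rw [← eA, ← eB]
          _ = _ := by ring
      rw [this]
      linear_combination 2 * ((a + b) * k * ((b - a) * k)) * (z * z' + 1) * hzz +
        (b ^ 2 - a ^ 2) * hk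
    rw [e1]
    linear_combination -(b ^ 2 - a ^ 2) * m1' - a * a' * f1 + b * b' * f1' - vec p 0 * d1 -
      Complex.I * vec p 1 * n1
  have hz2 : z' ^ 2 = (⟨-(vec p 0 * vec p 2) / (axisDist x * axisDist p),
      -vec p 1 / (axisDist x * axisDist p)⟩ : ℂ) := by
    have : z' ^ 2 = (-vec p 0 * vec p 2 - Complex.I * vec p 1) / (axisDist x * axisDist p) := by
      rw [eq_div_iff (mul_ne_zero hrx hr), ← mul_assoc, hval]
    rw [this, Complex.mk_eq_add_mul_I]
    push_cast
    field_simp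
    ring
  refine transition_eq_zpow s 1 rotY p (by rw [norm_pow, hnorm, one_pow]) ?_
  rw [hz2, rho_one]
  have e1 : rho rotY p = (axisDist x)⁻¹ • ![0, -vec p 2, vec p 1] := by
    have : rhoI x = (axisDist x)⁻¹ • ![-vec x 1, vec x 0, 0] := rfl
    rw [rho, ← hxdef, this, x0, x1, Matrix.mulVec_smul]
    congr 1
    ext i
    fin_cases i <;> simp [rotY, Matrix.mulVec, dotProduct, Fin.sum_univ_three]
  have e2 : rhoI p = (axisDist p)⁻¹ • ![-vec p 1, vec p 0, 0] := rfl
  have e3 : rot90 p (rhoI p) =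
      (axisDist p)⁻¹ • ![vec p 0 * vec p 2, vec p 1 * vec p 2, -(axisDist p ^ 2)] := by
    rw [rot90, e2, map_smul, LinearMap.smul_apply, cross_apply, axisDist_sq]
    congr 1
    ext i
    fin_cases i <;> simp
    ring
  have hsum := vec_sq_sum p
  have hsq := axisDist_sq p
  rw [e3, e1, e2]
  have hr' := (axisDist_pos hp).ne'
  have hrx' := (axisDist_pos hx).ne'
  apply Complex.ext
  · simp only [dotProduct, Fin.sum_univ_three, Pi.smul_apply, smul_eq_mul]
    simp
    field_simp
  · simp only [dotProduct, Fin.sum_univ_three, Pi.smul_apply, smul_eq_mul]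
    simp
    field_simp
    linear_combination (-vec p 1) * hsum - vec p 1 * hsq

theorem vec_rotZ_inv (α : ℝ) (p : Sphere2) :
    vec (rotate (rotZ α)⁻¹ p) 0 = Real.cos α * vec p 0 + Real.sin α * vec p 1 ∧
    vec (rotate (rotZ α)⁻¹ p) 1 = -Real.sin α * vec p 0 + Real.cos α * vec p 1 ∧
    vec (rotate (rotZ α)⁻¹ p) 2 = vec p 2 := by
  obtain ⟨x, rfl⟩ : ∃ x, p = rotate (rotZ α) x := ⟨_, (rotate_rotate_inv (rotZ α) p).symm⟩
  rw [rotate_inv_rotate, vec_rotate]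
  have h := Real.sin_sq_add_cos_sq α
  simp only [rotZ, Matrix.mulVec, dotProduct, Fin.sum_univ_three]
  refine ⟨?_, ?_, ?_⟩
  · simp; linear_combination -(vec x 0) * h
  · simp; linear_combination -(vec x 1) * h
  · simp

theorem axisDist_rotZ_inv (α : ℝ) (p : Sphere2) : axisDist (rotate (rotZ α)⁻¹ p) = axisDist p := by
  obtain ⟨x0, x1, -⟩ := vec_rotZ_inv α p
  rw [axisDist, x0, x1, axisDist]
  congr 1
  linear_combination (vec p 0 ^ 2 + vec p 1 ^ 2) * Real.sin_sq_add_cos_sq α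

theorem transition_rotZ (s : ℤ) (α : ℝ) {p : Sphere2} (hp : p ∈ chartI) :
    transition s 1 (rotZ α) p = 1 := by
  have hr := (axisDist_pos hp).ne'
  have hsq := axisDist_sq p
  have e1 : rho (rotZ α) p = rhoI p := by
    obtain ⟨x0, x1, x2⟩ := vec_rotZ_inv α p
    have : rhoI (rotate (rotZ α)⁻¹ p) = (axisDist (rotate (rotZ α)⁻¹ p))⁻¹ •
      ![-vec (rotate (rotZ α)⁻¹ p) 1, vec (rotate (rotZ α)⁻¹ p) 0, 0] := rfl
    have e2 : rhoI p = (axisDist p)⁻¹ • ![-vec p 1, vec p 0, 0] := rfl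
    rw [rho, this, axisDist_rotZ_inv, x0, x1, Matrix.mulVec_smul, e2]
    congr 1
    have h := Real.sin_sq_add_cos_sq α
    ext i
    fin_cases i
    · simp [rotZ, Matrix.mulVec, dotProduct, Fin.sum_univ_three]
      linear_combination -(vec p 1) * h
    · simp [rotZ, Matrix.mulVec, dotProduct, Fin.sum_univ_three]
      linear_combination (vec p 0) * h
    · simp [rotZ, Matrix.mulVec, dotProduct, Fin.sum_univ_three]
  rw [transition_eq_zpow s 1 (rotZ α) p (z := 1) (by simp), one_zpow]
  have e2 : rhoI p = (axisDist p)⁻¹ • ![-vec p 1, vec p 0, 0] := rfl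
  rw [rho_one, e1, rot90, e2, map_smul, LinearMap.smul_apply, cross_apply]
  apply Complex.ext
  · simp only [dotProduct, Fin.sum_univ_three, Pi.smul_apply, smul_eq_mul]
    simp
    field_simp
    linear_combination -hsq
  · simp only [dotProduct, Fin.sum_univ_three, Pi.smul_apply, smul_eq_mul]
    simp
    field_simp
    ring

/-! ### Behaviour of the harmonics under the two families of rotations -/

/-- The first linear form is multiplied by the phase `z` and the second by `z⁻¹`, so their powers
contribute `z ^ (l - s) * z ^ (-(l + s)) = z ^ (-2s)`. After conjugation this cancels the transition
function, leaving the linear substitution in `(u, v)`. -/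
theorem spinGen_rotY {s : ℤ} {l : ℕ} (hl : s.natAbs ≤ l) (u v : ℂ) {p : Sphere2} (hp : p ∈ chartI)
    (hx : rotate rotY⁻¹ p ∈ chartI) :
    transition s 1 rotY p * (starRingEnd ℂ) (spinGen s l u v (rotate rotY⁻¹ p)) =
      (starRingEnd ℂ) (spinGen s l ((u - v) / (Real.sqrt 2 : ℂ)) ((u + v) / (Real.sqrt 2 : ℂ)) p) := by
  obtain ⟨z, hz, hA, hB, ht⟩ := exists_spinor_rotY hp hx
  have hz0 : z ≠ 0 := by rintro rfl; simp at hz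
  have hzc : (starRingEnd ℂ) z = z⁻¹ := by field_simp; rw [mul_comm]; exact hz
  rw [ht s, spinGen, spinGen, hA, hB]
  set a := spinA p
  set b := spinB p
  have e1 : z * ((a + b) / (Real.sqrt 2 : ℂ)) * u + z * ((b - a) / (Real.sqrt 2 : ℂ)) * v =
      z * (a * ((u - v) / (Real.sqrt 2 : ℂ)) + b * ((u + v) / (Real.sqrt 2 : ℂ))) := by ring
  have e2 : -(starRingEnd ℂ) (z * ((b - a) / (Real.sqrt 2 : ℂ))) * u +
      (starRingEnd ℂ) (z * ((a + b) / (Real.sqrt 2 : ℂ))) * v =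
      z⁻¹ * (-(starRingEnd ℂ) b * ((u - v) / (Real.sqrt 2 : ℂ)) +
        (starRingEnd ℂ) a * ((u + v) / (Real.sqrt 2 : ℂ))) := by
    simp only [map_mul, map_div₀, map_add, map_sub, Complex.conj_ofReal, hzc]
    ring
  rw [e1, e2, mul_pow, mul_pow, mul_mul_mul_comm, map_mul, ← mul_assoc, map_mul, map_pow, map_pow,
    map_inv₀, hzc, inv_inv]
  have e3 : (z⁻¹ ^ 2) ^ s * (z⁻¹ ^ ((l : ℤ) - s).toNat * z ^ ((l : ℤ) + s).toNat) = 1 := by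
    simp only [← zpow_natCast, inv_zpow']
    rw [← zpow_mul, ← zpow_add₀ hz0, ← zpow_add₀ hz0, Int.toNat_of_nonneg (by omega),
      Int.toNat_of_nonneg (by omega)]
    rw [show -((2 : ℕ) : ℤ) * s + (-((l : ℤ) - s) + ((l : ℤ) + s)) = 0 by push_cast; ring, zpow_zero]
  rw [e3, one_mul]

theorem exp_longit_rotZ_inv (α : ℝ) {p : Sphere2} (hp : p ∈ chartI) :
    Complex.exp (Complex.I * longit (rotate (rotZ α)⁻¹ p)) =
      Complex.exp (-(Complex.I * α)) * Complex.exp (Complex.I * longit p) := by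
  have hr : (axisDist p : ℂ) ≠ 0 := by exact_mod_cast (axisDist_pos hp).ne'
  have h1 := axisDist_mul_exp_longit (rotate (rotZ α)⁻¹ p)
  have h2 := axisDist_mul_exp_longit p
  obtain ⟨x0, x1, -⟩ := vec_rotZ_inv α p
  rw [axisDist_rotZ_inv, x0, x1] at h1
  apply mul_left_cancel₀ hr
  rw [h1, mul_left_comm, h2, ← mul_neg, mul_comm Complex.I (-(α : ℂ)), Complex.exp_mul_I, Complex.cos_neg,
    Complex.sin_neg]
  push_cast
  linear_combination (Complex.sin α * vec p 1) * Complex.I_sq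

theorem harm_rotZ (s : ℤ) (l k : ℕ) (α : ℝ) {p : Sphere2} (hp : p ∈ chartI) :
    transition s 1 (rotZ α) p * (starRingEnd ℂ) (harm s l k (rotate (rotZ α)⁻¹ p)) =
      (starRingEnd ℂ) (Complex.exp (-(Complex.I * ((k : ℤ) - l : ℤ) * α)) * harm s l k p) := by
  rw [transition_rotZ s α hp, one_mul]
  congr 1
  have hc : colat (rotate (rotZ α)⁻¹ p) = colat p := by
    rw [colat, colat, (vec_rotZ_inv α p).2.2]
  have e : ∀ x : ℝ, Complex.exp (Complex.I * ((k : ℤ) - l : ℤ) * x) =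
      Complex.exp (Complex.I * x) ^ ((k : ℤ) - l) := by
    intro x
    rw [← Complex.exp_int_mul]; congr 1; ring
  have e' : Complex.exp (-(Complex.I * ((k : ℤ) - l : ℤ) * α)) =
      Complex.exp (-(Complex.I * α)) ^ ((k : ℤ) - l) := by
    rw [← Complex.exp_int_mul]; congr 1; ring
  rw [harm, harm, hc, e, e, e', exp_longit_rotZ_inv α hp, mul_zpow, mul_assoc]

/-! ### Measurability and boundedness of the harmonics. -/

theorem continuous_coeff_wignerPoly (p q k : ℕ) :
    Continuous fun θ => (wignerPoly p q θ).coeff k :=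
  continuous_iff_continuousAt.2 fun θ => (hasCoeffDerivAt_wignerPoly p q θ k).continuousAt

theorem measurable_vec (i : Fin 3) : Measurable fun p : Sphere2 => vec p i := by
  unfold vec
  fun_prop

theorem measurable_harm (s : ℤ) (l k : ℕ) : Measurable (harm s l k) := by
  have h1 : Measurable colat := Real.measurable_arccos.comp (measurable_vec 2)
  have h2 : Measurable longit := by
    have : longit = fun p => Complex.arg ((vec p 0 : ℂ) + (vec p 1 : ℂ) * Complex.I) := by
      funext p; rw [longit, Complex.mk_eq_add_mul_I]
    rw [this]
    exact Complex.measurable_arg.comp ((Complex.measurable_ofReal.comp (measurable_vec 0)).add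
      ((Complex.measurable_ofReal.comp (measurable_vec 1)).mul_const _))
  unfold harm
  exact ((((Complex.measurable_ofReal.comp h2).const_mul _).cexp)).mul
    (Complex.measurable_ofReal.comp ((continuous_coeff_wignerPoly _ _ _).measurable.comp h1))

theorem exists_norm_harm_le (s : ℤ) (l k : ℕ) : ∃ M, ∀ p, ‖harm s l k p‖ ≤ M := by
  obtain ⟨M, hM⟩ := (isCompact_Icc (a := (0 : ℝ)) (b := Real.pi)).exists_bound_of_continuousOn
    (continuous_coeff_wignerPoly ((l : ℤ) - s).toNat ((l : ℤ) + s).toNat k).continuousOn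
  refine ⟨M, fun p => ?_⟩
  rw [harm, norm_mul, mul_assoc, Complex.norm_exp, Complex.norm_real]
  have h2 : (Complex.I * ((((k : ℤ) - l : ℤ) : ℂ) * (longit p : ℂ))).re = 0 := by
    rw [Complex.I_mul_re, ← Complex.ofReal_intCast, ← Complex.ofReal_mul, Complex.ofReal_im, neg_zero]
  rw [h2, Real.exp_zero, one_mul]
  exact hM _ ⟨Real.arccos_nonneg _, Real.arccos_le_pi _⟩

open scoped Pointwise

/-! ### Rotation invariance of the surface measure -/

/-- The linear isometry of `ℝ³` given by a rotation matrix. -/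
noncomputable def rotIsometry (R : SO3) :
    EuclideanSpace ℝ (Fin 3) ≃ₗᵢ[ℝ] EuclideanSpace ℝ (Fin 3) :=
  LinearIsometry.toLinearIsometryEquiv
    { toLinearMap := Matrix.toEuclideanLin R.1
      norm_map' := fun x => by
        have hR : R.1ᵀ * R.1 = 1 := by
          have h := (Matrix.mem_specialOrthogonalGroup_iff.1 R.2).1
          exact (Matrix.mem_orthogonalGroup_iff' (Fin 3) ℝ).1 h
        have key : ∀ v : EuclideanSpace ℝ (Fin 3), ‖v‖ ^ 2 = v.ofLp ⬝ᵥ v.ofLp := by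
          intro v
          rw [EuclideanSpace.norm_sq_eq]
          simp [dotProduct, pow_two]
        have h2 : ‖Matrix.toEuclideanLin R.1 x‖ ^ 2 = ‖x‖ ^ 2 := by
          rw [key, key]
          change (R.1 *ᵥ x.ofLp) ⬝ᵥ (R.1 *ᵥ x.ofLp) = _
          rw [Matrix.dotProduct_mulVec, Matrix.vecMul_mulVec, hR, Matrix.vecMul_one]
        exact (sq_eq_sq₀ (norm_nonneg _) (norm_nonneg _)).1 h2 } rfl

theorem rotIsometry_coe (R : SO3) (p : Sphere2) :
    rotIsometry R (p : EuclideanSpace ℝ (Fin 3)) = (rotate R p : EuclideanSpace ℝ (Fin 3)) := rfl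

theorem measurable_rotate (R : SO3) : Measurable (rotate R) := by
  have : Continuous (rotate R) :=
    Continuous.subtype_mk ((rotIsometry R).continuous.comp continuous_subtype_val) _
  exact this.measurable

/-- The surface measure of a set is proportional to the volume of the cone over it in the unit ball.
Rotation commutes with forming the cone and is a linear isometry, hence preserves volume. -/
theorem measurePreserving_rotate (R : SO3) : MeasurePreserving (rotate R) surface surface := by
  refine ⟨measurable_rotate R, Measure.ext fun S hS => ?_⟩
  rw [Measure.map_apply (measurable_rotate R) hS, surface,
    Measure.toSphere_apply' _ (measurable_rotate R hS), Measure.toSphere_apply' _ hS]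
  congr 1
  have e : Set.Ioo (0 : ℝ) 1 • (Subtype.val '' (rotate R ⁻¹' S)) =
      rotIsometry R ⁻¹' (Set.Ioo (0 : ℝ) 1 • (Subtype.val '' S)) := by
    ext x
    simp only [Set.mem_smul, Set.mem_preimage, Set.mem_image]
    constructor
    · rintro ⟨c, hc, _, ⟨p, hp, rfl⟩, rfl⟩
      exact ⟨c, hc, _, ⟨rotate R p, hp, rfl⟩, by rw [map_smul, rotIsometry_coe]⟩
    · rintro ⟨c, hc, _, ⟨p, hp, rfl⟩, h⟩
      refine ⟨c, hc, _, ⟨rotate R⁻¹ p, by rwa [rotate_rotate_inv], rfl⟩, ?_⟩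
      apply (rotIsometry R).injective
      rw [map_smul, rotIsometry_coe, rotate_rotate_inv, h]
  rw [e]
  exact (rotIsometry R).measurePreserving.measure_preimage_equiv (f := (rotIsometry R).toMeasurableEquiv) _

theorem surface_singleton (p : Sphere2) : surface {p} = 0 := by
  rw [surface, Measure.toSphere_apply' _ (measurableSet_singleton p)]
  have h : volume (Set.Ioo (0 : ℝ) 1 • ((Subtype.val : Sphere2 → EuclideanSpace ℝ (Fin 3)) '' {p})) = 0 := by
    refine measure_mono_null (t := (Submodule.span ℝ {(p : EuclideanSpace ℝ (Fin 3))} :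
      Set (EuclideanSpace ℝ (Fin 3)))) ?_ (Measure.addHaar_submodule _ _ ?_)
    · rintro _ ⟨c, hc, _, ⟨q, rfl, rfl⟩, rfl⟩
      exact Submodule.smul_mem _ _ (Submodule.mem_span_singleton_self _)
    · intro h
      have h1 := finrank_span_singleton (K := ℝ) (ne_zero_of_mem_unit_sphere p)
      rw [h, finrank_top] at h1
      simp at h1
  rw [h, mul_zero]

theorem measurableSet_chartI : MeasurableSet chartI := by
  have h : ∀ v : Fin 3 → ℝ, MeasurableSet {p : Sphere2 | vec p = v} := fun v =>
    (measurable_pi_iff.2 measurable_vec) (measurableSet_singleton v)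
  exact ((h _).union (h _)).compl

theorem ae_mem_chartI : ∀ᵐ p ∂surface, p ∈ chartI := by
  have h : ∀ v : Fin 3 → ℝ, surface {p : Sphere2 | vec p = v} = 0 := fun v => by
    by_cases hv : ∃ p, vec p = v
    · obtain ⟨p, rfl⟩ := hv
      rw [show {q : Sphere2 | vec q = vec p} = {p} from Set.ext fun q => vec_injective.eq_iff]
      exact surface_singleton p
    · rw [show {q : Sphere2 | vec q = v} = ∅ from Set.eq_empty_of_forall_notMem fun q hq => hv ⟨q, hq⟩]
      exact measure_empty
  rw [ae_iff]
  simp only [chartI, Set.mem_ofPred_eq, not_not]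
  exact measure_union_null (h _) (h _)

instance : IsFiniteMeasure surface := by unfold surface; infer_instance

theorem restrict_surface_chartI : surface.restrict chartI = surface :=
  Measure.restrict_eq_self_of_ae_mem ae_mem_chartI

end SpinField

/-! ### Pairings of the field with test functions and rotation invariance of their moments. -/

namespace SpinField

namespace RandomSpinField

variable {Ω : Type*} [MeasurableSpace Ω] {s : ℤ} {P : Measure Ω}

open Classical in
/-- The trivialization over `U_I`, extended by zero to the poles. -/
noncomputable def sec (G : RandomSpinField s P) (p : Sphere2) (ω : Ω) : ℂ :=
  if p ∈ chartI then G.toFun 1 p ω else 0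

theorem sec_of_mem (G : RandomSpinField s P) {p : Sphere2} (hp : p ∈ chartI) (ω : Ω) :
    G.sec p ω = G.toFun 1 p ω := if_pos hp

theorem measurable_sec (G : RandomSpinField s P) :
    Measurable fun q : Sphere2 × Ω => G.sec q.1 q.2 := by
  refine measurable_of_restrict_of_restrict_compl
    (measurableSet_chartI.prod MeasurableSet.univ) ?_ ?_
  · have h := G.measurable_toFun 1
    have e : (chartI ×ˢ (Set.univ : Set Ω)).domRestrict (fun q : Sphere2 × Ω => G.sec q.1 q.2) =
        (fun q : chart 1 × Ω => G.toFun 1 q.1 q.2) ∘ fun z : (chartI ×ˢ (Set.univ : Set Ω) : Set _) =>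
          ((⟨z.1.1, by rw [chart_one]; exact z.2.1⟩ : chart 1), z.1.2) := by
      funext z
      exact G.sec_of_mem z.2.1 _
    rw [e]
    refine h.comp (Measurable.prodMk (Measurable.subtype_mk ?_) ?_)
    · exact measurable_fst.comp measurable_subtype_coe
    · exact measurable_snd.comp measurable_subtype_coe
  · have e : (chartI ×ˢ (Set.univ : Set Ω))ᶜ.domRestrict (fun q : Sphere2 × Ω => G.sec q.1 q.2) =
        fun _ => 0 := by
      funext z
      refine if_neg fun h => z.2 ⟨h, trivial⟩
    rw [e]
    exact measurable_const

theorem measurable_sec_apply (G : RandomSpinField s P) (p : Sphere2) : Measurable (G.sec p) :=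
  G.measurable_sec.comp measurable_prodMk_left

theorem measurable_rotI (G : RandomSpinField s P) (R : SO3) {x : Sphere2} (hx : x ∈ chartI) :
    Measurable (G.rotI R x) :=
  (G.measurable_toFun R).comp
    (measurable_prodMk_left (x := (⟨rotate R x, Set.mem_image_of_mem _ hx⟩ : chart R)))

theorem rotI_one (G : RandomSpinField s P) {x : Sphere2} (hx : x ∈ chartI) :
    G.rotI 1 x = G.sec x := by
  funext ω
  rw [rotI, rotate_one, G.sec_of_mem hx]

theorem rotI_ae_eq (G : RandomSpinField s P) (R : SO3) {x : Sphere2} (hx : x ∈ chartI)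
    (hRx : rotate R x ∈ chartI) :
    ∀ᵐ ω ∂P, G.rotI R x ω = transition s 1 R (rotate R x) * G.sec (rotate R x) ω := by
  filter_upwards [G.ae_transition 1 R (rotate R x) (by rwa [chart_one])
    (Set.mem_image_of_mem _ hx)] with ω hω
  rw [rotI, hω, G.sec_of_mem hRx]

/-- The `L²` pairing of the field with a function on the sphere, in the trivialization over
`U_I`. -/
noncomputable def proj (G : RandomSpinField s P) (h : Sphere2 → ℂ) (ω : Ω) : ℂ :=
  ∫ p, G.sec p ω * (starRingEnd ℂ) (h p) ∂surface

theorem coeff_eq_proj (G : RandomSpinField s P) {l : ℕ} (hl : s.natAbs ≤ l) {m : ℤ} (hm : |m| ≤ l)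
    (ω : Ω) :
    G.coeff l m ω = (harmConst s l m : ℂ) * G.proj (harm s l ((l : ℤ) + m).toNat) ω := by
  rw [coeff, restrict_surface_chartI, proj, ← integral_const_mul]
  refine integral_congr_ae ?_
  filter_upwards [ae_mem_chartI] with p hp
  rw [G.sec_of_mem hp, spinY_eq hl hm hp, map_mul, Complex.conj_ofReal]
  ring

theorem memLp_sec [IsProbabilityMeasure P] (G : RandomSpinField s P) :
    MemLp (fun q : Sphere2 × Ω => G.sec q.1 q.2) 2 (surface.prod P) := by
  refine ⟨G.measurable_sec.aestronglyMeasurable, ?_⟩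
  rw [eLpNorm_lt_top_iff_lintegral_rpow_enorm_lt_top (by norm_num) (by norm_num),
    lintegral_prod_symm _ (G.measurable_sec.enorm.pow_const _).aemeasurable]
  refine lt_of_eq_of_lt ?_ G.lintegral_sq_lt_top
  refine lintegral_congr fun ω => ?_
  rw [restrict_surface_chartI]
  refine lintegral_congr_ae ?_
  filter_upwards [ae_mem_chartI] with p hp
  rw [G.sec_of_mem hp]
  norm_num

theorem measurable_proj (G : RandomSpinField s P) {h : Sphere2 → ℂ} (hh : Measurable h) :
    StronglyMeasurable (G.proj h) := by
  have : Measurable fun q : Ω × Sphere2 => G.sec q.2 q.1 * (starRingEnd ℂ) (h q.2) :=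
    (G.measurable_sec.comp measurable_swap).mul
      (Complex.continuous_conj.measurable.comp (hh.comp measurable_snd))
  exact this.stronglyMeasurable.integral_prod_right

variable [IsProbabilityMeasure P]

theorem memLp_proj (G : RandomSpinField s P) {h : Sphere2 → ℂ} (hh : Measurable h)
    (hb : ∃ M, ∀ p, ‖h p‖ ≤ M) : MemLp (G.proj h) 2 P := by
  obtain ⟨M, hM⟩ := hb
  refine ⟨(G.measurable_proj hh).aestronglyMeasurable, ?_⟩
  rw [eLpNorm_lt_top_iff_lintegral_rpow_enorm_lt_top (by norm_num) (by norm_num)]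
  have hS := G.memLp_sec.2
  rw [eLpNorm_lt_top_iff_lintegral_rpow_enorm_lt_top (by norm_num) (by norm_num),
    lintegral_prod_symm _ (G.measurable_sec.enorm.pow_const _).aemeasurable] at hS
  have key : ∀ ω, ‖G.proj h ω‖ₑ ^ (2 : ℝ≥0∞).toReal ≤ (ENNReal.ofReal M ^ 2 * surface Set.univ) *
      ∫⁻ p, ‖G.sec p ω‖ₑ ^ (2 : ℝ≥0∞).toReal ∂surface := by
    intro ω
    have hmeas : AEStronglyMeasurable (fun p => G.sec p ω) surface :=
      (G.measurable_sec.comp measurable_prodMk_right).aestronglyMeasurable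
    have h1 : ‖G.proj h ω‖ₑ ≤ ENNReal.ofReal M * eLpNorm (fun p => G.sec p ω) 1 surface := by
      refine (enorm_integral_le_lintegral_enorm _).trans ?_
      rw [eLpNorm_one_eq_lintegral_enorm, ← lintegral_const_mul' _ _ ENNReal.ofReal_ne_top]
      refine lintegral_mono fun p => ?_
      rw [enorm_mul, mul_comm]
      gcongr
      rw [← ofReal_norm, RCLike.norm_conj]
      exact ENNReal.ofReal_le_ofReal (hM p)
    have h2 := eLpNorm_le_eLpNorm_mul_rpow_measure_univ (p := 1) (q := 2) (by norm_num) hmeas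
    have h3 : eLpNorm (fun p => G.sec p ω) 2 surface ^ (2 : ℝ) =
        ∫⁻ p, ‖G.sec p ω‖ₑ ^ (2 : ℝ≥0∞).toReal ∂surface := by
      rw [eLpNorm_eq_lintegral_rpow_enorm_toReal (by norm_num) (by norm_num), ← ENNReal.rpow_mul]
      norm_num
    rw [← h3]
    calc ‖G.proj h ω‖ₑ ^ (2 : ℝ≥0∞).toReal
        ≤ (ENNReal.ofReal M * (eLpNorm (fun p => G.sec p ω) 2 surface *
          surface Set.univ ^ (1 / (1 : ℝ≥0∞).toReal - 1 / (2 : ℝ≥0∞).toReal))) ^ (2 : ℝ) := by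
          simp only [ENNReal.toReal_ofNat]
          gcongr
          exact h1.trans (by gcongr; simpa using h2)
      _ = _ := by
          rw [ENNReal.mul_rpow_of_nonneg _ _ (by norm_num), ENNReal.mul_rpow_of_nonneg _ _ (by norm_num),
            ← ENNReal.rpow_mul]
          norm_num
          ring
  refine (lintegral_mono key).trans_lt ?_
  rw [lintegral_const_mul' _ _ (ENNReal.mul_ne_top (by simp) (measure_ne_top _ _))]
  exact ENNReal.mul_lt_top (ENNReal.mul_lt_top (by simp) (measure_lt_top _ _)) hS

/-- Fubini's theorem for the pairing of the field with a test function. -/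
theorem integral_mul_proj (G : RandomSpinField s P) {h : Sphere2 → ℂ} (hh : Measurable h)
    (hb : ∃ M, ∀ p, ‖h p‖ ≤ M) {η : Ω → ℂ} (hη : MemLp η 2 P) :
    ∫ ω, η ω * G.proj h ω ∂P = ∫ p, (∫ ω, η ω * G.sec p ω ∂P) * (starRingEnd ℂ) (h p) ∂surface := by
  obtain ⟨M, hM⟩ := hb
  have h1 : Integrable (fun q : Sphere2 × Ω => η q.2 * G.sec q.1 q.2) (surface.prod P) :=
    (hη.comp_snd surface).integrable_mul G.memLp_sec
  have h2 : Integrable (fun q : Sphere2 × Ω => (starRingEnd ℂ) (h q.1) * (η q.2 * G.sec q.1 q.2))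
      (surface.prod P) :=
    h1.bdd_mul (c := M)
      (Complex.continuous_conj.measurable.comp (hh.comp measurable_fst)).aestronglyMeasurable
      (Eventually.of_forall fun q => by rw [RCLike.norm_conj]; exact hM _)
  have h3 := integral_integral_swap (f := fun p ω => (starRingEnd ℂ) (h p) * (η ω * G.sec p ω)) h2
  simp only [integral_const_mul] at h3
  calc ∫ ω, η ω * G.proj h ω ∂P
      = ∫ ω, ∫ p, (starRingEnd ℂ) (h p) * (η ω * G.sec p ω) ∂surface ∂P := by
        refine integral_congr_ae (Eventually.of_forall fun ω => ?_)
        simp only [proj]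
        rw [← integral_const_mul]
        refine integral_congr_ae (Eventually.of_forall fun p => ?_)
        simp only; ring
    _ = _ := by
        rw [← h3]
        refine integral_congr_ae (Eventually.of_forall fun p => ?_)
        simp only; ring

/-- The covariance kernel of the field. -/
noncomputable def kernel (G : RandomSpinField s P) (x y : Sphere2) : ℂ :=
  ∫ ω, G.sec x ω * (starRingEnd ℂ) (G.sec y ω) ∂P

theorem ae_memLp_sec (G : RandomSpinField s P) : ∀ᵐ p ∂surface, MemLp (G.sec p) 2 P := by
  have h := (memLp_two_iff_integrable_sq_norm G.memLp_sec.1).1 G.memLp_sec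
  filter_upwards [h.prod_right_ae] with p hp
  exact (memLp_two_iff_integrable_sq_norm (G.measurable_sec_apply p).aestronglyMeasurable).2 hp

/-- Fubini is applied one pairing at a time, with the other square integrable factor held fixed:
first the whole variable `G.proj h`, then the value of the field at almost every `y`. No
integrability on a triple product is needed. -/
theorem integral_proj_mul_conj_proj (G : RandomSpinField s P) {h k : Sphere2 → ℂ}
    (hh : Measurable h) (hb : ∃ M, ∀ p, ‖h p‖ ≤ M) (hk : Measurable k) (kb : ∃ M, ∀ p, ‖k p‖ ≤ M) :
    ∫ ω, G.proj h ω * (starRingEnd ℂ) (G.proj k ω) ∂P =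
      ∫ y, (∫ x, G.kernel x y * (starRingEnd ℂ) (h x) ∂surface) * k y ∂surface := by
  have h1 := G.integral_mul_proj hk kb (η := fun ω => (starRingEnd ℂ) (G.proj h ω))
    (G.memLp_proj hh hb).star
  have h2 := congrArg (starRingEnd ℂ) h1
  rw [← integral_conj, ← integral_conj] at h2
  simp only [map_mul, Complex.conj_conj] at h2
  rw [h2]
  refine integral_congr_ae ?_
  filter_upwards [G.ae_memLp_sec] with y hy
  have h3 := G.integral_mul_proj hh hb (η := fun ω => (starRingEnd ℂ) (G.sec y ω)) hy.star
  congr 1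
  rw [← integral_conj]
  simp only [map_mul, Complex.conj_conj]
  calc ∫ ω, G.proj h ω * (starRingEnd ℂ) (G.sec y ω) ∂P
      = ∫ ω, (starRingEnd ℂ) (G.sec y ω) * G.proj h ω ∂P := by simp only [mul_comm]
    _ = _ := by rw [h3]; simp only [kernel, mul_comm]

/-- `h'` is the rotation of the section `h` by `R`, in the trivializations over `U_I`. -/
def IsRotated (s : ℤ) (R : SO3) (h h' : Sphere2 → ℂ) : Prop :=
  ∀ p ∈ chartI, rotate R⁻¹ p ∈ chartI →
    transition s 1 R p * (starRingEnd ℂ) (h (rotate R⁻¹ p)) = (starRingEnd ℂ) (h' p)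

/-- Rotations as measurable equivalences of the sphere. -/
noncomputable def rotEquiv (R : SO3) : Sphere2 ≃ᵐ Sphere2 where
  toFun := rotate R
  invFun := rotate R⁻¹
  left_inv := rotate_inv_rotate R
  right_inv := rotate_rotate_inv R
  measurable_toFun := measurable_rotate R
  measurable_invFun := measurable_rotate R⁻¹

theorem integral_rotate (R : SO3) (g : Sphere2 → ℂ) :
    ∫ x, g (rotate R x) ∂surface = ∫ x, g x ∂surface :=
  (measurePreserving_rotate R).integral_comp (rotEquiv R).measurableEmbedding g

theorem ae_rotate_mem_chartI (R : SO3) : ∀ᵐ x ∂surface, rotate R x ∈ chartI :=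
  (measurePreserving_rotate R).quasiMeasurePreserving.ae ae_mem_chartI

omit [IsProbabilityMeasure P] in
-- Isotropy for two points, tested on `f 0 * conj (f 1)`. Equality of laws gives equality of the
-- integrals without any integrability, so the formula holds pointwise, including where the kernel
-- is the default value `0`.
theorem kernel_rotate (G : RandomSpinField s P) (hG : G.Isotropic) (R : SO3) {x y : Sphere2}
    (hx : x ∈ chartI) (hy : y ∈ chartI) (hRx : rotate R x ∈ chartI) (hRy : rotate R y ∈ chartI) :
    G.kernel x y = transition s 1 R (rotate R x) *
      (starRingEnd ℂ) (transition s 1 R (rotate R y)) * G.kernel (rotate R x) (rotate R y) := by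
  have hxy : ∀ i, (![x, y] : Fin 2 → Sphere2) i ∈ chartI := by
    intro i; fin_cases i
    · exact hx
    · exact hy
  have h := hG 2 ![x, y] hxy 1 R
  have hm : ∀ R, AEMeasurable (fun ω i => G.rotI R ((![x, y] : Fin 2 → Sphere2) i) ω) P := fun R =>
    (measurable_pi_iff.2 fun i => G.measurable_rotI R (hxy i)).aemeasurable
  have hc : Continuous fun f : Fin 2 → ℂ => f 0 * (starRingEnd ℂ) (f 1) :=
    (continuous_apply 0).mul (Complex.continuous_conj.comp (continuous_apply 1))
  have h2 := congrArg (fun μ => ∫ f, f 0 * (starRingEnd ℂ) (f 1) ∂μ) h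
  rw [integral_map (hm 1) hc.aestronglyMeasurable, integral_map (hm R) hc.aestronglyMeasurable] at h2
  simp only [Matrix.cons_val_zero, Matrix.cons_val_one, G.rotI_one hx, G.rotI_one hy] at h2
  rw [kernel, h2, kernel, ← integral_const_mul]
  refine integral_congr_ae ?_
  filter_upwards [G.rotI_ae_eq R hx hRx, G.rotI_ae_eq R hy hRy] with ω h3 h4
  rw [h3, h4, map_mul]
  ring

omit [IsProbabilityMeasure P] in
theorem integral_sec_rotate (G : RandomSpinField s P) (hG : G.Isotropic) (R : SO3) {x : Sphere2}
    (hx : x ∈ chartI) (hRx : rotate R x ∈ chartI) :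
    ∫ ω, G.sec x ω ∂P = transition s 1 R (rotate R x) * ∫ ω, G.sec (rotate R x) ω ∂P := by
  have h := hG 1 (fun _ => x) (fun _ => hx) 1 R
  have hm : ∀ R, AEMeasurable (fun ω (_ : Fin 1) => G.rotI R x ω) P := fun R =>
    (measurable_pi_iff.2 fun i => G.measurable_rotI R hx).aemeasurable
  have h2 := congrArg (fun μ => ∫ f, f 0 ∂μ) h
  rw [integral_map (hm 1) (continuous_apply 0).aestronglyMeasurable,
    integral_map (hm R) (continuous_apply 0).aestronglyMeasurable] at h2
  simp only [G.rotI_one hx] at h2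
  rw [h2, ← integral_const_mul]
  exact integral_congr_ae (G.rotI_ae_eq R hx hRx)

/-- Second moments of the pairings are invariant under rotations of the test functions. -/
theorem integral_proj_mul_conj_proj_of_isRotated (G : RandomSpinField s P) (hG : G.Isotropic)
    {R : SO3} {h h' k k' : Sphere2 → ℂ} (hh : Measurable h) (hb : ∃ M, ∀ p, ‖h p‖ ≤ M)
    (hh' : Measurable h') (hb' : ∃ M, ∀ p, ‖h' p‖ ≤ M) (hk : Measurable k)
    (kb : ∃ M, ∀ p, ‖k p‖ ≤ M) (hk' : Measurable k') (kb' : ∃ M, ∀ p, ‖k' p‖ ≤ M)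
    (hrot : IsRotated s R h h') (krot : IsRotated s R k k') :
    ∫ ω, G.proj h ω * (starRingEnd ℂ) (G.proj k ω) ∂P =
      ∫ ω, G.proj h' ω * (starRingEnd ℂ) (G.proj k' ω) ∂P := by
  rw [G.integral_proj_mul_conj_proj hh hb hk kb, G.integral_proj_mul_conj_proj hh' hb' hk' kb',
    ← integral_rotate R fun y => (∫ x, G.kernel x y * (starRingEnd ℂ) (h' x) ∂surface) * k' y]
  refine integral_congr_ae ?_
  filter_upwards [ae_mem_chartI, ae_rotate_mem_chartI R] with y hy hRy
  have ky := congrArg (starRingEnd ℂ) (krot (rotate R y) hRy (by rwa [rotate_inv_rotate]))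
  rw [rotate_inv_rotate, map_mul, Complex.conj_conj, Complex.conj_conj] at ky
  rw [← ky, ← integral_rotate R fun x => G.kernel x (rotate R y) * (starRingEnd ℂ) (h' x),
    ← mul_assoc, ← integral_mul_const ((starRingEnd ℂ) (transition s 1 R (rotate R y)))]
  congr 1
  refine integral_congr_ae ?_
  filter_upwards [ae_mem_chartI, ae_rotate_mem_chartI R] with x hx hRx
  have hx' := hrot (rotate R x) hRx (by rwa [rotate_inv_rotate])
  rw [rotate_inv_rotate] at hx'
  rw [← hx', G.kernel_rotate hG R hx hy hRx hRy]
  ring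

theorem integral_proj_eq (G : RandomSpinField s P) {h : Sphere2 → ℂ} (hh : Measurable h)
    (hb : ∃ M, ∀ p, ‖h p‖ ≤ M) :
    ∫ ω, G.proj h ω ∂P = ∫ p, (∫ ω, G.sec p ω ∂P) * (starRingEnd ℂ) (h p) ∂surface := by
  simpa using G.integral_mul_proj hh hb (η := fun _ => 1) (memLp_const 1)

theorem integral_proj_of_isRotated (G : RandomSpinField s P) (hG : G.Isotropic)
    {R : SO3} {h h' : Sphere2 → ℂ} (hh : Measurable h) (hb : ∃ M, ∀ p, ‖h p‖ ≤ M)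
    (hh' : Measurable h') (hb' : ∃ M, ∀ p, ‖h' p‖ ≤ M) (hrot : IsRotated s R h h') :
    ∫ ω, G.proj h ω ∂P = ∫ ω, G.proj h' ω ∂P := by
  rw [G.integral_proj_eq hh hb, G.integral_proj_eq hh' hb',
    ← integral_rotate R fun p => (∫ ω, G.sec p ω ∂P) * (starRingEnd ℂ) (h' p)]
  refine integral_congr_ae ?_
  filter_upwards [ae_mem_chartI, ae_rotate_mem_chartI R] with x hx hRx
  have hx' := hrot (rotate R x) hRx (by rwa [rotate_inv_rotate])
  rw [rotate_inv_rotate] at hx'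
  rw [← hx', G.integral_sec_rotate hG R hx hRx]
  ring

end RandomSpinField

end SpinField

/-! ### Orthogonality relations for the coefficients, deduced from isotropy. -/

namespace SpinField

namespace RandomSpinField

variable {Ω : Type*} [MeasurableSpace Ω] {s : ℤ} {P : Measure Ω}

theorem isRotated_rotZ_harm (s : ℤ) (l k : ℕ) (α : ℝ) :
    IsRotated s (rotZ α) (harm s l k)
      (fun p => Complex.exp (-(Complex.I * ((k : ℤ) - l : ℤ) * α)) * harm s l k p) :=
  fun _ hp _ => harm_rotZ s l k α hp

theorem isRotated_rotY_spinGen {s : ℤ} {l : ℕ} (hl : s.natAbs ≤ l) (u v : ℂ) :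
    IsRotated s rotY (spinGen s l u v)
      (spinGen s l ((u - v) / (Real.sqrt 2 : ℂ)) ((u + v) / (Real.sqrt 2 : ℂ))) :=
  fun _ hp hx => spinGen_rotY hl u v hp hx

theorem measurable_spinGen {s : ℤ} {l : ℕ} (hl : s.natAbs ≤ l) (u v : ℂ) :
    Measurable (spinGen s l u v) := by
  rw [show spinGen s l u v = fun p => _ from funext fun p => spinGen_eq_sum hl u v p]
  exact Finset.measurable_fun_sum _ fun k _ => ((measurable_harm s l k).mul_const _).mul_const _

theorem exists_norm_spinGen_le {s : ℤ} {l : ℕ} (hl : s.natAbs ≤ l) (u v : ℂ) :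
    ∃ M, ∀ p, ‖spinGen s l u v p‖ ≤ M := by
  choose M hM using exists_norm_harm_le s l
  refine ⟨∑ k ∈ Finset.range (2 * l + 1), M k * ‖u ^ k‖ * ‖v ^ (2 * l - k)‖, fun p => ?_⟩
  rw [spinGen_eq_sum hl]
  refine (norm_sum_le _ _).trans (Finset.sum_le_sum fun k _ => ?_)
  rw [norm_mul, norm_mul]
  gcongr
  exact hM k p

theorem exists_norm_const_mul_harm_le (c : ℂ) (s : ℤ) (l k : ℕ) :
    ∃ M, ∀ p, ‖c * harm s l k p‖ ≤ M := by
  obtain ⟨M, hM⟩ := exists_norm_harm_le s l k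
  refine ⟨‖c‖ * M, fun p => ?_⟩
  rw [norm_mul]
  gcongr
  exact hM p

theorem proj_const_mul (G : RandomSpinField s P) (c : ℂ) (h : Sphere2 → ℂ) (ω : Ω) :
    G.proj (fun p => c * h p) ω = (starRingEnd ℂ) c * G.proj h ω := by
  rw [proj, proj, ← integral_const_mul]
  refine integral_congr_ae (Eventually.of_forall fun p => ?_)
  simp only [map_mul]
  ring

/-- Second moments of the unnormalized coefficients. -/
noncomputable def moment (G : RandomSpinField s P) (l k l' k' : ℕ) : ℂ :=
  ∫ ω, G.proj (harm s l k) ω * (starRingEnd ℂ) (G.proj (harm s l' k') ω) ∂P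

theorem integral_coeff_mul_conj_coeff_eq_moment (G : RandomSpinField s P) {l l' : ℕ}
    (hl : s.natAbs ≤ l) (hl' : s.natAbs ≤ l') {m m' : ℤ} (hm : |m| ≤ l) (hm' : |m'| ≤ l') :
    ∫ ω, G.coeff l m ω * (starRingEnd ℂ) (G.coeff l' m' ω) ∂P =
      harmConst s l m * harmConst s l' m' *
        G.moment l ((l : ℤ) + m).toNat l' ((l' : ℤ) + m').toNat := by
  rw [moment, ← integral_const_mul]
  refine integral_congr_ae (Eventually.of_forall fun ω => ?_)
  simp only [G.coeff_eq_proj hl hm, G.coeff_eq_proj hl' hm', map_mul, Complex.conj_ofReal]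
  ring

variable [IsProbabilityMeasure P]

theorem ae_integrable_sec (G : RandomSpinField s P) :
    ∀ᵐ ω ∂P, Integrable (fun p => G.sec p ω) surface :=
  (G.memLp_sec.integrable (by norm_num)).prod_left_ae

theorem proj_spinGen (G : RandomSpinField s P) {l : ℕ} (hl : s.natAbs ≤ l) (u v : ℂ) :
    ∀ᵐ ω ∂P, G.proj (spinGen s l u v) ω = ∑ k ∈ Finset.range (2 * l + 1),
      (starRingEnd ℂ) (u ^ k * v ^ (2 * l - k)) * G.proj (harm s l k) ω := by
  filter_upwards [G.ae_integrable_sec] with ω hω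
  have h : ∀ p, G.sec p ω * (starRingEnd ℂ) (spinGen s l u v p) =
      ∑ k ∈ Finset.range (2 * l + 1), (starRingEnd ℂ) (u ^ k * v ^ (2 * l - k)) *
        (G.sec p ω * (starRingEnd ℂ) (harm s l k p)) := by
    intro p
    rw [spinGen_eq_sum hl, map_sum, Finset.mul_sum]
    refine Finset.sum_congr rfl fun k _ => ?_
    rw [mul_assoc, map_mul]
    ring
  rw [proj]
  simp only [h]
  rw [integral_finsetSum]
  · exact Finset.sum_congr rfl fun k _ => integral_const_mul _ _
  · intro k _
    obtain ⟨M, hM⟩ := exists_norm_harm_le s l k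
    refine Integrable.const_mul (hω.mul_bdd (c := M) ?_ ?_) _
    · exact (Complex.continuous_conj.measurable.comp (measurable_harm s l k)).aestronglyMeasurable
    · exact Eventually.of_forall fun p => by rw [RCLike.norm_conj]; exact hM p

theorem memLp_proj_harm (G : RandomSpinField s P) (l k : ℕ) : MemLp (G.proj (harm s l k)) 2 P :=
  G.memLp_proj (measurable_harm s l k) (exists_norm_harm_le s l k)

theorem moment_eq_zero_of_ne (G : RandomSpinField s P) (hG : G.Isotropic) {l k l' k' : ℕ}
    (h : (k : ℤ) - l ≠ k' - l') : G.moment l k l' k' = 0 := by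
  set n : ℤ := ((k' : ℤ) - l') - (k - l) with hn
  have hn0 : (n : ℝ) ≠ 0 := by exact_mod_cast (by omega : n ≠ 0)
  -- Under rotation by `α` about the vertical axis the moment is multiplied by `exp (-i n α)`. This
  -- angle makes the factor `-1`, so the moment equals its own negative.
  set α : ℝ := Real.pi / n with hα
  have key := G.integral_proj_mul_conj_proj_of_isRotated hG (measurable_harm s l k)
    (exists_norm_harm_le s l k) ((measurable_harm s l k).const_mul _)
    (exists_norm_const_mul_harm_le _ s l k) (measurable_harm s l' k') (exists_norm_harm_le s l' k')
    ((measurable_harm s l' k').const_mul _) (exists_norm_const_mul_harm_le _ s l' k')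
    (isRotated_rotZ_harm s l k α) (isRotated_rotZ_harm s l' k' α)
  have e : (starRingEnd ℂ) (Complex.exp (-(Complex.I * ((k : ℤ) - l : ℤ) * α))) *
      Complex.exp (-(Complex.I * ((k' : ℤ) - l' : ℤ) * α)) = -1 := by
    rw [← Complex.exp_conj, ← Complex.exp_add]
    have : (starRingEnd ℂ) (-(Complex.I * ((k : ℤ) - l : ℤ) * α)) +
        -(Complex.I * ((k' : ℤ) - l' : ℤ) * α) = -(Real.pi * Complex.I) := by
      rw [map_neg, map_mul, map_mul, Complex.conj_I, Complex.conj_ofReal, map_intCast]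
      have hh : (n : ℂ) * α = Real.pi := by
        rw [hα]; push_cast
        rw [mul_div_cancel₀]
        exact_mod_cast hn0
      rw [hn] at hh
      push_cast at hh ⊢
      linear_combination -Complex.I * hh
    rw [this, Complex.exp_neg, Complex.exp_pi_mul_I]
    norm_num
  have h2 : G.moment l k l' k' = -1 * G.moment l k l' k' := by
    conv_lhs => rw [moment, key]
    rw [← e, moment, ← integral_const_mul]
    refine integral_congr_ae (Eventually.of_forall fun ω => ?_)
    simp only [proj_const_mul, map_mul, Complex.conj_conj]
    ring
  linear_combination (1 / 2 : ℂ) * h2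

theorem mean_eq_zero_of_ne (G : RandomSpinField s P) (hG : G.Isotropic) {l k : ℕ}
    (h : k ≠ l) : ∫ ω, G.proj (harm s l k) ω ∂P = 0 := by
  set n : ℤ := (k : ℤ) - l with hn
  have hn0 : (n : ℝ) ≠ 0 := by exact_mod_cast (by omega : n ≠ 0)
  set α : ℝ := Real.pi / n with hα
  have key := G.integral_proj_of_isRotated hG (measurable_harm s l k)
    (exists_norm_harm_le s l k) ((measurable_harm s l k).const_mul _)
    (exists_norm_const_mul_harm_le _ s l k) (isRotated_rotZ_harm s l k α)
  have e : (starRingEnd ℂ) (Complex.exp (-(Complex.I * ((k : ℤ) - l : ℤ) * α))) = -1 := by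
    rw [← Complex.exp_conj]
    have : (starRingEnd ℂ) (-(Complex.I * ((k : ℤ) - l : ℤ) * α)) = Real.pi * Complex.I := by
      rw [map_neg, map_mul, map_mul, Complex.conj_I, Complex.conj_ofReal, map_intCast]
      have hh : (n : ℂ) * α = Real.pi := by
        rw [hα]; push_cast
        rw [mul_div_cancel₀]
        exact_mod_cast hn0
      rw [← hn]
      linear_combination Complex.I * hh
    rw [this, Complex.exp_pi_mul_I]
  simp only [proj_const_mul, e] at key
  rw [integral_const_mul] at key
  linear_combination (1 / 2 : ℂ) * key

/-- Second moments of pairings with generating functions. -/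
theorem integral_spinGen (G : RandomSpinField s P) {l l' : ℕ} (hl : s.natAbs ≤ l)
    (hl' : s.natAbs ≤ l') (u v u' v' : ℂ) :
    ∫ ω, G.proj (spinGen s l u v) ω * (starRingEnd ℂ) (G.proj (spinGen s l' u' v') ω) ∂P =
      ∑ k ∈ Finset.range (2 * l + 1), ∑ k' ∈ Finset.range (2 * l' + 1),
        (starRingEnd ℂ) (u ^ k * v ^ (2 * l - k)) * (u' ^ k' * v' ^ (2 * l' - k')) *
          G.moment l k l' k' := by
  have hint : ∀ k k' : ℕ, Integrable (fun ω => G.proj (harm s l k) ω *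
      (starRingEnd ℂ) (G.proj (harm s l' k') ω)) P := fun k k' =>
    (G.memLp_proj_harm l k).integrable_mul (G.memLp_proj_harm l' k').star
  have e : ∀ᵐ ω ∂P, G.proj (spinGen s l u v) ω *
      (starRingEnd ℂ) (G.proj (spinGen s l' u' v') ω) =
      ∑ k ∈ Finset.range (2 * l + 1), ∑ k' ∈ Finset.range (2 * l' + 1),
        (starRingEnd ℂ) (u ^ k * v ^ (2 * l - k)) * (u' ^ k' * v' ^ (2 * l' - k')) *
          (G.proj (harm s l k) ω * (starRingEnd ℂ) (G.proj (harm s l' k') ω)) := by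
    filter_upwards [G.proj_spinGen hl u v, G.proj_spinGen hl' u' v'] with ω h1 h2
    rw [h1, h2, map_sum, Finset.sum_mul_sum]
    refine Finset.sum_congr rfl fun k _ => Finset.sum_congr rfl fun k' _ => ?_
    simp only [map_mul, Complex.conj_conj]
    ring
  rw [integral_congr_ae e, integral_finsetSum]
  · refine Finset.sum_congr rfl fun k _ => ?_
    rw [integral_finsetSum]
    · exact Finset.sum_congr rfl fun k' _ => integral_const_mul _ _
    · exact fun k' _ => (hint k k').const_mul _
  · exact fun k _ => integrable_finsetSum _ fun k' _ => (hint k k').const_mul _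

/-- The polynomial identity expressing invariance under a quarter turn about a horizontal axis. -/
theorem moment_identity (G : RandomSpinField s P) (hG : G.Isotropic) {l l' : ℕ}
    (hl : s.natAbs ≤ l) (hll' : l ≤ l') (x : ℂ) :
    ∑ k ∈ Finset.range (2 * l + 1), G.moment l k l' (k + (l' - l)) * x ^ (k + (l' - l)) =
      (Real.sqrt 2 : ℂ) ^ (2 * l) * (((x + 1) / (Real.sqrt 2 : ℂ)) ^ (l + l') *
        ((1 - x) / (Real.sqrt 2 : ℂ)) ^ (l' - l)) * G.moment l (2 * l) l' (l + l') := by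
  have h2 : (Real.sqrt 2 : ℂ) * (Real.sqrt 2 : ℂ) = 2 := by
    rw [← Complex.ofReal_mul, Real.mul_self_sqrt (by norm_num)]; norm_num
  have h2' : (Real.sqrt 2 : ℂ) ≠ 0 := by
    intro h; rw [h] at h2; norm_num at h2
  have hl' : s.natAbs ≤ l' := hl.trans hll'
  have diag : ∀ (c : ℕ → ℕ → ℂ) (k : ℕ), k ∈ Finset.range (2 * l + 1) →
      ∑ k' ∈ Finset.range (2 * l' + 1), c k k' * G.moment l k l' k' =
      c k (k + (l' - l)) * G.moment l k l' (k + (l' - l)) := by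
    intro c k hk
    rw [Finset.mem_range] at hk
    refine Finset.sum_eq_single_of_mem _ (Finset.mem_range.2 (by omega)) fun k' _ hk' => ?_
    rw [G.moment_eq_zero_of_ne hG (by omega), mul_zero]
  -- The parameters are chosen so that the quarter turn sends `(√2, 0)` to `(1, 1)` and the second
  -- pair to `(x, 1)`. Before the turn only the top index `k = 2l` survives; afterwards the diagonal
  -- moments are the coefficients of a polynomial in `x`.
  have key := G.integral_proj_mul_conj_proj_of_isRotated hG (measurable_spinGen hl _ _)
    (exists_norm_spinGen_le hl _ _) (measurable_spinGen hl _ _) (exists_norm_spinGen_le hl _ _)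
    (measurable_spinGen hl' _ _) (exists_norm_spinGen_le hl' _ _)
    (measurable_spinGen hl' _ _) (exists_norm_spinGen_le hl' _ _)
    (isRotated_rotY_spinGen hl (Real.sqrt 2) 0)
    (isRotated_rotY_spinGen hl' ((x + 1) / (Real.sqrt 2 : ℂ)) ((1 - x) / (Real.sqrt 2 : ℂ)))
  have e1 : ((x + 1) / (Real.sqrt 2 : ℂ) - (1 - x) / (Real.sqrt 2 : ℂ)) / (Real.sqrt 2 : ℂ) = x := by
    field_simp; rw [pow_two, h2]; ring
  have e2 : ((x + 1) / (Real.sqrt 2 : ℂ) + (1 - x) / (Real.sqrt 2 : ℂ)) / (Real.sqrt 2 : ℂ) = 1 := by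
    field_simp; rw [pow_two, h2]; ring
  rw [e1, e2, sub_zero, add_zero, div_self h2', G.integral_spinGen hl hl', G.integral_spinGen hl hl',
    Finset.sum_congr rfl (diag _), Finset.sum_congr rfl (diag _)] at key
  simp only [one_pow, mul_one, map_one, one_mul] at key
  rw [Finset.sum_eq_single_of_mem (2 * l) (by simp)] at key
  · rw [show 2 * l + (l' - l) = l + l' by omega, show 2 * l' - (l + l') = l' - l by omega] at key
    simp only [Nat.sub_self, pow_zero, mul_one, map_pow, Complex.conj_ofReal] at key
    rw [key]
    exact Finset.sum_congr rfl fun k _ => mul_comm _ _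
  · intro k hk hk'
    rw [Finset.mem_range] at hk
    rw [zero_pow (by omega)]
    simp

theorem moment_eq_zero_of_lt (G : RandomSpinField s P) (hG : G.Isotropic) {l l' : ℕ}
    (hl : s.natAbs ≤ l) (hll' : l < l') {k k' : ℕ} (hk : k ≤ 2 * l) : G.moment l k l' k' = 0 := by
  by_cases hkk : k' = k + (l' - l)
  swap
  · exact G.moment_eq_zero_of_ne hG (by omega)
  have h2 : (Real.sqrt 2 : ℂ) ≠ 0 := by
    rw [Ne, Complex.ofReal_eq_zero]; positivity
  -- As `l < l'`, every power of `x` on the left has positive exponent, while the factor of the top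
  -- moment on the right is nonzero at `x = 0`. So the top moment vanishes, then the whole
  -- polynomial, then each of its coefficients.
  have h0 := G.moment_identity hG hl hll'.le 0
  have z : G.moment l (2 * l) l' (l + l') = 0 := by
    rw [Finset.sum_eq_zero fun k _ => by rw [zero_pow (by omega), mul_zero]] at h0
    have := h0.symm
    simpa [h2] using this
  have h : ∀ x : ℂ, (∑ k ∈ Finset.range (2 * l + 1),
      Polynomial.C (G.moment l k l' (k + (l' - l))) * Polynomial.X ^ (k + (l' - l))).eval x =
        (0 : Polynomial ℂ).eval x := by
    intro x
    have := G.moment_identity hG hl hll'.le x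
    rw [z, mul_zero] at this
    simpa [Polynomial.eval_finsetSum] using this
  have h' := congrArg (fun Q => Polynomial.coeff Q k') (Polynomial.funext h)
  simp only [Polynomial.finsetSum_coeff, Polynomial.coeff_C_mul_X_pow, Polynomial.coeff_zero] at h'
  rw [Finset.sum_eq_single_of_mem k (Finset.mem_range.2 (by omega))] at h'
  · rw [if_pos hkk] at h'
    rw [hkk]; exact h'
  · intro j _ hj
    rw [if_neg (by omega)]

/-- For `l' = l` the right-hand side of `moment_identity` is the top moment times `(x + 1) ^ (2l)`;
comparing coefficients gives the binomial. -/
theorem moment_self (G : RandomSpinField s P) (hG : G.Isotropic) {l : ℕ}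
    (hl : s.natAbs ≤ l) {k : ℕ} (hk : k ≤ 2 * l) :
    G.moment l k l k = (2 * l).choose k * G.moment l (2 * l) l (2 * l) := by
  have h2 : (Real.sqrt 2 : ℂ) ≠ 0 := by
    rw [Ne, Complex.ofReal_eq_zero]; positivity
  have h : ∀ x : ℂ, (∑ k ∈ Finset.range (2 * l + 1),
      Polynomial.C (G.moment l k l k) * Polynomial.X ^ k).eval x =
        (Polynomial.C (G.moment l (2 * l) l (2 * l)) * (Polynomial.X + 1) ^ (2 * l)).eval x := by
    intro x
    have := G.moment_identity hG hl le_rfl x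
    simp only [Nat.sub_self, add_zero, pow_zero, mul_one, ← two_mul, div_pow] at this
    simp only [Polynomial.eval_finsetSum, Polynomial.eval_mul, Polynomial.eval_C,
      Polynomial.eval_pow, Polynomial.eval_X, Polynomial.eval_add, Polynomial.eval_one]
    rw [this]
    field_simp
  have h' := congrArg (fun Q => Polynomial.coeff Q k) (Polynomial.funext h)
  simp only [Polynomial.finsetSum_coeff, Polynomial.coeff_C_mul, Polynomial.coeff_X_pow,
    Polynomial.coeff_X_add_one_pow, mul_ite, mul_one, mul_zero] at h'
  rw [Finset.sum_ite_eq, if_pos (Finset.mem_range.2 (by omega))] at h'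
  rw [h', mul_comm]

/-- Vertical rotations leave only the mean of order `0`. The quarter turn from `(√2, 0)` to `(1, 1)`
equates `0 ^ l` times this mean with the mean itself, so positivity of `l` is essential. -/
theorem mean_eq_zero (G : RandomSpinField s P) (hG : G.Isotropic) {l : ℕ}
    (hl : s.natAbs ≤ l) (h0 : 0 < l) (k : ℕ) : ∫ ω, G.proj (harm s l k) ω ∂P = 0 := by
  by_cases hk : k = l
  swap
  · exact G.mean_eq_zero_of_ne hG hk
  subst hk
  have h2' : (Real.sqrt 2 : ℂ) ≠ 0 := by
    rw [Ne, Complex.ofReal_eq_zero]; positivity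
  have key := G.integral_proj_of_isRotated hG (measurable_spinGen hl _ _)
    (exists_norm_spinGen_le hl _ _) (measurable_spinGen hl _ _) (exists_norm_spinGen_le hl _ _)
    (isRotated_rotY_spinGen hl (Real.sqrt 2) 0)
  have e : ∀ u v : ℂ, ∫ ω, G.proj (spinGen s k u v) ω ∂P =
      (starRingEnd ℂ) (u ^ k * v ^ k) * ∫ ω, G.proj (harm s k k) ω ∂P := by
    intro u v
    rw [integral_congr_ae (G.proj_spinGen hl u v), integral_finsetSum]
    · rw [Finset.sum_eq_single_of_mem k (Finset.mem_range.2 (by omega))]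
      · rw [integral_const_mul, show 2 * k - k = k by omega]
      · intro j _ hj
        rw [integral_const_mul, G.mean_eq_zero_of_ne hG hj, mul_zero]
    · intro j _
      exact ((G.memLp_proj_harm k j).integrable (by norm_num)).const_mul _
  rw [e, e, sub_zero, add_zero, div_self h2', zero_pow h0.ne'] at key
  simpa using key.symm

/-! ### Moments of the coefficients -/

theorem memLp_coeff (G : RandomSpinField s P) {l : ℕ} (hl : s.natAbs ≤ l) {m : ℤ} (hm : |m| ≤ l) :
    MemLp (G.coeff l m) 2 P := by
  rw [show G.coeff l m = fun ω => _ from funext (G.coeff_eq_proj hl hm)]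
  exact (G.memLp_proj_harm _ _).const_mul _

theorem integral_coeff (G : RandomSpinField s P) (hG : G.Isotropic) {l : ℕ} (hl : s.natAbs ≤ l)
    (h0 : 0 < l) {m : ℤ} (hm : |m| ≤ l) : ∫ ω, G.coeff l m ω ∂P = 0 := by
  simp only [G.coeff_eq_proj hl hm]
  rw [integral_const_mul, G.mean_eq_zero hG hl h0, mul_zero]

theorem integral_coeff_mul_conj_coeff_of_ne (G : RandomSpinField s P) (hG : G.Isotropic) {l l' : ℕ}
    (hl : s.natAbs ≤ l) (hl' : s.natAbs ≤ l') {m m' : ℤ} (hm : |m| ≤ l) (hm' : |m'| ≤ l')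
    (hne : l ≠ l' ∨ m ≠ m') :
    ∫ ω, G.coeff l m ω * (starRingEnd ℂ) (G.coeff l' m' ω) ∂P = 0 := by
  have h1 := abs_le.1 hm
  have h2 := abs_le.1 hm'
  rcases lt_trichotomy l l' with h | h | h
  · rw [G.integral_coeff_mul_conj_coeff_eq_moment hl hl' hm hm',
      G.moment_eq_zero_of_lt hG hl h (by omega), mul_zero]
  · rw [G.integral_coeff_mul_conj_coeff_eq_moment hl hl' hm hm',
      G.moment_eq_zero_of_ne hG (by omega), mul_zero]
  · have := G.integral_coeff_mul_conj_coeff_eq_moment hl' hl hm' hm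
    rw [G.moment_eq_zero_of_lt hG hl' h (by omega), mul_zero] at this
    have := congrArg (starRingEnd ℂ) this
    rw [← integral_conj] at this
    simp only [map_mul, Complex.conj_conj, map_zero] at this
    simpa only [mul_comm] using this

theorem integral_norm_coeff_sq (G : RandomSpinField s P) (hG : G.Isotropic) {l : ℕ}
    (hl : s.natAbs ≤ l) {m : ℤ} (hm : |m| ≤ l) :
    ∫ ω, ‖G.coeff l m ω‖ ^ 2 ∂P = G.spectrum l := by
  obtain ⟨K, -, hK⟩ := harmConst_sq hl
  have key : ∀ m : ℤ, |m| ≤ l → ((∫ ω, ‖G.coeff l m ω‖ ^ 2 ∂P : ℝ) : ℂ) =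
      K * G.moment l (2 * l) l (2 * l) := by
    intro m hm
    have h1 := abs_le.1 hm
    rw [← integral_complex_ofReal]
    have := G.integral_coeff_mul_conj_coeff_eq_moment hl hl hm hm
    rw [G.moment_self hG hl (by omega)] at this
    simp only [Complex.mul_conj'] at this
    push_cast
    rw [this, ← hK m hm]
    push_cast
    ring
  have := (key m hm).trans (key 0 (by simp)).symm
  exact_mod_cast this

end RandomSpinField

end SpinField

namespace SpinField

/-! ### The fourth moment of the standard Gaussian. -/

section GaussianMoments

theorem integral_pow_four_gaussianReal : ∫ x, x ^ 4 ∂(gaussianReal 0 1) = 3 := by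
  have h := iteratedDeriv_mgf_zero (X := id) (μ := gaussianReal 0 1)
    (by rw [integrableExpSet_id_gaussianReal]; simp) 4
  have e : ∀ t : ℝ, HasDerivAt (fun t : ℝ => Real.exp (t ^ 2 / 2)) (t * Real.exp (t ^ 2 / 2)) t := by
    intro t
    have h1 : HasDerivAt (fun t : ℝ => t ^ 2 / 2) t t := by
      simpa using (hasDerivAt_pow 2 t).div_const 2
    simpa [mul_comm] using h1.exp
  have key : ∀ p p' : ℝ → ℝ, (∀ t, HasDerivAt p (p' t) t) →
      deriv (fun t => p t * Real.exp (t ^ 2 / 2)) = fun t => (p' t + p t * t) * Real.exp (t ^ 2 / 2) := by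
    intro p p' hp
    funext t
    rw [((hp t).fun_mul (e t)).deriv]
    ring
  have h0 : mgf id (gaussianReal 0 1) = fun t => 1 * Real.exp (t ^ 2 / 2) := by
    rw [mgf_id_gaussianReal]; funext t; simp
  rw [h0, iteratedDeriv_succ', iteratedDeriv_succ', iteratedDeriv_succ', iteratedDeriv_one,
    key _ (fun _ => 0) (fun t => hasDerivAt_const t 1), key _ (fun _ => 1) ?_,
    key _ (fun t => 3 * t - t) ?_, key _ (fun t => 3 + 3 * t ^ 2) ?_] at h
  · simp at h
    linarith
  · intro t
    have := (((hasDerivAt_id t).const_mul 3).sub (hasDerivAt_id t)).add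
      ((((hasDerivAt_id t).mul (hasDerivAt_id t)).const_add 1).mul (hasDerivAt_id t))
    refine (this.congr_of_eventuallyEq (Eventually.of_forall fun u => ?_)).congr_deriv ?_
    · simp
    · simp; ring
  · intro t
    have := ((hasDerivAt_id t).mul (hasDerivAt_id t)).const_add 1
    refine (this.congr_of_eventuallyEq (Eventually.of_forall fun u => ?_)).congr_deriv ?_
    · simp
    · simp; ring
  · intro t
    refine ((hasDerivAt_id t).congr_of_eventuallyEq (Eventually.of_forall fun u => ?_))
    simp

end GaussianMoments

/-! ### Gaussianity of the closed linear span of a Gaussian process. -/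

section Closure

variable {Ω : Type*} [MeasurableSpace Ω] {P : Measure Ω} [IsProbabilityMeasure P]

/-- A Gaussian characteristic function is a continuous function of the mean and variance, which are
continuous on `L²` as they are built from inner products with `1` and with the variable itself.
Convergence in `L²` also implies convergence in law, so both limits of the characteristic functions
must agree. -/
theorem hasGaussianLaw_of_tendsto {Y : ℕ → Lp ℝ 2 P} {Z : Lp ℝ 2 P}
    (hY : ∀ n, HasGaussianLaw (Y n) P) (h : Tendsto Y atTop (𝓝 Z)) : HasGaussianLaw Z P := by
  have hm : ∀ W : Lp ℝ 2 P, AEMeasurable W P := fun W => (Lp.aestronglyMeasurable W).aemeasurable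
  rw [hasGaussianLaw_iff_charFun_map_eq (hm Z)]
  intro t
  have hdist := (tendstoInMeasure_of_tendsto_Lp h).tendstoInDistribution fun n => hm (Y n)
  have hc := ProbabilityMeasure.tendsto_iff_tendsto_charFun.1 hdist.tendsto t
  have hmean : ∀ W : Lp ℝ 2 P, inner ℝ ((memLp_const (1 : ℝ)).toLp (fun _ : Ω => (1 : ℝ))) W =
      ∫ ω, W ω ∂P := by
    intro W
    rw [L2.inner_def]
    refine integral_congr_ae ?_
    filter_upwards [(memLp_const (μ := P) (p := 2) (1 : ℝ)).coeFn_toLp] with ω hω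
    rw [hω]; simp
  have hsq : ∀ W : Lp ℝ 2 P, inner ℝ W W = ∫ ω, W ω ^ 2 ∂P := by
    intro W
    rw [L2.inner_def]
    refine integral_congr_ae (Eventually.of_forall fun ω => ?_)
    simp [pow_two]
  have hvar : ∀ W : Lp ℝ 2 P, Var[W; P] = inner ℝ W W -
      (inner ℝ ((memLp_const (1 : ℝ)).toLp (fun _ : Ω => (1 : ℝ))) W) ^ 2 := by
    intro W
    rw [variance_eq_sub (Lp.memLp W), hmean, hsq]
    rfl
  have hform : ∀ W : Lp ℝ 2 P,
      Complex.exp ((P[fun ω => inner ℝ t (W ω)] : ℝ) * Complex.I - Var[fun ω => inner ℝ t (W ω); P] / 2)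
      = Complex.exp ((inner ℝ ((memLp_const (1 : ℝ)).toLp (fun _ : Ω => (1 : ℝ))) W * t : ℝ) * Complex.I -
        ((t ^ 2 * (inner ℝ W W -
      (inner ℝ ((memLp_const (1 : ℝ)).toLp (fun _ : Ω => (1 : ℝ))) W) ^ 2) : ℝ) : ℂ) / 2) := by
    intro W
    rw [← hvar, hmean]
    simp only [RCLike.inner_apply, conj_trivial]
    rw [integral_mul_const, variance_mul_const, mul_comm (t ^ 2)]
  rw [hform]
  refine tendsto_nhds_unique hc ?_
  have : ∀ n, charFun (P.map (Y n)) t = _ := fun n => ((hY n).charFun_map_eq t).trans (hform (Y n))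
  refine Tendsto.congr (fun n => (this n).symm) ?_
  have hcont : Continuous fun W : Lp ℝ 2 P =>
      Complex.exp ((inner ℝ ((memLp_const (1 : ℝ)).toLp (fun _ : Ω => (1 : ℝ))) W * t : ℝ) * Complex.I -
        ((t ^ 2 * (inner ℝ W W -
      (inner ℝ ((memLp_const (1 : ℝ)).toLp (fun _ : Ω => (1 : ℝ))) W) ^ 2) : ℝ) : ℂ) / 2) := by
    fun_prop
  exact (hcont.tendsto Z).comp h

/-- Square-integrable random variables in the closed linear span of a Gaussian process form a
Gaussian process; membership in the span is tested against its orthogonal complement. -/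
theorem isGaussianProcess_of_orthogonal {T S : Type*} {X : T → Ω → ℝ} {W : S → Ω → ℝ}
    (hX : IsGaussianProcess X P) (hW : ∀ i, MemLp (W i) 2 P)
    (h : ∀ i, ∀ η : Ω → ℝ, MemLp η 2 P → (∀ t, ∫ ω, η ω * X t ω ∂P = 0) →
      ∫ ω, η ω * W i ω ∂P = 0) : IsGaussianProcess W P := by
  have hX2 : ∀ t, MemLp (X t) 2 P := fun t => (hX.hasGaussianLaw_eval t).memLp_two
  set K : Submodule ℝ (Lp ℝ 2 P) := Submodule.span ℝ (Set.range fun t => (hX2 t).toLp) with hK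
  have hspan : ∀ Y ∈ K, HasGaussianLaw Y P := by
    intro Y hY
    rw [hK, Finsupp.mem_span_range_iff_exists_finsupp] at hY
    obtain ⟨c, rfl⟩ := hY
    refine HasGaussianLaw.congr ((hX.smul c).hasGaussianLaw_fun_sum (I := c.support)) ?_
    rw [Finsupp.sum]
    have h1 := Lp.coeFn_finsetSum c.support fun t => c t • (hX2 t).toLp
    have h2 : ∀ᵐ ω ∂P, ∀ t ∈ c.support, (c t • (hX2 t).toLp : Lp ℝ 2 P) ω = c t • X t ω := by
      rw [Finset.eventually_all]
      intro t _
      filter_upwards [Lp.coeFn_smul (c t) (hX2 t).toLp, (hX2 t).coeFn_toLp] with ω h3 h4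
      rw [h3, Pi.smul_apply, h4]
    filter_upwards [h1, h2] with ω h3 h4
    rw [h3, Finset.sum_apply]
    exact Finset.sum_congr rfl fun t ht => (h4 t ht).symm
  have hclos : ∀ Y ∈ Kᗮᗮ, HasGaussianLaw Y P := by
    intro Y hY
    rw [Submodule.orthogonal_orthogonal_eq_closure, ← SetLike.mem_coe,
      Submodule.topologicalClosure_coe] at hY
    obtain ⟨y, hy, hlim⟩ := mem_closure_iff_seq_limit.1 hY
    exact hasGaussianLaw_of_tendsto (fun n => hspan _ (hy n)) hlim
  -- The closure of the span is its double orthogonal complement, so membership only requires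
  -- testing against `η` orthogonal to the process. For variables defined by integrals, Fubini
  -- verifies this without approximating sums.
  have hmem : ∀ i, (hW i).toLp ∈ Kᗮᗮ := by
    intro i
    rw [Submodule.mem_orthogonal]
    intro η hη
    rw [L2.inner_def]
    have e : ∀ {V : Ω → ℝ} (hV : MemLp V 2 P),
        ∫ ω, inner ℝ (η ω) ((hV.toLp V : Lp ℝ 2 P) ω) ∂P = ∫ ω, η ω * V ω ∂P := by
      intro V hV
      refine integral_congr_ae ?_
      filter_upwards [hV.coeFn_toLp] with ω hω
      rw [hω]; simp [mul_comm]
    rw [e]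
    refine h i η (Lp.memLp η) fun t => ?_
    rw [← e (hX2 t), ← L2.inner_def, real_inner_comm]
    exact (Submodule.mem_orthogonal _ _).1 hη _ (Submodule.subset_span ⟨t, rfl⟩)
  refine ⟨fun I => ⟨isGaussian_of_isGaussian_map fun L => ?_⟩⟩
  have hmeas : AEMeasurable (fun ω => I.restrict (W · ω)) P :=
    aemeasurable_pi_lambda _ fun i => (hW i).aestronglyMeasurable.aemeasurable
  rw [AEMeasurable.map_map_of_aemeasurable (by fun_prop) hmeas]
  refine HasGaussianLaw.isGaussian_map ?_
  classical
  -- Joint Gaussianity is tested on a linear functional `L` of finitely many variables; its value is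
  -- this linear combination, again in the closed span.
  set V : Lp ℝ 2 P := ∑ i : I, L (Pi.single i 1) • (hW i).toLp with hV
  have hVm : V ∈ Kᗮᗮ := Submodule.sum_mem _ fun i _ => Submodule.smul_mem _ _ (hmem i)
  refine (hclos V hVm).congr ?_
  have h1 := Lp.coeFn_finsetSum Finset.univ fun i : I => L (Pi.single i 1) • (hW i).toLp
  have h2 : ∀ᵐ ω ∂P, ∀ i : I, (L (Pi.single i 1) • (hW i).toLp : Lp ℝ 2 P) ω =
      L (Pi.single i 1) • W i ω := by
    rw [ae_all_iff]
    intro i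
    filter_upwards [Lp.coeFn_smul (L (Pi.single i 1)) (hW i).toLp, (hW i).coeFn_toLp] with ω h3 h4
    rw [h3, Pi.smul_apply, h4]
  filter_upwards [h1, h2] with ω h3 h4
  rw [hV, h3, Finset.sum_apply, Function.comp_apply]
  have h5 : I.restrict (W · ω) = ∑ i : I, W i ω • (Pi.single i (1 : ℝ) : I → ℝ) := by
    ext j
    simp [Finset.sum_apply, Pi.single_apply]
  rw [h5, map_sum]
  refine Finset.sum_congr rfl fun i _ => ?_
  rw [h4, map_smul, smul_eq_mul, smul_eq_mul, mul_comm]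

end Closure

/-! ### A central limit theorem for weighted sums. -/

section CentralLimit

theorem norm_prod_sub_prod_le {ι : Type*} (I : Finset ι) (x y : ι → ℂ) (hx : ∀ i ∈ I, ‖x i‖ ≤ 1)
    (hy : ∀ i ∈ I, ‖y i‖ ≤ 1) :
    ‖∏ i ∈ I, x i - ∏ i ∈ I, y i‖ ≤ ∑ i ∈ I, ‖x i - y i‖ := by
  classical
  induction I using Finset.induction_on with
  | empty => simp
  | insert j I hj ih =>
    rw [Finset.prod_insert hj, Finset.prod_insert hj, Finset.sum_insert hj]
    have ih' := ih (fun i hi => hx i (Finset.mem_insert_of_mem hi))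
      (fun i hi => hy i (Finset.mem_insert_of_mem hi))
    have hp : ‖∏ i ∈ I, x i‖ ≤ 1 := by
      rw [norm_prod]
      exact Finset.prod_le_one (fun _ _ => norm_nonneg _)
        fun i hi => hx i (Finset.mem_insert_of_mem hi)
    calc ‖x j * ∏ i ∈ I, x i - y j * ∏ i ∈ I, y i‖
        = ‖(x j - y j) * ∏ i ∈ I, x i + y j * (∏ i ∈ I, x i - ∏ i ∈ I, y i)‖ := by
          congr 1; ring
      _ ≤ ‖x j - y j‖ * 1 + 1 * ∑ i ∈ I, ‖x i - y i‖ := by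
          refine (norm_add_le _ _).trans ?_
          rw [norm_mul, norm_mul]
          gcongr
          exact hy j (Finset.mem_insert_self _ _)
      _ = _ := by ring

variable {Ω : Type*} [MeasurableSpace Ω] {P : Measure Ω}

/-- Both functions have the second-order expansion `1 - θ² / 2` at `0`. Since all summands of the
later sums share the law `μ`, one `δ` serves for all of them. -/
theorem charFun_sub_exp_isLittleO {μ : Measure ℝ} [IsProbabilityMeasure μ] (h0 : ∫ x, x ∂μ = 0)
    (h1 : ∫ x, x ^ 2 ∂μ = 1) {ε : ℝ} (hε : 0 < ε) :
    ∃ δ > 0, ∀ θ : ℝ, |θ| ≤ δ → ‖charFun μ θ - Complex.exp (-(θ ^ 2 / 2 : ℝ))‖ ≤ ε * θ ^ 2 := by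
  have t1 := taylor_charFun_two (P := μ) (X := id) aemeasurable_id h0 (by simpa using h1)
  rw [Measure.map_id] at t1
  have t2 : (fun t : ℝ => Complex.exp (-(t ^ 2 / 2 : ℝ)) - (1 - t ^ 2 / 2)) =o[𝓝 0]
      fun t : ℝ => t ^ 2 := by
    have hd : (fun z : ℂ => Complex.exp z - 1 - z) =o[𝓝 0] fun z => z := by
      have := (Complex.hasDerivAt_exp 0).isLittleO
      simpa using this
    have hlim : Tendsto (fun t : ℝ => ((-(t ^ 2 / 2) : ℝ) : ℂ)) (𝓝 0) (𝓝 0) := by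
      have : Continuous fun t : ℝ => ((-(t ^ 2 / 2) : ℝ) : ℂ) := by fun_prop
      simpa using this.tendsto 0
    have h2 := hd.comp_tendsto hlim
    have h3 : (fun t : ℝ => ((-(t ^ 2 / 2) : ℝ) : ℂ)) =O[𝓝 0] fun t : ℝ => t ^ 2 := by
      refine Asymptotics.IsBigO.of_bound 1 (Eventually.of_forall fun t => ?_)
      rw [Complex.norm_real, norm_neg, norm_div, one_mul]
      have : ‖(2 : ℝ)‖ = 2 := by norm_num
      rw [this]
      linarith [norm_nonneg (t ^ 2)]
    refine (h2.trans_isBigO h3).congr_left fun t => ?_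
    simp only [Function.comp_apply]
    push_cast
    ring
  have t3 := (t1.sub t2).bound hε
  obtain ⟨δ, hδ, hball⟩ := Metric.eventually_nhds_iff.1 t3
  refine ⟨δ / 2, by positivity, fun θ hθ => ?_⟩
  have := hball (y := θ) (by rw [Real.dist_eq, sub_zero]; linarith)
  simp only [norm_pow, Real.norm_eq_abs, sq_abs] at this
  refine le_trans (le_of_eq ?_) this
  congr 1
  ring

/-- A central limit theorem for weighted sums of independent identically distributed random
variables, in terms of characteristic functions. -/
theorem tendsto_charFun_weighted_sum {ι κ : Type*} {l : Filter κ} {μ : Measure ℝ}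
    [IsProbabilityMeasure μ] (h0 : ∫ x, x ∂μ = 0) (h1 : ∫ x, x ^ 2 ∂μ = 1) {X : ι → Ω → ℝ}
    (hX : ∀ i, AEMeasurable (X i) P) (hlaw : ∀ i, P.map (X i) = μ) (hind : iIndepFun X P)
    {I : κ → Finset ι} {c : κ → ι → ℝ} {b : κ → ℝ} (hc : ∀ᶠ k in l, ∑ i ∈ I k, c k i ^ 2 = 1)
    (hb : ∀ᶠ k in l, ∀ i ∈ I k, |c k i| ≤ b k) (hb0 : Tendsto b l (𝓝 0)) (t : ℝ) :
    Tendsto (fun k => charFun (P.map fun ω => ∑ i ∈ I k, c k i * X i ω) t) l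
      (𝓝 (Complex.exp (-(t ^ 2 / 2 : ℝ)))) := by
  have hprod : ∀ k, charFun (P.map fun ω => ∑ i ∈ I k, c k i * X i ω) t =
      ∏ i ∈ I k, charFun μ (t * c k i) := by
    intro k
    have hind' : iIndepFun (fun i ω => c k i * X i ω) P :=
      hind.comp (fun i x => c k i * x) fun i => measurable_const_mul _
    have := hind'.precomp (g := ((↑) : I k → ι)) Subtype.val_injective
    rw [iIndepFun.charFun_map_fun_finsetSum_eq_prod (X := fun i ω => c k i * X i ω)
      (fun i _ => (hX i).const_mul _) this, Finset.prod_apply]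
    refine Finset.prod_congr rfl fun i _ => ?_
    have e : P.map (fun ω => c k i * X i ω) = μ.map (fun x => c k i * x) := by
      rw [← hlaw i, AEMeasurable.map_map_of_aemeasurable (by fun_prop) (hX i)]
      rfl
    rw [e, charFun_map_mul]
    congr 1
    ring
  rw [Metric.tendsto_nhds]
  intro ε hε
  -- The errors of all factors add up to `ε' * t ^ 2`, which this choice keeps strictly below `ε`.
  set ε' := ε / (2 * (t ^ 2 + 1)) with hε'
  have hε'0 : 0 < ε' := by positivity
  obtain ⟨δ, hδ, hφ⟩ := charFun_sub_exp_isLittleO h0 h1 hε'0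
  have hbt : ∀ᶠ k in l, |t| * b k < δ := by
    have : Tendsto (fun k => |t| * b k) l (𝓝 0) := by simpa using hb0.const_mul |t|
    exact this.eventually_lt_const hδ
  filter_upwards [hc, hb, hbt] with k hck hbk hbtk
  -- As the squared weights sum to `1`, the Gaussian limit factors over the same index set and the
  -- two products can be compared term by term.
  have hexp : Complex.exp (-(t ^ 2 / 2 : ℝ)) =
      ∏ i ∈ I k, Complex.exp (-((t * c k i) ^ 2 / 2 : ℝ)) := by
    rw [← Complex.exp_sum]
    congr 1
    rw [Finset.sum_neg_distrib]
    congr 1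
    rw [← Complex.ofReal_sum]
    congr 1
    simp only [mul_pow]
    rw [← Finset.sum_div, ← Finset.mul_sum, hck, mul_one]
  rw [hprod, hexp, dist_eq_norm]
  refine lt_of_le_of_lt (norm_prod_sub_prod_le _ _ _ (fun i _ => norm_charFun_le_one _) ?_) ?_
  · intro i _
    rw [← Complex.ofReal_neg, Complex.norm_exp_ofReal, Real.exp_le_one_iff]
    have := sq_nonneg (t * c k i)
    linarith
  · calc ∑ i ∈ I k, ‖charFun μ (t * c k i) - Complex.exp (-((t * c k i) ^ 2 / 2 : ℝ))‖
        ≤ ∑ i ∈ I k, ε' * (t * c k i) ^ 2 := by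
          refine Finset.sum_le_sum fun i hi => hφ _ ?_
          rw [abs_mul]
          exact (mul_le_mul_of_nonneg_left (hbk i hi) (abs_nonneg t)).trans hbtk.le
      _ = ε' * t ^ 2 := by
          simp only [mul_pow]
          rw [← Finset.mul_sum, ← Finset.mul_sum, hck, mul_one]
      _ < ε := by
          rw [hε', div_mul_eq_mul_div, div_lt_iff₀ (by positivity)]
          nlinarith [sq_nonneg t]

end CentralLimit

end SpinField

namespace SpinField

/-! ### Independent real Gaussian coordinates for the coefficients. -/

section SecondMoments

variable {Ω : Type*} [MeasurableSpace Ω] {P : Measure Ω}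

/-- The covariances of real and imaginary parts require both `E[z conj w]` and `E[z w]`. Isotropy
controls the first; involutivity reduces the second to it. -/
theorem integral_re_mul_re {z w : Ω → ℂ} (hz : MemLp z 2 P) (hw : MemLp w 2 P) :
    ∫ ω, (z ω).re * (w ω).re ∂P =
      ((∫ ω, z ω * (starRingEnd ℂ) (w ω) ∂P).re + (∫ ω, z ω * w ω ∂P).re) / 2 := by
  have h1 : Integrable (fun ω => z ω * (starRingEnd ℂ) (w ω)) P := hz.integrable_mul hw.star
  have h2 : Integrable (fun ω => z ω * w ω) P := hz.integrable_mul hw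
  have e1 : (∫ ω, z ω * (starRingEnd ℂ) (w ω) ∂P).re = ∫ ω, (z ω * (starRingEnd ℂ) (w ω)).re ∂P :=
    (integral_re h1).symm
  have e2 : (∫ ω, z ω * w ω ∂P).re = ∫ ω, (z ω * w ω).re ∂P := (integral_re h2).symm
  have i1 : Integrable (fun ω => (z ω * (starRingEnd ℂ) (w ω)).re) P := h1.re
  have i2 : Integrable (fun ω => (z ω * w ω).re) P := h2.re
  rw [e1, e2, ← integral_add i1 i2, ← integral_div]
  refine integral_congr_ae (Eventually.of_forall fun ω => ?_)
  simp

theorem integral_im_mul_im {z w : Ω → ℂ} (hz : MemLp z 2 P) (hw : MemLp w 2 P) :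
    ∫ ω, (z ω).im * (w ω).im ∂P =
      ((∫ ω, z ω * (starRingEnd ℂ) (w ω) ∂P).re - (∫ ω, z ω * w ω ∂P).re) / 2 := by
  have h1 : Integrable (fun ω => z ω * (starRingEnd ℂ) (w ω)) P := hz.integrable_mul hw.star
  have h2 : Integrable (fun ω => z ω * w ω) P := hz.integrable_mul hw
  have e1 : (∫ ω, z ω * (starRingEnd ℂ) (w ω) ∂P).re = ∫ ω, (z ω * (starRingEnd ℂ) (w ω)).re ∂P :=
    (integral_re h1).symm
  have e2 : (∫ ω, z ω * w ω ∂P).re = ∫ ω, (z ω * w ω).re ∂P := (integral_re h2).symm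
  have i1 : Integrable (fun ω => (z ω * (starRingEnd ℂ) (w ω)).re) P := h1.re
  have i2 : Integrable (fun ω => (z ω * w ω).re) P := h2.re
  rw [e1, e2, ← integral_sub i1 i2, ← integral_div]
  refine integral_congr_ae (Eventually.of_forall fun ω => ?_)
  simp

theorem integral_re_mul_im {z w : Ω → ℂ} (hz : MemLp z 2 P) (hw : MemLp w 2 P) :
    ∫ ω, (z ω).re * (w ω).im ∂P =
      ((∫ ω, z ω * w ω ∂P).im - (∫ ω, z ω * (starRingEnd ℂ) (w ω) ∂P).im) / 2 := by
  have h1 : Integrable (fun ω => z ω * (starRingEnd ℂ) (w ω)) P := hz.integrable_mul hw.star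
  have h2 : Integrable (fun ω => z ω * w ω) P := hz.integrable_mul hw
  have e1 : (∫ ω, z ω * (starRingEnd ℂ) (w ω) ∂P).im = ∫ ω, (z ω * (starRingEnd ℂ) (w ω)).im ∂P :=
    (integral_im h1).symm
  have e2 : (∫ ω, z ω * w ω ∂P).im = ∫ ω, (z ω * w ω).im ∂P := (integral_im h2).symm
  have i1 : Integrable (fun ω => (z ω * (starRingEnd ℂ) (w ω)).im) P := h1.im
  have i2 : Integrable (fun ω => (z ω * w ω).im) P := h2.im
  rw [e1, e2, ← integral_sub i2 i1, ← integral_div]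
  refine integral_congr_ae (Eventually.of_forall fun ω => ?_)
  simp

end SecondMoments

namespace RandomSpinField

variable {Ω : Type*} [MeasurableSpace Ω] {s : ℤ} {P : Measure Ω}

/-- The degrees and orders of the spin `s` harmonics, without the degree `0`. -/
abbrev Order (s : ℤ) : Type := {q : ℕ × ℤ // s.natAbs ≤ q.1 ∧ 0 < q.1 ∧ |q.2| ≤ q.1}

/-- An orthogonal real form of the coefficients of an involutive field. -/
noncomputable def realCoeff (G : RandomSpinField s P) (l : ℕ) (m : ℤ) (ω : Ω) : ℝ :=
  if m < 0 then Real.sqrt 2 * (G.coeff l (-m) ω).im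
  else (if m = 0 then 1 else Real.sqrt 2) * (G.coeff l m ω).re

variable [IsProbabilityMeasure P]

theorem memLp_realCoeff (G : RandomSpinField s P) {l : ℕ} (hl : s.natAbs ≤ l) {m : ℤ}
    (hm : |m| ≤ l) : MemLp (G.realCoeff l m) 2 P := by
  unfold realCoeff
  split_ifs
  · exact (G.memLp_coeff hl (by rwa [abs_neg])).im.const_mul _
  · exact (G.memLp_coeff hl hm).re.const_mul _
  · exact (G.memLp_coeff hl hm).re.const_mul _

theorem integral_realCoeff (G : RandomSpinField s P) (hG : G.Isotropic) {l : ℕ}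
    (hl : s.natAbs ≤ l) (h0 : 0 < l) {m : ℤ} (hm : |m| ≤ l) :
    ∫ ω, G.realCoeff l m ω ∂P = 0 := by
  have hre : ∀ {m : ℤ}, |m| ≤ l → ∫ ω, (G.coeff l m ω).re ∂P = 0 := fun {m} hm => by
    have : ∫ ω, (G.coeff l m ω).re ∂P = (∫ ω, G.coeff l m ω ∂P).re :=
      integral_re ((G.memLp_coeff hl hm).integrable (by norm_num))
    rw [this, G.integral_coeff hG hl h0 hm, Complex.zero_re]
  have him : ∀ {m : ℤ}, |m| ≤ l → ∫ ω, (G.coeff l m ω).im ∂P = 0 := fun {m} hm => by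
    have : ∫ ω, (G.coeff l m ω).im ∂P = (∫ ω, G.coeff l m ω ∂P).im :=
      integral_im ((G.memLp_coeff hl hm).integrable (by norm_num))
    rw [this, G.integral_coeff hG hl h0 hm, Complex.zero_im]
  unfold realCoeff
  split_ifs
  · rw [integral_const_mul, him (by rwa [abs_neg]), mul_zero]
  · rw [integral_const_mul, hre hm, mul_zero]
  · rw [integral_const_mul, hre hm, mul_zero]

theorem integral_coeff_mul_conj_coeff (G : RandomSpinField s P) (hG : G.Isotropic) {l l' : ℕ}
    (hl : s.natAbs ≤ l) (hl' : s.natAbs ≤ l') {m m' : ℤ} (hm : |m| ≤ l) (hm' : |m'| ≤ l') :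
    ∫ ω, G.coeff l m ω * (starRingEnd ℂ) (G.coeff l' m' ω) ∂P =
      ((if l = l' ∧ m = m' then G.spectrum l else 0 : ℝ) : ℂ) := by
  split_ifs with h
  · obtain ⟨rfl, rfl⟩ := h
    rw [← G.integral_norm_coeff_sq hG hl hm, ← integral_complex_ofReal]
    refine integral_congr_ae (Eventually.of_forall fun ω => ?_)
    simp only [Complex.mul_conj']
    push_cast
    rfl
  · rw [G.integral_coeff_mul_conj_coeff_of_ne hG hl hl' hm hm' (by tauto), Complex.ofReal_zero]

theorem integral_coeff_mul_coeff (G : RandomSpinField s P) (hG : G.Isotropic) (hinv : G.Involutive)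
    {l l' : ℕ} (hl : s.natAbs ≤ l) (hl' : s.natAbs ≤ l') {m m' : ℤ} (hm : |m| ≤ l)
    (hm' : |m'| ≤ l') :
    ∫ ω, G.coeff l m ω * G.coeff l' m' ω ∂P =
      ((if l = l' ∧ m = -m' then G.spectrum l else 0 : ℝ) : ℂ) := by
  rw [← G.integral_coeff_mul_conj_coeff hG hl hl' hm (by rwa [abs_neg])]
  refine integral_congr_ae ?_
  filter_upwards [hinv l' hl' (-m') (by rwa [abs_neg])] with ω hω
  rw [hω, neg_neg]

theorem integral_realCoeff_mul_realCoeff (G : RandomSpinField s P) (hG : G.Isotropic)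
    (hinv : G.Involutive) {l l' : ℕ} (hl : s.natAbs ≤ l) (hl' : s.natAbs ≤ l') {m m' : ℤ}
    (hm : |m| ≤ l) (hm' : |m'| ≤ l') :
    ∫ ω, G.realCoeff l m ω * G.realCoeff l' m' ω ∂P =
      if l = l' ∧ m = m' then G.spectrum l else 0 := by
  have h2 : Real.sqrt 2 * Real.sqrt 2 = 2 := Real.mul_self_sqrt (by norm_num)
  have hn : |(-m)| ≤ (l : ℤ) := by rwa [abs_neg]
  have hn' : |(-m')| ≤ (l' : ℤ) := by rwa [abs_neg]
  have pull : ∀ (c c' : ℝ) (f g : Ω → ℝ), ∫ ω, (c * f ω) * (c' * g ω) ∂P =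
      c * c' * ∫ ω, f ω * g ω ∂P := by
    intro c c' f g
    rw [← integral_const_mul]
    refine integral_congr_ae (Eventually.of_forall fun ω => ?_)
    simp only; ring
  by_cases h : m < 0 <;> by_cases h' : m' < 0 <;> simp only [realCoeff, h, h', if_true, if_false]
  · rw [pull, integral_im_mul_im (G.memLp_coeff hl hn) (G.memLp_coeff hl' hn'), h2,
      G.integral_coeff_mul_conj_coeff hG hl hl' hn hn',
      G.integral_coeff_mul_coeff hG hinv hl hl' hn hn', if_neg (by omega : ¬ (l = l' ∧ -m = - -m'))]
    simp only [neg_inj, Complex.ofReal_re]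
    ring
  · rw [if_neg (by omega : ¬ (l = l' ∧ m = m'))]
    refine (integral_congr_ae (Eventually.of_forall fun ω => mul_comm _ _)).trans ?_
    rw [pull, integral_re_mul_im (G.memLp_coeff hl' hm') (G.memLp_coeff hl hn),
      G.integral_coeff_mul_conj_coeff hG hl' hl hm' hn,
      G.integral_coeff_mul_coeff hG hinv hl' hl hm' hn]
    simp
  · rw [if_neg (by omega : ¬ (l = l' ∧ m = m')), pull,
      integral_re_mul_im (G.memLp_coeff hl hm) (G.memLp_coeff hl' hn'),
      G.integral_coeff_mul_conj_coeff hG hl hl' hm hn',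
      G.integral_coeff_mul_coeff hG hinv hl hl' hm hn']
    simp
  · rw [pull, integral_re_mul_re (G.memLp_coeff hl hm) (G.memLp_coeff hl' hm'),
      G.integral_coeff_mul_conj_coeff hG hl hl' hm hm',
      G.integral_coeff_mul_coeff hG hinv hl hl' hm hm', Complex.ofReal_re, Complex.ofReal_re]
    by_cases hq : l = l' ∧ m = m'
    · rw [if_pos hq]
      obtain ⟨rfl, rfl⟩ := hq
      by_cases hm0 : m = 0
      · simp [hm0]
      · rw [if_neg hm0, if_neg (by omega), h2]; ring
    · rw [if_neg hq]
      by_cases hq' : l = l' ∧ m = -m'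
      -- Both orders are nonnegative here, so `m = -m'` forces `m = m' = 0`, the diagonal case
      -- already excluded.
      · exact absurd ⟨hq'.1, by omega⟩ hq
      · rw [if_neg hq']
        simp

/-- Random variables orthogonal to the field are orthogonal to its coefficients. -/
theorem integral_mul_coeff_eq_zero (G : RandomSpinField s P) {η : Ω → ℝ} (hη : MemLp η 2 P)
    (hgauss : G.Gaussian)
    (h : ∀ t, ∫ ω, η ω * (Sum.elim (fun (x : chartI) (ω : Ω) => (G.toFun 1 x ω).re)
      (fun (x : chartI) (ω : Ω) => (G.toFun 1 x ω).im)) t ω ∂P = 0) {l : ℕ} (hl : s.natAbs ≤ l)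
    {m : ℤ} (hm : |m| ≤ l) : ∫ ω, (η ω : ℂ) * G.coeff l m ω ∂P = 0 := by
  have key := G.integral_mul_proj (measurable_harm s l ((l : ℤ) + m).toNat)
    (exists_norm_harm_le s l _) (η := fun ω => (η ω : ℂ)) hη.ofReal
  -- After Fubini the inner integral pairs `η` with the field at one point, and this is zero by
  -- orthogonality to its real and imaginary parts.
  have hzero : ∀ᵐ p ∂surface, ∫ ω, (η ω : ℂ) * G.sec p ω ∂P = 0 := by
    filter_upwards [ae_mem_chartI] with p hp
    have hre : MemLp (fun ω => (G.toFun 1 p ω).re) 2 P :=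
      (hgauss.hasGaussianLaw_eval (Sum.inl ⟨p, hp⟩)).memLp_two
    have him : MemLp (fun ω => (G.toFun 1 p ω).im) 2 P :=
      (hgauss.hasGaussianLaw_eval (Sum.inr ⟨p, hp⟩)).memLp_two
    have i1 : Integrable (fun ω => η ω * (G.toFun 1 p ω).re) P := hη.integrable_mul hre
    have i2 : Integrable (fun ω => η ω * (G.toFun 1 p ω).im) P := hη.integrable_mul him
    have z1 : ∫ ω, η ω * (G.toFun 1 p ω).re ∂P = 0 := h (Sum.inl ⟨p, hp⟩)
    have z2 : ∫ ω, η ω * (G.toFun 1 p ω).im ∂P = 0 := h (Sum.inr ⟨p, hp⟩)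
    calc ∫ ω, (η ω : ℂ) * G.sec p ω ∂P
        = ∫ ω, (((η ω * (G.toFun 1 p ω).re : ℝ) : ℂ) +
            ((η ω * (G.toFun 1 p ω).im : ℝ) : ℂ) * Complex.I) ∂P := by
          refine integral_congr_ae (Eventually.of_forall fun ω => ?_)
          simp only
          rw [G.sec_of_mem hp]
          conv_lhs => rw [← Complex.re_add_im (G.toFun 1 p ω)]
          push_cast
          ring
      _ = 0 := by
          rw [integral_add i1.ofReal (i2.ofReal.mul_const _), integral_mul_const,
            integral_complex_ofReal, integral_complex_ofReal, z1, z2]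
          simp
  have : ∫ ω, (η ω : ℂ) * G.proj (harm s l ((l : ℤ) + m).toNat) ω ∂P = 0 := by
    rw [key]
    refine integral_eq_zero_of_ae ?_
    filter_upwards [hzero] with p hp
    rw [hp, zero_mul, Pi.zero_apply]
  simp only [G.coeff_eq_proj hl hm, mul_left_comm _ (harmConst s l m : ℂ)]
  rw [integral_const_mul, this, mul_zero]

theorem isGaussianProcess_realCoeff (G : RandomSpinField s P) (hgauss : G.Gaussian) :
    IsGaussianProcess (fun (q : Order s) => G.realCoeff q.1.1 q.1.2) P := by
  refine isGaussianProcess_of_orthogonal hgauss (fun q => G.memLp_realCoeff q.2.1 q.2.2.2) ?_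
  rintro ⟨⟨l, m⟩, hl, -, hm⟩ η hη h
  have hint : ∀ {m : ℤ}, |m| ≤ l → Integrable (fun ω => (η ω : ℂ) * G.coeff l m ω) P :=
    fun hm => (hη.ofReal (K := ℂ)).integrable_mul (G.memLp_coeff hl hm)
  have hre : ∀ {m : ℤ}, |m| ≤ l → ∫ ω, η ω * (G.coeff l m ω).re ∂P = 0 := fun {m} hm => by
    have e : ∫ ω, ((η ω : ℂ) * G.coeff l m ω).re ∂P = (∫ ω, (η ω : ℂ) * G.coeff l m ω ∂P).re :=
      integral_re (hint hm)
    rw [G.integral_mul_coeff_eq_zero hη hgauss h hl hm] at e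
    simpa using e
  have him : ∀ {m : ℤ}, |m| ≤ l → ∫ ω, η ω * (G.coeff l m ω).im ∂P = 0 := fun {m} hm => by
    have e : ∫ ω, ((η ω : ℂ) * G.coeff l m ω).im ∂P = (∫ ω, (η ω : ℂ) * G.coeff l m ω ∂P).im :=
      integral_im (hint hm)
    rw [G.integral_mul_coeff_eq_zero hη hgauss h hl hm] at e
    simpa using e
  simp only [realCoeff]
  split_ifs
  · simp only [mul_left_comm (η _)]
    rw [integral_const_mul, him (by rwa [abs_neg]), mul_zero]
  · simp only [mul_left_comm (η _)]
    rw [integral_const_mul, hre hm, mul_zero]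
  · simp only [mul_left_comm (η _)]
    rw [integral_const_mul, hre hm, mul_zero]

theorem iIndepFun_realCoeff (G : RandomSpinField s P) (hG : G.Isotropic) (hgauss : G.Gaussian)
    (hinv : G.Involutive) :
    iIndepFun (fun (q : Order s) => G.realCoeff q.1.1 q.1.2) P := by
  -- The independence criterion concerns families of processes, so each coefficient is regarded as a
  -- process indexed by one point.
  have hproc := (G.isGaussianProcess_realCoeff hgauss).comp_right
    (fun p : (_ : Order s) × Unit => p.1)
  have h := hproc.iIndepFun_of_covariance_eq_zero
    (X := fun (q : Order s) (_ : Unit) => G.realCoeff q.1.1 q.1.2)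
    (fun q _ => (G.memLp_realCoeff q.2.1 q.2.2.2).aestronglyMeasurable.aemeasurable) ?_
  · exact h.comp (fun _ f => f ()) fun _ => measurable_pi_apply _
  · intro q q' hqq _ _
    rw [covariance_eq_sub (G.memLp_realCoeff q.2.1 q.2.2.2) (G.memLp_realCoeff q'.2.1 q'.2.2.2),
      G.integral_realCoeff hG q.2.1 q.2.2.1 q.2.2.2, zero_mul, sub_zero]
    refine (G.integral_realCoeff_mul_realCoeff hG hinv q.2.1 q'.2.1 q.2.2.2 q'.2.2.2).trans ?_
    rw [if_neg]
    rintro ⟨h1, h2⟩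
    exact hqq (Subtype.ext (Prod.ext h1 h2))

omit [IsProbabilityMeasure P] in
theorem spectrum_nonneg (G : RandomSpinField s P) (l : ℕ) : 0 ≤ G.spectrum l :=
  integral_nonneg fun _ => by positivity

theorem map_realCoeff (G : RandomSpinField s P) (hG : G.Isotropic) (hgauss : G.Gaussian)
    (hinv : G.Involutive) (q : Order s) :
    P.map (G.realCoeff q.1.1 q.1.2) = gaussianReal 0 (G.spectrum q.1.1).toNNReal := by
  have h := ((G.isGaussianProcess_realCoeff hgauss).hasGaussianLaw_eval q).map_eq_gaussianReal
  have hmem := G.memLp_realCoeff q.2.1 q.2.2.2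
  rw [variance_eq_sub hmem, G.integral_realCoeff hG q.2.1 q.2.2.1 q.2.2.2] at h
  rw [h]
  congr 2
  have := G.integral_realCoeff_mul_realCoeff hG hinv q.2.1 q.2.1 q.2.2.2 q.2.2.2
  rw [if_pos ⟨rfl, rfl⟩] at this
  rw [← this]
  simp [pow_two]

omit [IsProbabilityMeasure P] in
-- The orders `m` and `-m` share the same modulus, while `realCoeff` takes `√2 Re` at one and `√2
-- Im` at the other. The termwise difference of the two sums is therefore odd in `m` and sums to
-- zero; at `m = 0` the coefficient is real.
theorem sum_norm_coeff_sq (G : RandomSpinField s P) (hinv : G.Involutive) {l : ℕ}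
    (hl : s.natAbs ≤ l) : ∀ᵐ ω ∂P, ∑ m ∈ Finset.Icc (-(l : ℤ)) (l : ℤ), ‖G.coeff l m ω‖ ^ 2 =
      ∑ m ∈ Finset.Icc (-(l : ℤ)) (l : ℤ), G.realCoeff l m ω ^ 2 := by
  have hall : ∀ᵐ ω ∂P, ∀ m ∈ Finset.Icc (-(l : ℤ)) (l : ℤ),
      (starRingEnd ℂ) (G.coeff l m ω) = G.coeff l (-m) ω := by
    rw [Finset.eventually_all]
    intro m hm
    exact hinv l hl m (abs_le.2 (Finset.mem_Icc.1 hm))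
  filter_upwards [hall] with ω hω
  have h2 : Real.sqrt 2 ^ 2 = 2 := Real.sq_sqrt (by norm_num)
  have hn : ∀ z : ℂ, ‖z‖ ^ 2 = z.re ^ 2 + z.im ^ 2 := fun z => by
    rw [← Complex.normSq_eq_norm_sq, Complex.normSq_apply]; ring
  rw [← sub_eq_zero, ← Finset.sum_sub_distrib]
  set d : ℤ → ℝ := fun m => ‖G.coeff l m ω‖ ^ 2 - G.realCoeff l m ω ^ 2 with hd
  have hodd : ∀ m ∈ Finset.Icc (-(l : ℤ)) (l : ℤ), d (-m) = -d m := by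
    intro m hm
    have hc := hω m hm
    have hnorm : ‖G.coeff l (-m) ω‖ = ‖G.coeff l m ω‖ := by rw [← hc, RCLike.norm_conj]
    rcases lt_trichotomy m 0 with h | h | h
    · simp only [hd, realCoeff, h, if_true, if_neg (by omega : ¬ (-m < 0)),
        if_neg (by omega : ¬ (-m = 0)), hnorm, mul_pow, h2]
      rw [← hnorm, hn]
      ring
    · subst h
      have him : (G.coeff l 0 ω).im = 0 := by
        rw [neg_zero] at hc
        exact Complex.conj_eq_iff_im.1 hc
      simp [hd, realCoeff, hn, him]
    · simp only [hd, realCoeff, if_neg (by omega : ¬ (m < 0)), if_pos (by omega : -m < 0),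
        if_neg (by omega : ¬ (m = 0)), neg_neg, hnorm, mul_pow, h2]
      rw [hn]
      ring
  have hsum : ∑ m ∈ Finset.Icc (-(l : ℤ)) (l : ℤ), d m =
      ∑ m ∈ Finset.Icc (-(l : ℤ)) (l : ℤ), d (-m) := by
    refine Finset.sum_nbij' (fun m => -m) (fun m => -m) ?_ ?_ ?_ ?_ ?_
    · intro m hm; rw [Finset.mem_Icc] at hm ⊢; omega
    · intro m hm; rw [Finset.mem_Icc] at hm ⊢; omega
    · intro m _; simp
    · intro m _; simp
    · intro m _; simp
  rw [Finset.sum_congr rfl hodd, Finset.sum_neg_distrib] at hsum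
  change ∑ m ∈ Finset.Icc (-(l : ℤ)) (l : ℤ), d m = 0
  linarith

end RandomSpinField

end SpinField

namespace SpinField

/-! ### The needlet filter along the spectrum of the Laplacian -/

theorem eigen_eq (s : ℤ) (l : ℕ) :
    eigen s l = ((l : ℝ) - s.natAbs) * ((l : ℝ) + s.natAbs + 1) := by
  unfold eigen
  split_ifs with h
  · have : ((s.natAbs : ℕ) : ℝ) = (s : ℝ) := by
      rw [Nat.cast_natAbs, abs_of_nonneg h]
    rw [this]
  · have : ((s.natAbs : ℕ) : ℝ) = -(s : ℝ) := by
      rw [Nat.cast_natAbs, abs_of_neg (not_le.1 h)]; push_cast; ring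
    rw [this]
    ring

namespace IsNeedletFilter

variable {f : ℝ → ℝ} {a : ℝ}

theorem mem_Icc_of_ne_zero (hf : IsNeedletFilter f a) {u : ℝ} (hu : f u ≠ 0) :
    u ∈ Set.Icc (1 / a ^ 2) (a ^ 2) :=
  hf.support_subset hu

theorem pos_of_ne_zero (hf : IsNeedletFilter f a) {u : ℝ} (hu : f u ≠ 0) : 0 < u := by
  have ha := hf.one_lt
  exact lt_of_lt_of_le (by positivity) (hf.mem_Icc_of_ne_zero hu).1

theorem sq_le_one (hf : IsNeedletFilter f a) (u : ℝ) : f u ^ 2 ≤ 1 := by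
  by_cases h : f u = 0
  · simp [h]
  · have := le_hasSum (hf.daubechies u (hf.pos_of_ne_zero h)) 0 fun j _ => sq_nonneg _
    simpa using this

theorem exists_ne_zero (hf : IsNeedletFilter f a) : ∃ u, f u ≠ 0 := by
  by_contra! h
  have := hf.daubechies 1 one_pos
  have h0 : HasSum (fun j : ℤ => f (a ^ (2 * j) * 1) ^ 2) 0 := by simp [h, hasSum_zero]
  exact one_ne_zero (this.unique h0)

theorem exists_forall_eq_zero (hf : IsNeedletFilter f a) (s : ℤ) (j : ℤ) :
    ∃ N : ℕ, ∀ l : ℕ, s.natAbs ≤ l → l ∉ Finset.Icc (max s.natAbs 1) N →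
      f (a ^ (2 * j) * eigen s l) = 0 := by
  have ha : 0 < a := one_pos.trans hf.one_lt
  have hp : 0 < a ^ (2 * j) := zpow_pos ha _
  refine ⟨⌈a ^ 2 / a ^ (2 * j)⌉₊ + s.natAbs, fun l hl h => not_not.1 fun hne => h ?_⟩
  rw [Finset.mem_Icc, max_le_iff]
  refine ⟨⟨hl, Nat.one_le_iff_ne_zero.2 ?_⟩, ?_⟩
  -- Degree `0` occurs only for spin `0`, where its eigenvalue is `0` and so outside the support of
  -- `f`. This is where the possibly uncentred coefficient `A_{00}` leaves the statistic.
  · rintro rfl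
    have hs : s.natAbs = 0 := by omega
    have hpos := hf.pos_of_ne_zero hne
    simp [eigen_eq, hs] at hpos
  · by_contra! hlt
    have h1 := (hf.mem_Icc_of_ne_zero hne).2
    have h2 : a ^ 2 / a ^ (2 * j) < (l : ℝ) - s.natAbs := by
      have h3 := Nat.le_ceil (a ^ 2 / a ^ (2 * j))
      have h4 : ((⌈a ^ 2 / a ^ (2 * j)⌉₊ + s.natAbs : ℕ) : ℝ) < l := by exact_mod_cast hlt
      push_cast at h4
      linarith
    have h5 : (l : ℝ) - s.natAbs ≤ eigen s l := by
      have h6 : (0 : ℝ) ≤ (l : ℝ) - s.natAbs := sub_nonneg.2 (by exact_mod_cast hl)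
      rw [eigen_eq]
      have h7 : (0 : ℝ) ≤ s.natAbs := Nat.cast_nonneg _
      exact le_mul_of_one_le_right h6 (by linarith)
    rw [div_lt_iff₀ hp] at h2
    nlinarith

theorem zpow_mul_eigen (a : ℝ) (s j : ℤ) (l : ℕ) :
    a ^ (2 * j) * eigen s l = eigen s l / (a ^ (-j)) ^ 2 := by
  rw [← zpow_natCast, ← zpow_mul, div_eq_mul_inv, ← zpow_neg, mul_comm]
  congr 2
  push_cast
  ring

variable {s : ℤ} {S : ℕ → ℝ} {c C α : ℝ}

/-- If the filter does not vanish at degree `l`, then `L² / a²` is at most the eigenvalue, so `L ≤ a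
(l + |s| + 1)`. For `L ≥ 2a (|s| + 1)` this yields `l ≥ L / (2a)`, and the decay of the spectrum
gives the bound. -/
theorem eventually_sq_mul_spectrum_le (hf : IsNeedletFilter f a) (hC : 0 < C) (hα : 0 < α)
    (hS : ∀ l : ℕ, s.natAbs ≤ l → 0 < l → S l ≤ C * (l : ℝ) ^ (-α)) :
    ∃ A : ℝ, 0 < A ∧ ∀ᶠ L : ℝ in atTop, ∀ l : ℕ, s.natAbs ≤ l → 0 < l →
      f (eigen s l / L ^ 2) ^ 2 * S l ≤ A * L ^ (-α) := by
  have ha : 0 < a := one_pos.trans hf.one_lt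
  refine ⟨C * (1 / (2 * a)) ^ (-α), by positivity, ?_⟩
  filter_upwards [eventually_gt_atTop 0, eventually_ge_atTop (2 * a * (s.natAbs + 1))]
    with L hL0 hL l hl hl0
  have hl0' : (0 : ℝ) < l := by exact_mod_cast hl0
  by_cases hne : f (eigen s l / L ^ 2) = 0
  · rw [hne]
    simp only [ne_eq, OfNat.ofNat_ne_zero, not_false_eq_true, zero_pow, zero_mul]
    positivity
  · have h1 := (hf.mem_Icc_of_ne_zero hne).1
    rw [div_le_div_iff₀ (by positivity) (by positivity), one_mul, eigen_eq] at h1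
    have hn : (0 : ℝ) ≤ s.natAbs := Nat.cast_nonneg _
    have hln : (s.natAbs : ℝ) ≤ l := by exact_mod_cast hl
    have h2 : L ^ 2 ≤ (((l : ℝ) + s.natAbs + 1) * a) ^ 2 := by
      rw [mul_pow]
      refine h1.trans (mul_le_mul_of_nonneg_right ?_ (by positivity))
      nlinarith
    have h3 : L ≤ ((l : ℝ) + s.natAbs + 1) * a := (sq_le_sq₀ hL0.le (by positivity)).1 h2
    have h4 : 1 / (2 * a) * L ≤ l := by
      rw [div_mul_eq_mul_div, one_mul, div_le_iff₀ (by positivity)]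
      nlinarith
    have h5 : (l : ℝ) ^ (-α) ≤ (1 / (2 * a) * L) ^ (-α) :=
      Real.rpow_le_rpow_of_nonpos (by positivity) h4 (by linarith)
    rw [Real.mul_rpow (by positivity) hL0.le] at h5
    calc f (eigen s l / L ^ 2) ^ 2 * S l
        ≤ f (eigen s l / L ^ 2) ^ 2 * (C * (l : ℝ) ^ (-α)) := by gcongr; exact hS l hl hl0
      _ ≤ 1 * (C * (l : ℝ) ^ (-α)) := by gcongr; exact hf.sq_le_one _
      _ ≤ C * (1 / (2 * a)) ^ (-α) * L ^ (-α) := by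
          rw [one_mul, mul_assoc]; gcongr

/-- Fix `u` with `f u ≠ 0` and take `l = ⌈√u L⌉`. The rescaled eigenvalue tends to `u`, so by
continuity the filter stays away from zero at this one degree, whose multiplicity `2l + 1` supplies
the extra factor `L`. -/
theorem eventually_exists_le_variance_term (hf : IsNeedletFilter f a) (hc : 0 < c) (hα : 0 < α)
    (hS : ∀ l : ℕ, s.natAbs ≤ l → 0 < l → c * (l : ℝ) ^ (-α) ≤ S l) :
    ∃ B : ℝ, 0 < B ∧ ∀ᶠ L : ℝ in atTop, ∃ l : ℕ, s.natAbs ≤ l ∧ 0 < l ∧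
      B * (L ^ (-α)) ^ 2 * L ≤ 2 * f (eigen s l / L ^ 2) ^ 4 * S l ^ 2 * (2 * (l : ℝ) + 1) := by
  obtain ⟨u, hu⟩ := hf.exists_ne_zero
  have hu0 := hf.pos_of_ne_zero hu
  set r := Real.sqrt u
  have hr0 : 0 < r := Real.sqrt_pos.2 hu0
  have hlim : Tendsto (fun L : ℝ => (⌈r * L⌉₊ : ℝ) / L) atTop (𝓝 r) :=
    tendsto_nat_ceil_mul_div_atTop hr0.le
  have hinv : ∀ d : ℝ, Tendsto (fun L : ℝ => d / L) atTop (𝓝 0) := fun d =>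
    tendsto_const_nhds.div_atTop tendsto_id
  have heig : Tendsto (fun L : ℝ => eigen s ⌈r * L⌉₊ / L ^ 2) atTop (𝓝 u) := by
    have h := (hlim.sub (hinv s.natAbs)).mul (hlim.add (hinv (s.natAbs + 1)))
    rw [sub_zero, add_zero, show r * r = u from Real.mul_self_sqrt hu0.le] at h
    refine h.congr' ?_
    filter_upwards [eventually_gt_atTop 0] with L hL
    rw [eigen_eq]
    field_simp
    ring
  have hf4 : Tendsto (fun L : ℝ => f (eigen s ⌈r * L⌉₊ / L ^ 2) ^ 4) atTop (𝓝 (f u ^ 4)) :=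
    ((hf.smooth.continuous.tendsto u).comp heig).pow 4
  have hu4 : 0 < f u ^ 4 := by positivity
  set ε := f u ^ 4 / 2
  have hε0 : 0 < ε := by positivity
  -- The constant collects `f⁴ > ε`, the lower bound on the spectrum at `l ≤ 2rL`, and `2l + 1 ≥
  -- 2rL`.
  refine ⟨4 * ε * (c * (2 * r) ^ (-α)) ^ 2 * r, by positivity, ?_⟩
  filter_upwards [eventually_gt_atTop 0, eventually_ge_atTop ((s.natAbs : ℝ) / r),
    hf4.eventually (lt_mem_nhds (half_lt_self hu4)),
    hlim.eventually (gt_mem_nhds (by linarith : r < 2 * r))] with L hL0 hLs hL4 hL2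
  have hle : r * L ≤ (⌈r * L⌉₊ : ℝ) := Nat.le_ceil _
  have hceil0 : 0 < (⌈r * L⌉₊ : ℝ) := lt_of_lt_of_le (by positivity) hle
  have hs : s.natAbs ≤ ⌈r * L⌉₊ := by
    rw [div_le_iff₀ hr0, mul_comm] at hLs
    exact_mod_cast hLs.trans hle
  have h0 : 0 < ⌈r * L⌉₊ := by exact_mod_cast hceil0
  refine ⟨⌈r * L⌉₊, hs, h0, ?_⟩
  rw [div_lt_iff₀ hL0] at hL2
  have h5 : (2 * r) ^ (-α) * L ^ (-α) ≤ (⌈r * L⌉₊ : ℝ) ^ (-α) := by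
    rw [← Real.mul_rpow (by positivity) hL0.le]
    exact Real.rpow_le_rpow_of_nonpos hceil0 hL2.le (by linarith)
  have h6 : c * (2 * r) ^ (-α) * L ^ (-α) ≤ S ⌈r * L⌉₊ := by
    rw [mul_assoc]
    exact (mul_le_mul_of_nonneg_left h5 hc.le).trans (hS _ hs h0)
  calc 4 * ε * (c * (2 * r) ^ (-α)) ^ 2 * r * (L ^ (-α)) ^ 2 * L
      = 2 * ε * (c * (2 * r) ^ (-α) * L ^ (-α)) ^ 2 * (2 * (r * L)) := by ring
    _ ≤ 2 * f (eigen s ⌈r * L⌉₊ / L ^ 2) ^ 4 * S ⌈r * L⌉₊ ^ 2 * (2 * (⌈r * L⌉₊ : ℝ) + 1) := by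
        gcongr
        linarith

theorem tendsto_zpow_neg_atBot (hf : IsNeedletFilter f a) :
    Tendsto (fun j : ℤ => a ^ (-j)) atBot atTop :=
  ((tendsto_pow_atTop_atTop_of_one_lt hf.one_lt).comp
    (tendsto_atTop.2 fun n => (eventually_le_atBot (-(n : ℤ))).mono fun j hj =>
      (by omega : n ≤ (-j).toNat))).congr' <| by
    filter_upwards [eventually_le_atBot 0] with j hj
    rw [Function.comp_apply, ← zpow_natCast, Int.toNat_of_nonneg (by omega)]

/-- No single order contributes a positive fraction of the variance in the limit of small scales. -/
theorem exists_tendsto_forall_abs_weight_le (hf : IsNeedletFilter f a) (hc : 0 < c) (hC : 0 < C)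
    (hα : 0 < α) (hS : ∀ l : ℕ, s.natAbs ≤ l → 0 < l →
      c * (l : ℝ) ^ (-α) ≤ S l ∧ S l ≤ C * (l : ℝ) ^ (-α)) {V : ℤ → ℝ}
    (hV : ∀ j : ℤ, HasSum (fun l : {l : ℕ // s.natAbs ≤ l} =>
      2 * f (a ^ (2 * j) * eigen s l.1) ^ 4 * S l.1 ^ 2 * (2 * (l.1 : ℝ) + 1)) (V j)) :
    ∃ b : ℤ → ℝ, Tendsto b atBot (𝓝 0) ∧ ∀ᶠ j : ℤ in atBot, 0 < V j ∧
      ∀ l : ℕ, s.natAbs ≤ l → 0 < l →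
        |Real.sqrt 2 * f (a ^ (2 * j) * eigen s l) ^ 2 * S l / Real.sqrt (V j)| ≤ b j := by
  obtain ⟨A, hA, hA'⟩ := hf.eventually_sq_mul_spectrum_le (s := s) (S := S) hC hα
    fun l h h0 => (hS l h h0).2
  obtain ⟨B, hB, hB'⟩ := hf.eventually_exists_le_variance_term (s := s) (S := S) hc hα
    fun l h h0 => (hS l h h0).1
  have hlim := hf.tendsto_zpow_neg_atBot
  -- The squared numerator is at most `2 A² L^(-2α)` and the variance at least `B L^(1 - 2α)`; the
  -- power of `L^(-α)` cancels.
  refine ⟨fun j => Real.sqrt (2 * A ^ 2 / B / a ^ (-j)), ?_, ?_⟩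
  · have := (tendsto_const_nhds (x := 2 * A ^ 2 / B)).div_atTop hlim
    simpa using this.sqrt
  · filter_upwards [hlim.eventually hA', hlim.eventually hB', hlim.eventually (eventually_gt_atTop 0)]
      with j hj1 hj2 hj0
    simp only [← zpow_mul_eigen] at hj1 hj2
    set L := a ^ (-j)
    obtain ⟨l₀, hl₀, -, hle⟩ := hj2
    have hVle : B * (L ^ (-α)) ^ 2 * L ≤ V j :=
      hle.trans (le_hasSum (hV j) ⟨l₀, hl₀⟩ fun l _ => by positivity)
    have hX : 0 < L ^ (-α) := Real.rpow_pos_of_pos hj0 _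
    have hV0 : 0 < V j := lt_of_lt_of_le (by positivity) hVle
    refine ⟨hV0, fun l hl hl0 => Real.abs_le_sqrt ?_⟩
    have hS0 : 0 ≤ S l := le_trans (by positivity) (hS l hl hl0).1
    have hw := hj1 l hl hl0
    rw [div_pow, Real.sq_sqrt hV0.le, div_le_iff₀ hV0]
    calc (Real.sqrt 2 * f (a ^ (2 * j) * eigen s l) ^ 2 * S l) ^ 2
        = 2 * (f (a ^ (2 * j) * eigen s l) ^ 2 * S l) ^ 2 := by
          rw [mul_assoc, mul_pow, Real.sq_sqrt (by norm_num)]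
      _ ≤ 2 * (A * L ^ (-α)) ^ 2 := by gcongr
      _ = 2 * A ^ 2 / B / L * (B * (L ^ (-α)) ^ 2 * L) := by field_simp
      _ ≤ 2 * A ^ 2 / B / L * V j := by gcongr

end IsNeedletFilter

end SpinField

namespace SpinField

/-! ### Squares of Gaussian variables. -/

section GaussianSquares

variable {Ω : Type*} [MeasurableSpace Ω] {P : Measure Ω} {X : Ω → ℝ} {v : ℝ}

theorem map_sqrt_mul_gaussianReal (hv : 0 ≤ v) :
    (gaussianReal 0 1).map (fun x => Real.sqrt v * x) = gaussianReal 0 v.toNNReal := by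
  rw [gaussianReal_map_const_mul, mul_zero, mul_one]
  congr 1
  ext
  simp [Real.sq_sqrt hv, hv]

theorem integrable_pow_gaussianReal (n : ℕ) : Integrable (fun x : ℝ => x ^ n) (gaussianReal 0 1) := by
  rcases Nat.eq_zero_or_pos n with rfl | hn
  · simp
  · have := (memLp_id_gaussianReal (μ := 0) (v := 1) (n : NNReal)).integrable_norm_pow (by omega)
    refine this.mono (by fun_prop) (Eventually.of_forall fun x => by simp)

theorem integral_sq_gaussianReal : ∫ x, x ^ 2 ∂(gaussianReal 0 1) = 1 := by
  have h := variance_id_gaussianReal (μ := 0) (v := 1)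
  rw [variance_eq_sub (memLp_id_gaussianReal' 2 (by norm_num))] at h
  simpa [integral_id_gaussianReal] using h

theorem integral_pow_of_map_gaussianReal (hX : AEMeasurable X P) (hv : 0 ≤ v)
    (h : P.map X = gaussianReal 0 v.toNNReal) (n : ℕ) :
    ∫ ω, X ω ^ n ∂P = Real.sqrt v ^ n * ∫ x, x ^ n ∂(gaussianReal 0 1) := by
  rw [← integral_map (f := fun x : ℝ => x ^ n) hX (by fun_prop), h, ← map_sqrt_mul_gaussianReal hv,
    integral_map (by fun_prop) (by fun_prop), ← integral_const_mul]
  simp only [mul_pow]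

theorem memLp_sq_of_map_gaussianReal (hX : AEMeasurable X P)
    (h : P.map X = gaussianReal 0 v.toNNReal) : MemLp (fun ω => X ω ^ 2) 2 P := by
  refine (memLp_two_iff_integrable_sq (hX.pow_const 2).aestronglyMeasurable).2 ?_
  have h4 : Integrable (fun x : ℝ => ‖id x‖ ^ 4) (P.map X) := by
    rw [h]
    exact (memLp_id_gaussianReal (μ := 0) (v := v.toNNReal) 4).integrable_norm_pow (by norm_num)
  refine (h4.comp_aemeasurable hX).congr (Eventually.of_forall fun ω => ?_)
  simp only [Function.comp_apply, id_eq, Real.norm_eq_abs]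
  rw [← abs_pow, abs_of_nonneg (by positivity)]
  ring

theorem integral_sq_of_map_gaussianReal (hX : AEMeasurable X P) (hv : 0 ≤ v)
    (h : P.map X = gaussianReal 0 v.toNNReal) : ∫ ω, X ω ^ 2 ∂P = v := by
  rw [integral_pow_of_map_gaussianReal hX hv h, integral_sq_gaussianReal, Real.sq_sqrt hv, mul_one]

theorem variance_sq_of_map_gaussianReal [IsProbabilityMeasure P] (hX : AEMeasurable X P)
    (hv : 0 ≤ v) (h : P.map X = gaussianReal 0 v.toNNReal) :
    Var[fun ω => X ω ^ 2; P] = 2 * v ^ 2 := by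
  have h4 := integral_pow_of_map_gaussianReal hX hv h 4
  rw [integral_pow_four_gaussianReal, show Real.sqrt v ^ 4 = (Real.sqrt v ^ 2) ^ 2 by ring,
    Real.sq_sqrt hv] at h4
  rw [variance_eq_sub (memLp_sq_of_map_gaussianReal hX h), integral_sq_of_map_gaussianReal hX hv h]
  have : ∫ ω, ((fun ω => X ω ^ 2) ^ 2) ω ∂P = v ^ 2 * 3 := by
    rw [← h4]
    refine integral_congr_ae (Eventually.of_forall fun ω => ?_)
    simp only [Pi.pow_apply]
    ring
  rw [this]
  ring

/-- The law of the standardized square of a centred Gaussian variable. -/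
noncomputable def standardizedChiSq : Measure ℝ :=
  (gaussianReal 0 1).map fun x => (x ^ 2 - 1) / Real.sqrt 2

instance : IsProbabilityMeasure standardizedChiSq :=
  Measure.isProbabilityMeasure_map (by fun_prop)

theorem integral_standardizedChiSq : ∫ x, x ∂standardizedChiSq = 0 := by
  rw [standardizedChiSq, integral_map (by fun_prop) (by fun_prop), integral_div,
    integral_sub (integrable_pow_gaussianReal 2) (integrable_const 1), integral_sq_gaussianReal]
  simp

theorem integral_sq_standardizedChiSq : ∫ x, x ^ 2 ∂standardizedChiSq = 1 := by
  have h2 : Real.sqrt 2 ^ 2 = 2 := Real.sq_sqrt (by norm_num)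
  rw [standardizedChiSq, integral_map (by fun_prop) (by fun_prop)]
  have e : ∀ x : ℝ, ((x ^ 2 - 1) / Real.sqrt 2) ^ 2 = (x ^ 4 - 2 * x ^ 2 + 1) / 2 := fun x => by
    rw [div_pow, h2]; ring
  simp only [e]
  have i42 : Integrable (fun x : ℝ => x ^ 4 - 2 * x ^ 2) (gaussianReal 0 1) :=
    (integrable_pow_gaussianReal 4).sub ((integrable_pow_gaussianReal 2).const_mul 2)
  rw [integral_div, integral_add i42 (integrable_const 1),
    integral_sub (integrable_pow_gaussianReal 4) ((integrable_pow_gaussianReal 2).const_mul 2),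
    integral_const_mul, integral_sq_gaussianReal, integral_pow_four_gaussianReal]
  norm_num

theorem map_standardized_sq (hX : AEMeasurable X P) (hv : 0 < v)
    (h : P.map X = gaussianReal 0 v.toNNReal) :
    P.map (fun ω => (X ω ^ 2 / v - 1) / Real.sqrt 2) = standardizedChiSq := by
  have e : (fun ω => (X ω ^ 2 / v - 1) / Real.sqrt 2) =
    (fun x => (x ^ 2 / v - 1) / Real.sqrt 2) ∘ X := rfl
  rw [e, ← AEMeasurable.map_map_of_aemeasurable (by fun_prop) hX, h,
    ← map_sqrt_mul_gaussianReal hv.le, Measure.map_map (by fun_prop) (by fun_prop),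
    standardizedChiSq]
  congr 1
  funext x
  simp only [Function.comp_apply]
  rw [mul_pow, Real.sq_sqrt hv.le]
  field_simp

end GaussianSquares

/-! ### The statistic as a quadratic form in independent Gaussian variables. -/

namespace RandomSpinField

variable {Ω : Type*} [MeasurableSpace Ω] {s : ℤ} {P : Measure Ω} {f : ℝ → ℝ} {a : ℝ}

/-- The orders of all degrees up to `N`. -/
noncomputable def ordersUpTo (s : ℤ) (N : ℕ) : Finset (Order s) :=
  ((Finset.Icc (max s.natAbs 1) N ×ˢ Finset.Icc (-(N : ℤ)) N).filter
    fun q : ℕ × ℤ => |q.2| ≤ (q.1 : ℤ)).subtype _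

theorem sum_ordersUpTo (s : ℤ) (N : ℕ) (g : ℕ → ℤ → ℝ) :
    ∑ q ∈ ordersUpTo s N, g q.1.1 q.1.2 =
      ∑ l ∈ Finset.Icc (max s.natAbs 1) N, ∑ m ∈ Finset.Icc (-(l : ℤ)) l, g l m := by
  rw [← Finset.sum_finset_product' ((Finset.Icc (max s.natAbs 1) N ×ˢ
    Finset.Icc (-(N : ℤ)) N).filter fun q : ℕ × ℤ => |q.2| ≤ (q.1 : ℤ)), ordersUpTo]
  · exact Finset.sum_subtype_of_mem (fun q : ℕ × ℤ => g q.1 q.2) fun q hq => by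
      simp only [Finset.mem_filter, Finset.mem_product, Finset.mem_Icc, max_le_iff] at hq
      exact ⟨hq.1.1.1.1, hq.1.1.1.2, hq.2⟩
  · intro q
    simp only [Finset.mem_filter, Finset.mem_product, Finset.mem_Icc, abs_le]
    omega

theorem hasSum_of_forall_eq_zero {g : ℕ → ℝ} {N : ℕ}
    (h : ∀ l : ℕ, s.natAbs ≤ l → l ∉ Finset.Icc (max s.natAbs 1) N → g l = 0) :
    HasSum (fun l : {l : ℕ // s.natAbs ≤ l} => g l.1)
      (∑ l ∈ Finset.Icc (max s.natAbs 1) N, g l) := by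
  rw [← Finset.sum_subtype_of_mem (p := fun l => s.natAbs ≤ l) g fun l hl => by
    rw [Finset.mem_Icc, max_le_iff] at hl; exact hl.1.1]
  exact hasSum_sum_of_ne_finset_zero fun l hl => h l.1 l.2 fun h' => hl (Finset.mem_subtype.2 h')

/-- The random variable `Γ̂_j` is a finite quadratic form in the real coefficients. -/
theorem exists_gammaHat_ae_eq (G : RandomSpinField s P) (hf : IsNeedletFilter f a)
    (hinv : G.Involutive) (j : ℤ) : ∃ I : Finset (Order s),
      (G.gammaHat f a j =ᵐ[P] fun ω => ∑ q ∈ I,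
        f (a ^ (2 * j) * eigen s q.1.1) ^ 2 * G.realCoeff q.1.1 q.1.2 ω ^ 2) ∧
      HasSum (fun l : {l : ℕ // s.natAbs ≤ l} =>
          2 * f (a ^ (2 * j) * eigen s l.1) ^ 4 * G.spectrum l.1 ^ 2 * (2 * (l.1 : ℝ) + 1))
        (∑ q ∈ I, 2 * f (a ^ (2 * j) * eigen s q.1.1) ^ 4 * G.spectrum q.1.1 ^ 2) := by
  obtain ⟨N, hN⟩ := hf.exists_forall_eq_zero s j
  refine ⟨ordersUpTo s N, ?_, ?_⟩
  · have hall : ∀ᵐ ω ∂P, ∀ l ∈ Finset.Icc (max s.natAbs 1) N,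
        ∑ m ∈ Finset.Icc (-(l : ℤ)) (l : ℤ), ‖G.coeff l m ω‖ ^ 2 =
          ∑ m ∈ Finset.Icc (-(l : ℤ)) (l : ℤ), G.realCoeff l m ω ^ 2 := by
      rw [Finset.eventually_all]
      intro l hl
      rw [Finset.mem_Icc, max_le_iff] at hl
      exact G.sum_norm_coeff_sq hinv hl.1.1
    filter_upwards [hall] with ω hω
    rw [sum_ordersUpTo s N fun l m => f (a ^ (2 * j) * eigen s l) ^ 2 * G.realCoeff l m ω ^ 2,
      gammaHat]
    refine (hasSum_of_forall_eq_zero (N := N) (g := fun l => ∑ m ∈ Finset.Icc (-(l : ℤ)) (l : ℤ),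
      f (a ^ (2 * j) * eigen s l) ^ 2 * ‖G.coeff l m ω‖ ^ 2) fun l hl h => ?_).tsum_eq.trans ?_
    · simp [hN l hl h]
    · refine Finset.sum_congr rfl fun l hl => ?_
      rw [← Finset.mul_sum, ← Finset.mul_sum, hω l hl]
  · rw [sum_ordersUpTo s N fun l _ => 2 * f (a ^ (2 * j) * eigen s l) ^ 4 * G.spectrum l ^ 2]
    convert hasSum_of_forall_eq_zero (s := s) (N := N)
      (g := fun l => 2 * f (a ^ (2 * j) * eigen s l) ^ 4 * G.spectrum l ^ 2 * (2 * (l : ℝ) + 1))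
      fun l hl h => ?_ using 1
    · refine Finset.sum_congr rfl fun l _ => ?_
      rw [Finset.sum_const, Int.card_Icc, nsmul_eq_mul, mul_comm]
      congr 1
      have : ((l : ℤ) + 1 - -(l : ℤ)).toNat = 2 * l + 1 := by omega
      rw [this]
      push_cast
      ring
    · simp [hN l hl h]

variable [IsProbabilityMeasure P]

theorem aemeasurable_realCoeff (G : RandomSpinField s P) (q : Order s) :
    AEMeasurable (G.realCoeff q.1.1 q.1.2) P :=
  (G.memLp_realCoeff q.2.1 q.2.2.2).aestronglyMeasurable.aemeasurable

section QuadraticForm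

variable (G : RandomSpinField s P) (hG : G.Isotropic) (hgauss : G.Gaussian) (hinv : G.Involutive)
  (I : Finset (Order s)) (w : ℕ → ℝ)

include hG hgauss hinv

theorem memLp_sum_mul_realCoeff_sq :
    MemLp (fun ω => ∑ q ∈ I, w q.1.1 * G.realCoeff q.1.1 q.1.2 ω ^ 2) 2 P :=
  memLp_finsetSum _ fun q _ => (memLp_sq_of_map_gaussianReal (G.aemeasurable_realCoeff q)
    (G.map_realCoeff hG hgauss hinv q)).const_mul _

theorem integral_sum_mul_realCoeff_sq :
    ∫ ω, ∑ q ∈ I, w q.1.1 * G.realCoeff q.1.1 q.1.2 ω ^ 2 ∂P =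
      ∑ q ∈ I, w q.1.1 * G.spectrum q.1.1 := by
  rw [integral_finsetSum _ fun q _ => ((memLp_sq_of_map_gaussianReal (G.aemeasurable_realCoeff q)
    (G.map_realCoeff hG hgauss hinv q)).integrable (by norm_num)).const_mul _]
  refine Finset.sum_congr rfl fun q _ => ?_
  rw [integral_const_mul, integral_sq_of_map_gaussianReal (G.aemeasurable_realCoeff q)
    (G.spectrum_nonneg _) (G.map_realCoeff hG hgauss hinv q)]

theorem variance_sum_mul_realCoeff_sq :
    Var[fun ω => ∑ q ∈ I, w q.1.1 * G.realCoeff q.1.1 q.1.2 ω ^ 2; P] =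
      ∑ q ∈ I, 2 * w q.1.1 ^ 2 * G.spectrum q.1.1 ^ 2 := by
  have h := IndepFun.variance_sum (μ := P) (s := I)
    (X := fun q ω => w q.1.1 * G.realCoeff q.1.1 q.1.2 ω ^ 2)
    (fun q _ => (memLp_sq_of_map_gaussianReal (G.aemeasurable_realCoeff q)
      (G.map_realCoeff hG hgauss hinv q)).const_mul _)
    (fun q _ q' _ hqq => ((G.iIndepFun_realCoeff hG hgauss hinv).indepFun hqq).comp
      (φ := fun x => w q.1.1 * x ^ 2) (ψ := fun x => w q'.1.1 * x ^ 2) (by fun_prop) (by fun_prop))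
  have e : (∑ q ∈ I, fun ω => w q.1.1 * G.realCoeff q.1.1 q.1.2 ω ^ 2) =
      fun ω => ∑ q ∈ I, w q.1.1 * G.realCoeff q.1.1 q.1.2 ω ^ 2 := by
    ext ω; simp
  rw [← e, h]
  refine Finset.sum_congr rfl fun q _ => ?_
  rw [variance_const_mul, variance_sq_of_map_gaussianReal (G.aemeasurable_realCoeff q)
    (G.spectrum_nonneg _) (G.map_realCoeff hG hgauss hinv q)]
  ring

theorem iIndepFun_standardized :
    iIndepFun (fun (q : Order s) ω =>
      (G.realCoeff q.1.1 q.1.2 ω ^ 2 / G.spectrum q.1.1 - 1) / Real.sqrt 2) P :=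
  (G.iIndepFun_realCoeff hG hgauss hinv).comp
    (fun q x => (x ^ 2 / G.spectrum q.1.1 - 1) / Real.sqrt 2) fun q => by fun_prop

end QuadraticForm

theorem tendstoInDistribution_of_charFun {κ : Type*} {l : Filter κ} [l.IsCountablyGenerated]
    {X : κ → Ω → ℝ} (hX : ∀ k, AEMeasurable (X k) P)
    (h : ∀ t, Tendsto (fun k => charFun (P.map (X k)) t) l
      (𝓝 (Complex.exp (-(t ^ 2 / 2 : ℝ))))) :
    TendstoInDistribution X l (id : ℝ → ℝ) (fun _ => P) (gaussianReal 0 1) where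
  forall_aemeasurable := hX
  aemeasurable_limit := aemeasurable_id
  tendsto := by
    -- Lévy's continuity theorem is used along sequences, which suffices for a countably generated
    -- filter.
    refine tendsto_of_seq_tendsto fun u hu => ?_
    refine ProbabilityMeasure.tendsto_iff_tendsto_charFun.2 fun t => ?_
    have e : charFun ((gaussianReal 0 1).map id) t = Complex.exp (-(t ^ 2 / 2 : ℝ)) := by
      simp [charFun_gaussianReal]
    simp only [ProbabilityMeasure.coe_mk]
    rw [e]
    exact (h t).comp hu

end RandomSpinField

end SpinField

/-! ### The main theorem. -/

theorem proposition8p2 {Ω : Type*} [MeasurableSpace Ω] (P : Measure Ω) [IsProbabilityMeasure P]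
    (s : ℤ) (f : ℝ → ℝ) (a : ℝ) (hf : IsNeedletFilter f a)
    (G : RandomSpinField s P) (hiso : G.Isotropic) (hgauss : G.Gaussian) (hinv : G.Involutive) :
    -- the power spectrum does not depend on the order `m`
    (∀ l : ℕ, s.natAbs ≤ l → ∀ m : ℤ, |m| ≤ l →
      ∫ ω, ‖G.coeff l m ω‖ ^ 2 ∂P = G.spectrum l) ∧
    -- the variance
    (∀ j : ℤ, MemLp (G.gammaHat f a j) 2 P ∧
      HasSum (fun l : {l : ℕ // s.natAbs ≤ l} =>
          2 * f (a ^ (2 * j) * eigen s l.1) ^ 4 * G.spectrum l.1 ^ 2 * (2 * (l.1 : ℝ) + 1))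
        (Var[G.gammaHat f a j; P])) ∧
    -- the central limit theorem
    (∀ c C α : ℝ, 0 < c → 0 < C → 2 < α →
      (∀ l : ℕ, s.natAbs ≤ l → 0 < l →
        c * (l : ℝ) ^ (-α) ≤ G.spectrum l ∧ G.spectrum l ≤ C * (l : ℝ) ^ (-α)) →
      TendstoInDistribution
        (fun (j : ℤ) (ω : Ω) =>
          (G.gammaHat f a j ω - P[G.gammaHat f a j]) / Real.sqrt (Var[G.gammaHat f a j; P]))
        atBot (id : ℝ → ℝ) (fun _ => P) (gaussianReal 0 1)) := by
  choose I hI hsum using G.exists_gammaHat_ae_eq hf hinv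
  have hvar : ∀ j, Var[G.gammaHat f a j; P] =
      ∑ q ∈ I j, 2 * f (a ^ (2 * j) * eigen s q.1.1) ^ 4 * G.spectrum q.1.1 ^ 2 := fun j => by
    rw [variance_congr (hI j), G.variance_sum_mul_realCoeff_sq hiso hgauss hinv (I j)
      fun l => f (a ^ (2 * j) * eigen s l) ^ 2]
    exact Finset.sum_congr rfl fun q _ => by ring
  have hmem : ∀ j, MemLp (G.gammaHat f a j) 2 P := fun j =>
    (memLp_congr_ae (hI j)).2 (G.memLp_sum_mul_realCoeff_sq hiso hgauss hinv (I j)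
      fun l => f (a ^ (2 * j) * eigen s l) ^ 2)
  have hhas : ∀ j, HasSum (fun l : {l : ℕ // s.natAbs ≤ l} =>
      2 * f (a ^ (2 * j) * eigen s l.1) ^ 4 * G.spectrum l.1 ^ 2 * (2 * (l.1 : ℝ) + 1))
      (Var[G.gammaHat f a j; P]) := fun j => by rw [hvar]; exact hsum j
  refine ⟨fun l hl m hm => G.integral_norm_coeff_sq hiso hl hm, fun j => ⟨hmem j, hhas j⟩, ?_⟩
  intro c C α hc hC hα hS
  -- The lower bound on the spectrum allows each squared coefficient to be divided by its mean, so
  -- that all summands acquire the same law.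
  have hspec : ∀ q : RandomSpinField.Order s, 0 < G.spectrum q.1.1 := fun q => by
    have h0 : (0 : ℝ) < q.1.1 := by exact_mod_cast q.2.2.1
    exact lt_of_lt_of_le (by positivity) (hS _ q.2.1 q.2.2.1).1
  obtain ⟨b, hb0, hb⟩ := hf.exists_tendsto_forall_abs_weight_le hc hC (by linarith) hS hhas
  refine RandomSpinField.tendstoInDistribution_of_charFun (fun j =>
    ((hmem j).aestronglyMeasurable.aemeasurable.sub_const _).div_const _) fun t => ?_
  have h2 : Real.sqrt 2 ^ 2 = 2 := Real.sq_sqrt (by norm_num)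
  have h20 : Real.sqrt 2 ≠ 0 := by positivity
  -- Since `X² - C_l = √2 C_l ξ` with `ξ` standardized, the weight of `ξ` is `√2 f² C_l / √Var`. The
  -- variance formula says precisely that the squares of these weights sum to `1`.
  have hlim := tendsto_charFun_weighted_sum (P := P) (l := atBot)
    integral_standardizedChiSq integral_sq_standardizedChiSq
    (X := fun (q : RandomSpinField.Order s) ω =>
      (G.realCoeff q.1.1 q.1.2 ω ^ 2 / G.spectrum q.1.1 - 1) / Real.sqrt 2)
    (fun q => (((G.aemeasurable_realCoeff q).pow_const 2).div_const _).sub_const 1 |>.div_const _)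
    (fun q => map_standardized_sq (G.aemeasurable_realCoeff q) (hspec q)
      (G.map_realCoeff hiso hgauss hinv q))
    (G.iIndepFun_standardized hiso hgauss hinv) (I := I) (b := b)
    (c := fun j q => Real.sqrt 2 * f (a ^ (2 * j) * eigen s q.1.1) ^ 2 * G.spectrum q.1.1 /
      Real.sqrt (Var[G.gammaHat f a j; P]))
    (hb.mono fun j hj => ?_) (hb.mono fun j hj q _ => hj.2 _ q.2.1 q.2.2.1) hb0 t
  · refine hlim.congr fun j => ?_
    congr 1
    refine Measure.map_congr ?_
    filter_upwards [hI j] with ω hω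
    rw [hω, integral_congr_ae (hI j), G.integral_sum_mul_realCoeff_sq hiso hgauss hinv (I j)
      fun l => f (a ^ (2 * j) * eigen s l) ^ 2, ← Finset.sum_sub_distrib, Finset.sum_div]
    refine Finset.sum_congr rfl fun q _ => ?_
    have := (hspec q).ne'
    field_simp
  · simp only [div_pow, mul_pow, h2, Real.sq_sqrt hj.1.le]
    rw [← Finset.sum_div, div_eq_one_iff_eq hj.1.ne', hvar]
    exact Finset.sum_congr rfl fun q _ => by ring
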